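/- **Setting.** A GP 2 *host graph* is a finite directed graph (parallel edges and loops allowed) in which every node carries a list over $\mathbb Z\cup\mathrm{Char}^*$, a mark in $\{\mathtt{none},\mathtt{red},\mathtt{green},\mathtt{blue},\mathtt{grey}\}$ and a Boolean root flag, and every edge carries a list and a mark in $\{\mathtt{none},\mathtt{red},\mathtt{green},\mathtt{blue},\mathtt{dashed}\}$. GP 2 programs are built from calls of finite sets of conditional rule schemata $\langle L\leftarrow K\rightarrow R,\Gamma\rangle$ (applied at injective matches by natural double pushouts), $P;Q$, $\mathtt{if}\ C\ \mathtt{then}\ P\ \mathtt{else}\ Q$, $\mathtt{try}\ C\ \mathtt{then}\ P\ \mathtt{else}\ Q$, the loop $P!$, $P\ \mathtt{or}\ Q$, $\mathtt{break}$, $\mathtt{skip}$ and $\mathtt{fail}$, and $[\![P]\!]G$ is the set of outcomes (host graphs, $\mathrm{fail}$, $\bot$) of executing $P$ on $G$ under the small-step operational semantics of GP 2. The evaluation of expressions is total; integer division truncates towards zero, and by convention $a/0=0$. First-order formulas have node, edge and label variables (label variables of type list, atom, int, string or char), all of which can be quantified; their atoms are equations between node terms (node variables, and sources and targets of edges), between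 edges, and between list terms (which include node and edge labels), equations $\mathsf{m_V}(x)=m$ and $\mathsf{m_E}(x)=m$ for marks (where $m=\mathsf{any}$ means "not none"), comparisons of integer terms (with arithmetic, in- and outdegrees and lengths of label variables), typing predicates for label variables, $\mathsf{root}(x)$, and the edge predicate. A *precondition* is a closed first-order formula. A program is *loop-free* if it does not contain the loop construct $P!$. *Non-failing commands* are defined inductively: $\mathtt{break}$, $\mathtt{skip}$ and every loop $P!$ are non-failing; every call of a non-empty set of rule schemata (in particular of a single one) that have the empty graph as left-hand graph and no application condition (or one that is always true) is non-failing; if $P$ and $Q$ are non-failing, then so are $P;Q$, $\mathtt{if}\ C\ \mathtt{then}\ P\ \mathtt{else}\ Q$ and $\mathtt{try}\ C\ \mathtt{then}\ P\ \mathtt{else}\ Q$ for every command $C$. *Iteration commands* are defined inductively, sequential composition being read up to associativity: every loop-free program and every non-failing command is an iteration command, and $C;P$ is an iteration command if $C$ is a loop-free program and $P$ is an iteration command. An *assertion* is a predicate on host graphs. $\mathrm{SUCCESS}(P)$ holds on $G$ iff some host graph $H$ belongs to $[\![P]\!]G$, and $\mathrm{FAIL}(P)$ holds on $G$ iff $\mathrm{fail}\in[\![P]\!]G$.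 An assertion $d$ is a *liberal postcondition* with respect to $c$ and $P$ if, for all host graphs $G,H$, $G\models c$ and $H\in[\![P]\!]G$ imply $H\models d$; $\mathrm{SLP}(c,P)$ is the strongest such assertion, i.e. the liberal postcondition that implies every liberal postcondition with respect to $c$ and $P$. **Theorem.** 1. For every loop-free program $P$ there is a closed first-order formula $\mathrm{Success}(P)$ such that, for every host graph $G$, $G\models\mathrm{Success}(P)$ if and only if $G\models\mathrm{SUCCESS}(P)$; and for every precondition $c$ there is a closed first-order formula $\mathrm{Slp}(c,P)$ such that, for every host graph $G$, $G\models\mathrm{Slp}(c,P)$ if and only if $G\models\mathrm{SLP}(c,P)$. 2. For every iteration command $S$ there is a closed first-order formula $\mathrm{Fail}(S)$ such that, for every host graph $G$, $G\models\mathrm{Fail}(S)$ if and only if $G\models\mathrm{FAIL}(S)$. -/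

import Mathlib

open CategoryTheory

namespace GP2

/-! ### Host-graph labels -/

/-- The printable characters other than the double quote: ASCII 32, 33 and 35 to 126. -/
def Character : Type := {c : Char // 32 ≤ c.toNat ∧ c.toNat ≤ 126 ∧ c.toNat ≠ 34}

/-- Atoms: integers and character strings. -/
inductive Atom : Type
  | int (z : ℤ)
  | str (s : List Character)

/-- Host-graph lists: heterogeneous lists of integers and strings. -/
abbrev HList : Type := List Atom

inductive VMark : Type
  | none | red | green | blue | grey

inductive EMark : Type
  | none | red | green | blue | dashed

/-- Node marks together with the wildcard `any`. -/
inductive VPat : Type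
  | mark (m : VMark)
  | any

/-- Edge marks together with the wildcard `any`. -/
inductive EPat : Type
  | mark (m : EMark)
  | any

/-- The wildcard `any` stands for an arbitrary mark other than `none`. -/
def VPat.Matches : VPat → VMark → Prop
  | .mark m, m' => m' = m
  | .any, m' => m' ≠ .none

def EPat.Matches : EPat → EMark → Prop
  | .mark m, m' => m' = m
  | .any, m' => m' ≠ .none

/-- Replace the wildcard by the given mark. -/
def VPat.resolve : VPat → VMark → VMark
  | .mark m, _ => m
  | .any, m' => m'

def EPat.resolve : EPat → EMark → EMark
  | .mark m, _ => m
  | .any, m' => m'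

/-- The five types of label variables. -/
inductive LSort : Type
  | list | atom | int | string | char

/-- The domain of each type of label variables. -/
def LSort.Dom : LSort → Type
  | .list => HList
  | .atom => Atom
  | .int => ℤ
  | .string => List Character
  | .char => Character

/-- The inclusions of the domains in the domain of lists: a list or a string of length one is
identified with its content. -/
def LSort.toHList : (s : LSort) → s.Dom → HList
  | .list, l => l
  | .atom, a => [a]
  | .int, z => [.int z]
  | .string, w => [.str w]
  | .char, c => [.str [c]]

/-- An assignment of values to label variables; `X s` is the set of variables of type `s`. -/
abbrev LAssign (X : LSort → Type) : Type := (s : LSort) → X s → s.Dom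

/-! ### Host graphs -/

structure HostGraph : Type 1 where
  V : Type
  E : Type
  finV : Finite V
  finE : Finite E
  src : E → V
  tgt : E → V
  vList : V → HList
  vMark : V → VMark
  eList : E → HList
  eMark : E → EMark
  root : V → Bool

noncomputable def HostGraph.indeg (G : HostGraph) (v : G.V) : ℕ := Nat.card {e : G.E // G.tgt e = v}

noncomputable def HostGraph.outdeg (G : HostGraph) (v : G.V) : ℕ := Nat.card {e : G.E // G.src e = v}

/-! ### Expressions

`X s` is the set of label variables of type `s`, and `N` is the set of node identifiers (in rule
schemata) or of node terms (in formulas). -/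

inductive ArithOp : Type
  | add | sub | mul | div

/-- Integer division truncates towards zero; evaluation is total, with `a / 0 = 0`. -/
def ArithOp.eval : ArithOp → ℤ → ℤ → ℤ
  | .add, a, b => a + b
  | .sub, a, b => a - b
  | .mul, a, b => a * b
  | .div, a, b => Int.tdiv a b

inductive IntExp (X : LSort → Type) (N : Type) : Type
  | const (z : ℤ)
  | var (x : X .int)
  | op (o : ArithOp) (a b : IntExp X N)
  | indeg (n : N)
  | outdeg (n : N)
  | lengthAtom (x : X .atom)
  | lengthString (x : X .string)
  | lengthList (x : X .list)

inductive StrExp (X : LSort → Type) : Type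
  | lit (w : List Character)
  | charVar (x : X .char)
  | var (x : X .string)
  | concat (a b : StrExp X)

inductive AtomExp (X : LSort → Type) (N : Type) : Type
  | int (e : IntExp X N)
  | str (e : StrExp X)
  | var (x : X .atom)

inductive ListExp (X : LSort → Type) (N : Type) : Type
  | empty
  | atom (e : AtomExp X N)
  | append (a b : ListExp X N)
  | var (x : X .list)

/-- The length of an atom: that of the string, or 1 (the length of the one-element list) for an
integer. -/
def Atom.length : Atom → ℕ
  | .int _ => 1
  | .str w => w.length

section Eval

variable {X : LSort → Type} {N : Type}

noncomputable def IntExp.eval (G : HostGraph) (ν : N → G.V) (α : LAssign X) : IntExp X N → ℤ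
  | .const z => z
  | .var x => α .int x
  | .op o a b => o.eval (a.eval G ν α) (b.eval G ν α)
  | .indeg n => G.indeg (ν n)
  | .outdeg n => G.outdeg (ν n)
  | .lengthAtom x => (Atom.length (α .atom x) : ℤ)
  | .lengthString x => (List.length (α := Character) (α .string x) : ℤ)
  | .lengthList x => (List.length (α := Atom) (α .list x) : ℤ)

def StrExp.eval (α : LAssign X) : StrExp X → List Character
  | .lit w => w
  | .charVar x => [α .char x]
  | .var x => α .string x
  | .concat a b => a.eval α ++ b.eval α

noncomputable def AtomExp.eval (G : HostGraph) (ν : N → G.V) (α : LAssign X) : AtomExp X N → Atom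
  | .int e => .int (e.eval G ν α)
  | .str e => .str (e.eval α)
  | .var x => α .atom x

noncomputable def ListExp.eval (G : HostGraph) (ν : N → G.V) (α : LAssign X) : ListExp X N → HList
  | .empty => []
  | .atom e => [e.eval G ν α]
  | .append a b => a.eval G ν α ++ b.eval G ν α
  | .var x => α .list x

/-! Variables that occur in an expression, and simple expressions. -/

def IntExp.vars : IntExp X N → Set (Σ s, X s)
  | .const _ => ∅
  | .var x => {⟨_, x⟩}
  | .op _ a b => a.vars ∪ b.vars
  | .indeg _ => ∅
  | .outdeg _ => ∅
  | .lengthAtom x => {⟨_, x⟩}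
  | .lengthString x => {⟨_, x⟩}
  | .lengthList x => {⟨_, x⟩}

def StrExp.vars : StrExp X → Set (Σ s, X s)
  | .lit _ => ∅
  | .charVar x => {⟨_, x⟩}
  | .var x => {⟨_, x⟩}
  | .concat a b => a.vars ∪ b.vars

def AtomExp.vars : AtomExp X N → Set (Σ s, X s)
  | .int e => e.vars
  | .str e => e.vars
  | .var x => {⟨_, x⟩}

def ListExp.vars : ListExp X N → Set (Σ s, X s)
  | .empty => ∅
  | .atom e => e.vars
  | .append a b => a.vars ∪ b.vars
  | .var x => {⟨_, x⟩}

/-- No arithmetic operator occurs. -/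
def IntExp.NoArith : IntExp X N → Prop
  | .op _ _ _ => False
  | _ => True

/-- The number of occurrences of list variables. -/
def IntExp.listVarCount : IntExp X N → ℕ
  | .op _ a b => a.listVarCount + b.listVarCount
  | .lengthList _ => 1
  | _ => 0

/-- The number of occurrences of string variables. -/
def StrExp.strVarCount : StrExp X → ℕ
  | .var _ => 1
  | .concat a b => a.strVarCount + b.strVarCount
  | _ => 0

def AtomExp.NoArith : AtomExp X N → Prop
  | .int e => e.NoArith
  | _ => True

def AtomExp.listVarCount : AtomExp X N → ℕ
  | .int e => e.listVarCount
  | _ => 0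

def ListExp.NoArith : ListExp X N → Prop
  | .atom e => e.NoArith
  | .append a b => a.NoArith ∧ b.NoArith
  | _ => True

def ListExp.listVarCount : ListExp X N → ℕ
  | .atom e => e.listVarCount
  | .append a b => a.listVarCount + b.listVarCount
  | .var _ => 1
  | _ => 0

/-- Every string subexpression has at most one occurrence of a string variable. -/
def ListExp.StrSimple : ListExp X N → Prop
  | .atom (.str e) => e.strVarCount ≤ 1
  | .append a b => a.StrSimple ∧ b.StrSimple
  | _ => True

def ListExp.Simple (e : ListExp X N) : Prop :=
  e.NoArith ∧ e.listVarCount ≤ 1 ∧ e.StrSimple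

end Eval

/-! ### Predicates on labels -/

/-- The typing predicates. -/
inductive TypePred : Type
  | int | char | string | atom

def TypePred.Holds : TypePred → HList → Prop
  | .int, l => ∃ z, l = [.int z]
  | .char, l => ∃ c, l = [.str [c]]
  | .string, l => ∃ w, l = [.str w]
  | .atom, l => ∃ a, l = [a]

inductive Cmp : Type
  | gt | ge | lt | le

def Cmp.Holds : Cmp → ℤ → ℤ → Prop
  | .gt, a, b => a > b
  | .ge, a, b => a ≥ b
  | .lt, a, b => a < b
  | .le, a, b => a ≤ b

/-- There is an edge from `u` to `v`; a list or a mark that is given has to be that of the edge. -/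
def HostGraph.HasEdge (G : HostGraph) (u v : G.V) (l : Option HList) (m : Option EPat) : Prop :=
  ∃ e : G.E, G.src e = u ∧ G.tgt e = v ∧ (∀ l' ∈ l, G.eList e = l') ∧
    (∀ p ∈ m, p.Matches (G.eMark e))

/-! ### First-order formulas

Formulas are represented up to renaming of bound variables. `Formula N E X` is the set of formulas
whose free node variables belong to `N`, whose free edge variables belong to `E` and whose free label
variables of type `s` belong to `X s`. A quantifier adds one new element (the bound variable) to the
corresponding set. The inequality `t ≠ t'` is the negation of `t = t'`. -/

/-- The label variables `X` together with a new variable of type `s`. -/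
inductive Ext (X : LSort → Type) (s : LSort) : LSort → Type
  | old {t : LSort} (x : X t) : Ext X s t
  | new : Ext X s s

def Ext.assign {X : LSort → Type} {s : LSort} (α : LAssign X) (d : s.Dom) : LAssign (Ext X s)
  | _, .old x => α _ x
  | _, .new => d

/-- Node terms: node variables, and sources and targets of edge variables. -/
inductive NodeTerm (N E : Type) : Type
  | var (x : N)
  | src (e : E)
  | tgt (e : E)

def NodeTerm.eval {N E : Type} (G : HostGraph) (ν : N → G.V) (ε : E → G.E) : NodeTerm N E → G.V
  | .var x => ν x
  | .src e => G.src (ε e)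
  | .tgt e => G.tgt (ε e)

/-- List terms. -/
inductive Lst (N E : Type) (X : LSort → Type) : Type
  | empty
  | atom (e : AtomExp X (NodeTerm N E))
  | append (a b : Lst N E X)
  | var (x : X .list)
  | nodeLabel (t : NodeTerm N E)
  | edgeLabel (e : E)

noncomputable def Lst.eval {N E : Type} {X : LSort → Type} (G : HostGraph) (ν : N → G.V)
    (ε : E → G.E) (α : LAssign X) : Lst N E X → HList
  | .empty => []
  | .atom e => [e.eval G (NodeTerm.eval G ν ε) α]
  | .append a b => a.eval G ν ε α ++ b.eval G ν ε α
  | .var x => α .list x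
  | .nodeLabel t => G.vList (t.eval G ν ε)
  | .edgeLabel e => G.eList (ε e)

inductive Formula : (N E : Type) → (X : LSort → Type) → Type 1
  | tt {N E : Type} {X : LSort → Type} : Formula N E X
  | ff {N E : Type} {X : LSort → Type} : Formula N E X
  | typed {N E : Type} {X : LSort → Type} (p : TypePred) (s : LSort) (x : X s) : Formula N E X
  | cmp {N E : Type} {X : LSort → Type} (o : Cmp) (a b : IntExp X (NodeTerm N E)) : Formula N E X
  | edge {N E : Type} {X : LSort → Type} (t u : NodeTerm N E) (l : Option (Lst N E X))
      (m : Option EPat) : Formula N E X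
  | root {N E : Type} {X : LSort → Type} (t : NodeTerm N E) : Formula N E X
  | nodeEq {N E : Type} {X : LSort → Type} (t u : NodeTerm N E) : Formula N E X
  | edgeEq {N E : Type} {X : LSort → Type} (e f : E) : Formula N E X
  | lstEq {N E : Type} {X : LSort → Type} (a b : Lst N E X) : Formula N E X
  | nodeMarkEq {N E : Type} {X : LSort → Type} (t : NodeTerm N E) (m : VPat) : Formula N E X
  | edgeMarkEq {N E : Type} {X : LSort → Type} (e : E) (m : EPat) : Formula N E X
  | and {N E : Type} {X : LSort → Type} (φ ψ : Formula N E X) : Formula N E X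
  | or {N E : Type} {X : LSort → Type} (φ ψ : Formula N E X) : Formula N E X
  | not {N E : Type} {X : LSort → Type} (φ : Formula N E X) : Formula N E X
  | existsV {N E : Type} {X : LSort → Type} (φ : Formula (Option N) E X) : Formula N E X
  | existsE {N E : Type} {X : LSort → Type} (φ : Formula N (Option E) X) : Formula N E X
  | existsL {N E : Type} {X : LSort → Type} (s : LSort) (φ : Formula N E (Ext X s)) : Formula N E X

/-- Satisfaction of a formula in a host graph by an assignment of its free variables. -/
def Formula.Sat (G : HostGraph) : {N E : Type} → {X : LSort → Type} → Formula N E X →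
    (N → G.V) → (E → G.E) → LAssign X → Prop
  | _, _, _, .tt, _, _, _ => True
  | _, _, _, .ff, _, _, _ => False
  | _, _, _, .typed p s x, _, _, α => p.Holds (s.toHList (α s x))
  | _, _, _, .cmp o a b, ν, ε, α =>
      o.Holds (a.eval G (NodeTerm.eval G ν ε) α) (b.eval G (NodeTerm.eval G ν ε) α)
  | _, _, _, .edge t u l m, ν, ε, α =>
      G.HasEdge (t.eval G ν ε) (u.eval G ν ε) (l.map (Lst.eval G ν ε α)) m
  | _, _, _, .root t, ν, ε, _ => G.root (t.eval G ν ε) = true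
  | _, _, _, .nodeEq t u, ν, ε, _ => t.eval G ν ε = u.eval G ν ε
  | _, _, _, .edgeEq e f, _, ε, _ => ε e = ε f
  | _, _, _, .lstEq a b, ν, ε, α => a.eval G ν ε α = b.eval G ν ε α
  | _, _, _, .nodeMarkEq t m, ν, ε, _ => m.Matches (G.vMark (t.eval G ν ε))
  | _, _, _, .edgeMarkEq e m, _, ε, _ => m.Matches (G.eMark (ε e))
  | _, _, _, .and φ ψ, ν, ε, α => φ.Sat G ν ε α ∧ ψ.Sat G ν ε α
  | _, _, _, .or φ ψ, ν, ε, α => φ.Sat G ν ε α ∨ ψ.Sat G ν ε α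
  | _, _, _, .not φ, ν, ε, α => ¬ φ.Sat G ν ε α
  | _, _, _, .existsV φ, ν, ε, α => ∃ v : G.V, φ.Sat G (fun x => x.elim v ν) ε α
  | _, _, _, .existsE φ, ν, ε, α => ∃ e : G.E, φ.Sat G ν (fun x => x.elim e ε) α
  | _, _, _, .existsL s φ, ν, ε, α => ∃ d : s.Dom, φ.Sat G ν ε (Ext.assign α d)

/-- A host graph satisfies a formula if some assignment of its free variables does. -/
def HostGraph.Models (G : HostGraph) {N E : Type} {X : LSort → Type} (φ : Formula N E X) : Prop :=
  ∃ (ν : N → G.V) (ε : E → G.E) (α : LAssign X), φ.Sat G ν ε α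

/-- Closed formulas. -/
abbrev ClosedFormula : Type 1 := Formula Empty Empty (fun _ => Empty)

/-! ### Partially labelled graphs and their morphisms -/

/-- Graphs in which the label (list and mark) and the rootedness of a node may be undefined. -/
structure PGraph : Type 1 where
  V : Type
  E : Type
  finV : Finite V
  finE : Finite E
  src : E → V
  tgt : E → V
  vLabel : V → Option (HList × VMark)
  eLabel : E → HList × EMark
  root : V → Option Bool

/-- Graph morphisms preserve sources, targets, labels, roots and non-roots (where defined). -/
@[ext]
structure PGraph.Hom (G H : PGraph) : Type where
  onV : G.V → H.V
  onE : G.E → H.E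
  src_comm : ∀ e, H.src (onE e) = onV (G.src e)
  tgt_comm : ∀ e, H.tgt (onE e) = onV (G.tgt e)
  vLabel_comm : ∀ v, ∀ l ∈ G.vLabel v, H.vLabel (onV v) = some l
  eLabel_comm : ∀ e, H.eLabel (onE e) = G.eLabel e
  root_comm : ∀ v, ∀ b ∈ G.root v, H.root (onV v) = some b

instance : Category PGraph where
  Hom := PGraph.Hom
  id G :=
    { onV := id
      onE := id
      src_comm := fun _ => rfl
      tgt_comm := fun _ => rfl
      vLabel_comm := fun _ _ h => h
      eLabel_comm := fun _ => rfl
      root_comm := fun _ _ h => h }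
  comp f g :=
    { onV := g.onV ∘ f.onV
      onE := g.onE ∘ f.onE
      src_comm := fun e => by simp [g.src_comm, f.src_comm]
      tgt_comm := fun e => by simp [g.tgt_comm, f.tgt_comm]
      vLabel_comm := fun v l h => g.vLabel_comm _ l (f.vLabel_comm v l h)
      eLabel_comm := fun e => by simp [g.eLabel_comm, f.eLabel_comm]
      root_comm := fun v b h => g.root_comm _ b (f.root_comm v b h) }

/-- A host graph is a graph all of whose labels and roots are defined. -/
def HostGraph.toPGraph (G : HostGraph) : PGraph where
  V := G.V
  E := G.E
  finV := G.finV
  finE := G.finE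
  src := G.src
  tgt := G.tgt
  vLabel v := some (G.vList v, G.vMark v)
  eLabel e := (G.eList e, G.eMark e)
  root v := some (G.root v)

/-- A commuting square that is a pushout and also a pullback. -/
def IsNaturalPushout {A B C D : PGraph} (f : A ⟶ B) (g : A ⟶ C) (h : B ⟶ D) (k : C ⟶ D) : Prop :=
  IsPushout f g h k ∧ IsPullback f g h k

/-! ### Conditional rule schemata -/

/-- The label variables of rule schemata: countably many of each type. -/
abbrev RVar : LSort → Type := fun _ => ℕ

/-- Total rule graphs with nodes `V` and edges `E`; the node identifiers in expressions are taken
from `I`. -/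
structure RuleGraph (I V E : Type) : Type where
  src : E → V
  tgt : E → V
  vList : V → ListExp RVar I
  vMark : V → VPat
  eList : E → ListExp RVar I
  eMark : E → EPat
  root : V → Bool

def RuleGraph.vars {I V E : Type} (M : RuleGraph I V E) : Set (Σ s, RVar s) :=
  (⋃ v, (M.vList v).vars) ∪ ⋃ e, (M.eList e).vars

/-- Application conditions with node identifiers from `I`. -/
inductive RuleCond (I : Type) : Type
  | typed (p : TypePred) (s : LSort) (x : RVar s)
  | listEq (a b : ListExp RVar I)
  | listNe (a b : ListExp RVar I)
  | cmp (o : Cmp) (a b : IntExp RVar I)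
  | edge (u v : I)
  | edgeList (u v : I) (l : ListExp RVar I)
  | edgeListMark (u v : I) (l : ListExp RVar I) (m : EPat)
  | not (c : RuleCond I)
  | and (c d : RuleCond I)
  | or (c d : RuleCond I)

def RuleCond.vars {I : Type} : RuleCond I → Set (Σ s, RVar s)
  | .typed _ s x => {⟨s, x⟩}
  | .listEq a b => a.vars ∪ b.vars
  | .listNe a b => a.vars ∪ b.vars
  | .cmp _ a b => a.vars ∪ b.vars
  | .edge _ _ => ∅
  | .edgeList _ _ l => l.vars
  | .edgeListMark _ _ l _ => l.vars
  | .not c => c.vars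
  | .and c d => c.vars ∪ d.vars
  | .or c d => c.vars ∪ d.vars

def RuleCond.Holds {I : Type} (G : HostGraph) (g : I → G.V) (α : LAssign RVar) : RuleCond I → Prop
  | .typed p s x => p.Holds (s.toHList (α s x))
  | .listEq a b => a.eval G g α = b.eval G g α
  | .listNe a b => a.eval G g α ≠ b.eval G g α
  | .cmp o a b => o.Holds (a.eval G g α) (b.eval G g α)
  | .edge u v => G.HasEdge (g u) (g v) none none
  | .edgeList u v l => G.HasEdge (g u) (g v) (some (l.eval G g α)) none
  | .edgeListMark u v l m => G.HasEdge (g u) (g v) (some (l.eval G g α)) (some m)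
  | .not c => ¬ c.Holds G g α
  | .and c d => c.Holds G g α ∧ d.Holds G g α
  | .or c d => c.Holds G g α ∨ d.Holds G g α

/-- Conditional rule schemata `⟨L ← K → R, Γ⟩`. Nodes and edges are named by natural numbers, and the
interface `K` consists of nodes that belong to both `L` and `R`. Node identifiers in expressions refer
to nodes of `L`. -/
structure RuleSchema : Type where
  VL : Finset ℕ
  EL : Finset ℕ
  VR : Finset ℕ
  ER : Finset ℕ
  K : Finset ℕ
  K_sub_L : K ⊆ VL
  K_sub_R : K ⊆ VR
  L : RuleGraph VL VL EL
  R : RuleGraph VL VR ER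
  cond : RuleCond VL
  simple_vL : ∀ v, (L.vList v).Simple
  simple_eL : ∀ e, (L.eList e).Simple
  vars_R : R.vars ⊆ L.vars
  vars_cond : cond.vars ⊆ L.vars
  /-- A wildcard in `R` takes its value from the wildcard of the same item in `L`. -/
  any_vR : ∀ v : VR, R.vMark v = .any → ∃ h : v.1 ∈ VL, L.vMark ⟨v.1, h⟩ = .any
  any_eR : ∀ e : ER, R.eMark e = .any → ∃ h : e.1 ∈ EL, L.eMark ⟨e.1, h⟩ = .any

/-- Premorphisms from the left-hand graph to a host graph preserve sources, targets, roots and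
non-roots, but not necessarily labels. -/
structure RuleSchema.Premorphism (r : RuleSchema) (G : HostGraph) : Type where
  onV : r.VL → G.V
  onE : r.EL → G.E
  src_comm : ∀ e, G.src (onE e) = onV (r.L.src e)
  tgt_comm : ∀ e, G.tgt (onE e) = onV (r.L.tgt e)
  root_comm : ∀ v, G.root (onV v) = r.L.root v

def RuleSchema.Premorphism.Injective {r : RuleSchema} {G : HostGraph} (g : r.Premorphism G) : Prop :=
  Function.Injective g.onV ∧ Function.Injective g.onE

/-- Label assignments for `L`. Only the values at variables that occur in `L` and at items marked
with `any` matter. -/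
structure RuleSchema.LabelAssignment (r : RuleSchema) : Type where
  val : LAssign RVar
  muV : r.VL → {m : VMark // m ≠ .none}
  muE : r.EL → {m : EMark // m ≠ .none}

/-- The left-hand instance: expressions are evaluated in `G`, wildcards are replaced. -/
noncomputable def RuleSchema.instL (r : RuleSchema) {G : HostGraph} (g : r.Premorphism G)
    (α : r.LabelAssignment) : HostGraph where
  V := r.VL
  E := r.EL
  finV := inferInstance
  finE := inferInstance
  src := r.L.src
  tgt := r.L.tgt
  vList v := (r.L.vList v).eval G g.onV α.val
  vMark v := (r.L.vMark v).resolve (α.muV v).1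
  eList e := (r.L.eList e).eval G g.onV α.val
  eMark e := (r.L.eMark e).resolve (α.muE e).1
  root := r.L.root

/-- The right-hand instance. -/
noncomputable def RuleSchema.instR (r : RuleSchema) {G : HostGraph} (g : r.Premorphism G)
    (α : r.LabelAssignment) : HostGraph where
  V := r.VR
  E := r.ER
  finV := inferInstance
  finE := inferInstance
  src := r.R.src
  tgt := r.R.tgt
  vList v := (r.R.vList v).eval G g.onV α.val
  vMark v := (r.R.vMark v).resolve (if h : v.1 ∈ r.VL then (α.muV ⟨v.1, h⟩).1 else .none)
  eList e := (r.R.eList e).eval G g.onV α.val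
  eMark e := (r.R.eMark e).resolve (if h : e.1 ∈ r.EL then (α.muE ⟨e.1, h⟩).1 else .none)
  root := r.R.root

/-- The interface: nodes only, with labels and roots undefined. -/
def RuleSchema.interface (r : RuleSchema) : PGraph where
  V := r.K
  E := Empty
  finV := inferInstance
  finE := inferInstance
  src := Empty.elim
  tgt := Empty.elim
  vLabel _ := none
  eLabel := Empty.elim
  root _ := none

/-- The inclusion of the interface in the left-hand instance. -/
noncomputable def RuleSchema.inclL (r : RuleSchema) {G : HostGraph} (g : r.Premorphism G)
    (α : r.LabelAssignment) : r.interface ⟶ (r.instL g α).toPGraph :=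
  PGraph.Hom.mk (G := r.interface) (H := (r.instL g α).toPGraph)
    (fun k : r.K => (⟨k.1, r.K_sub_L k.2⟩ : r.VL)) Empty.elim (fun e => e.elim) (fun e => e.elim)
    (fun _ _ h => by simp [RuleSchema.interface] at h) (fun e => e.elim)
    (fun _ _ h => by simp [RuleSchema.interface] at h)

/-- The inclusion of the interface in the right-hand instance. -/
noncomputable def RuleSchema.inclR (r : RuleSchema) {G : HostGraph} (g : r.Premorphism G)
    (α : r.LabelAssignment) : r.interface ⟶ (r.instR g α).toPGraph :=
  PGraph.Hom.mk (G := r.interface) (H := (r.instR g α).toPGraph)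
    (fun k : r.K => (⟨k.1, r.K_sub_R k.2⟩ : r.VR)) Empty.elim (fun e => e.elim) (fun e => e.elim)
    (fun _ _ h => by simp [RuleSchema.interface] at h) (fun e => e.elim)
    (fun _ _ h => by simp [RuleSchema.interface] at h)

/-- `G` directly derives `H` by `r` and `g`: for some label assignment, `g` is a label preserving
morphism on the left-hand instance, the application condition is true, and there is a natural double
pushout. -/
def RuleSchema.Derives (r : RuleSchema) (G H : HostGraph) (g : r.Premorphism G) : Prop :=
  ∃ (α : r.LabelAssignment) (m : (r.instL g α).toPGraph ⟶ G.toPGraph),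
    PGraph.Hom.onV m = g.onV ∧ PGraph.Hom.onE m = g.onE ∧
    r.cond.Holds G g.onV α.val ∧
    ∃ (D : PGraph) (k : r.interface ⟶ D) (d : D ⟶ G.toPGraph) (h : D ⟶ H.toPGraph)
      (m' : (r.instR g α).toPGraph ⟶ H.toPGraph),
      IsNaturalPushout (r.inclL g α) k m d ∧ IsNaturalPushout (r.inclR g α) k m' h

/-- The rule schema is unconditional, i.e. its application condition is always true. -/
def RuleSchema.Unconditional (r : RuleSchema) : Prop :=
  ∀ (G : HostGraph) (g : r.Premorphism G) (α : LAssign RVar), r.cond.Holds G g.onV α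

/-- `G ⇒ H` by some rule schema of the set. -/
def RuleSetDerives (rs : List RuleSchema) (G H : HostGraph) : Prop :=
  ∃ r ∈ rs, ∃ g : r.Premorphism G, g.Injective ∧ r.Derives G H g

/-! ### Programs -/

/-- Command sequences. Procedures are macros and are expanded; a call of a single rule schema is a
call of a one-element set; an omitted `then` or `else` part is `skip`. -/
inductive Com : Type
  | call (rs : List RuleSchema)
  | seq (P Q : Com)
  | ifte (C P Q : Com)
  | tryte (C P Q : Com)
  | loop (P : Com)
  | choice (P Q : Com)
  | brk
  | skip
  | fail

inductive Config : Type 1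
  | run (P : Com) (G : HostGraph)
  | graph (G : HostGraph)
  | fail

mutual

/-- The small-step operational semantics. -/
inductive Step : Config → Config → Prop
  | call₁ {rs : List RuleSchema} {G H : HostGraph} :
      RuleSetDerives rs G H → Step (.run (.call rs) G) (.graph H)
  | call₂ {rs : List RuleSchema} {G : HostGraph} :
      (¬ ∃ H, RuleSetDerives rs G H) → Step (.run (.call rs) G) .fail
  | seq₁ {P P' Q : Com} {G H : HostGraph} :
      Step (.run P G) (.run P' H) → Step (.run (.seq P Q) G) (.run (.seq P' Q) H)
  | seq₂ {P Q : Com} {G H : HostGraph} :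
      Step (.run P G) (.graph H) → Step (.run (.seq P Q) G) (.run Q H)
  | seq₃ {P Q : Com} {G : HostGraph} :
      Step (.run P G) .fail → Step (.run (.seq P Q) G) .fail
  | brk {P : Com} {G : HostGraph} : Step (.run (.seq .brk P) G) (.run .brk G)
  | if₁ {C P Q : Com} {G H : HostGraph} :
      Plus (.run C G) (.graph H) → Step (.run (.ifte C P Q) G) (.run P G)
  | if₂ {C P Q : Com} {G : HostGraph} :
      Plus (.run C G) .fail → Step (.run (.ifte C P Q) G) (.run Q G)
  | try₁ {C P Q : Com} {G H : HostGraph} :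
      Plus (.run C G) (.graph H) → Step (.run (.tryte C P Q) G) (.run P H)
  | try₂ {C P Q : Com} {G : HostGraph} :
      Plus (.run C G) .fail → Step (.run (.tryte C P Q) G) (.run Q G)
  | loop₁ {P : Com} {G H : HostGraph} :
      Plus (.run P G) (.graph H) → Step (.run (.loop P) G) (.run (.loop P) H)
  | loop₂ {P : Com} {G : HostGraph} :
      Plus (.run P G) .fail → Step (.run (.loop P) G) (.graph G)
  | loop₃ {P : Com} {G H : HostGraph} :
      Star (.run P G) (.run .brk H) → Step (.run (.loop P) G) (.graph H)
  | choice₁ {P Q : Com} {G : HostGraph} : Step (.run (.choice P Q) G) (.run P G)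
  | choice₂ {P Q : Com} {G : HostGraph} : Step (.run (.choice P Q) G) (.run Q G)
  | skip {G : HostGraph} : Step (.run .skip G) (.graph G)
  | fail {G : HostGraph} : Step (.run .fail G) .fail

/-- One or more steps. -/
inductive Plus : Config → Config → Prop
  | single {a b : Config} : Step a b → Plus a b
  | tail {a b c : Config} : Plus a b → Step b c → Plus a c

/-- Zero or more steps. -/
inductive Star : Config → Config → Prop
  | refl {a : Config} : Star a a
  | plus {a b : Config} : Plus a b → Star a b

end

theorem Plus.transGen : ∀ {a b : Config}, Plus a b → Relation.TransGen Step a b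
  | _, _, .single h => .single h
  | _, _, .tail h h' => .tail h.transGen h'

theorem plus_iff {a b : Config} : Plus a b ↔ Relation.TransGen Step a b := by
  refine ⟨Plus.transGen, fun h => ?_⟩
  induction h with
  | single h => exact .single h
  | tail _ h ih => exact .tail ih h

theorem star_iff {a b : Config} : Star a b ↔ Relation.ReflTransGen Step a b := by
  constructor
  · rintro (_ | h)
    · exact .refl
    · exact (plus_iff.1 h).to_reflTransGen
  · intro h
    rcases Relation.reflTransGen_iff_eq_or_transGen.1 h with rfl | h
    · exact .refl
    · exact .plus (plus_iff.2 h)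

inductive Outcome : Type 1
  | graph (H : HostGraph)
  | fail
  | bot

/-- The set of outcomes of `P` on `G`. The outcome `bot` stands for a run that diverges or gets stuck
(as when the guard of a branching command diverges). -/
def Com.sem (P : Com) (G : HostGraph) : Set Outcome :=
  {o | match o with
    | .graph H => Plus (.run P G) (.graph H)
    | .fail => Plus (.run P G) .fail
    | .bot =>
        (∃ f : ℕ → Config, f 0 = .run P G ∧ ∀ n, Step (f n) (f (n + 1))) ∨
        (∃ (Q : Com) (H : HostGraph), Star (.run P G) (.run Q H) ∧
          ¬ ∃ c, Step (.run Q H) c)}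

/-- No loop occurs in the program. -/
def Com.LoopFree : Com → Prop
  | .loop _ => False
  | .seq P Q => P.LoopFree ∧ Q.LoopFree
  | .ifte C P Q => C.LoopFree ∧ P.LoopFree ∧ Q.LoopFree
  | .tryte C P Q => C.LoopFree ∧ P.LoopFree ∧ Q.LoopFree
  | .choice P Q => P.LoopFree ∧ Q.LoopFree
  | _ => True

inductive Com.NonFailing : Com → Prop
  | brk : NonFailing .brk
  | skip : NonFailing .skip
  | call (rs : List RuleSchema) : rs ≠ [] → (∀ r ∈ rs, r.VL = ∅ ∧ r.Unconditional) →
      NonFailing (.call rs)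
  | loop (P : Com) : NonFailing (.loop P)
  | seq (P Q : Com) : NonFailing P → NonFailing Q → NonFailing (.seq P Q)
  | ifte (C P Q : Com) : NonFailing P → NonFailing Q → NonFailing (.ifte C P Q)
  | tryte (C P Q : Com) : NonFailing P → NonFailing Q → NonFailing (.tryte C P Q)

/-- Iteration commands. The last clause says that command sequences are read up to associativity
of sequential composition. -/
inductive Com.IsIteration : Com → Prop
  | loopFree (P : Com) : P.LoopFree → IsIteration P
  | nonFailing (P : Com) : P.NonFailing → IsIteration P
  | seq (C P : Com) : C.LoopFree → IsIteration P → IsIteration (.seq C P)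
  | assoc (P Q R : Com) : IsIteration (.seq P (.seq Q R)) → IsIteration (.seq (.seq P Q) R)

/-! ### Assertions -/

/-- Assertions: arbitrary predicates on host graphs. -/
abbrev Assertion : Type 1 := HostGraph → Prop

def IsLiberalPost (c : Assertion) (P : Com) (d : Assertion) : Prop :=
  ∀ G H : HostGraph, c G → Outcome.graph H ∈ P.sem G → d H

/-- `d` is the strongest liberal postcondition with respect to `c` and `P`. -/
def IsStrongestLiberalPost (c : Assertion) (P : Com) (d : Assertion) : Prop :=
  IsLiberalPost c P d ∧ ∀ d' : Assertion, IsLiberalPost c P d' → ∀ H : HostGraph, d H → d' H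

/-- The predicate SUCCESS. -/
def Com.Succeeds (P : Com) : Assertion := fun G => ∃ H : HostGraph, Outcome.graph H ∈ P.sem G

/-- The predicate FAIL. -/
def Com.Fails (P : Com) : Assertion := fun G => Outcome.fail ∈ P.sem G

end GP2

namespace GP2

/-! ### Definable predicates -/

-- The heart of the matter is one rule application. A direct derivation from `G` to `H` exists
-- exactly when `G` and `H` arise, up to isomorphism, by filling the holes of one and the same
-- context with the left-hand and the right-hand instance of the rule
-- (`RuleSchema.exists_derives_iff`). To see this, the natural pushouts that define derivations are
-- identified with concrete gluings (`PGraph.IsGluing`), by testing the universal properties against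
-- suitable graphs. The resulting description is symmetric in the two sides, so that preconditions
-- and postconditions can be computed by the same argument.
--
-- A first-order statement about the graph after a replacement translates into one about the graph
-- before it, with the match as a parameter (`Definable.transfers`). A quantified node or edge is
-- either an item outside the match or one of the finitely many inserted items, so a quantifier
-- turns into a quantifier together with a finite disjunction. Atoms about context items are
-- unchanged, those about inserted items are mostly decided by the inserted graph, and the degree of
-- an interface node changes by a known constant. The lists of the inserted items are not fixed in
-- advance: they are values of label variables, which `RuleSchema.Valid` equates with the values of
-- the rule's expressions in `G`.
--
-- The translation is an induction on the semantic class `Definable`, whose graph atoms speak about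
-- variables only; nested terms are eliminated by quantifying over their values. Formulas define
-- exactly the predicates of this class (`Formula.definable`, `Definable.exists_formula`). Since a
-- rule schema has finitely many items, relevant variables and wildcard values, the existence of a
-- match whose replacement satisfies a given formula is definable (`canReplace_definable`), and this
-- applies in both directions (`RuleSchema.pre_definable`, `RuleSchema.post_definable`).
--
-- The rest is structural induction on programs. For loop-free `P`, "some result of `P` satisfies
-- `p`" and "`P` can fail" are expressible together (`expressible_pre_fail`), because the failure of
-- `P; Q` is the failure of `P` or the possibility that `P` reaches a graph on which `Q` can fail.
-- Success is the case where `p` is true. The strongest liberal postcondition is the set of results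
-- of `P` on graphs satisfying `c`, treated in `expressible_post`. Iteration commands add only
-- non-failing commands, for which failure is expressed by falsity.

/-- Predicates on host graphs with assignments of node, edge and label variables. -/
abbrev Pred (N E : Type) (X : LSort → Type) : Type 1 :=
  (G : HostGraph) → (N → G.V) → (E → G.E) → LAssign X → Prop

/-- A condition on label variables that is expressed by formulas, uniformly in all contexts. -/
def PureDefinable {X : LSort → Type} (p : LAssign X → Prop) : Prop :=
  ∀ (N E : Type) (Y : LSort → Type) (ρ : ∀ s, X s → Y s), ∃ φ : Formula N E Y,
    ∀ (G : HostGraph) (ν : N → G.V) (ε : E → G.E) (α : LAssign Y),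
      φ.Sat G ν ε α ↔ p (fun s x => α s (ρ s x))

/-- The predicates generated from atoms without nested terms by first-order operations. -/
inductive Definable : ∀ {N E : Type} {X : LSort → Type}, Pred N E X → Prop
  | pure {N E : Type} {X : LSort → Type} (p : LAssign X → Prop) (h : PureDefinable p) :
      Definable (N := N) (E := E) (fun _ _ _ α => p α)
  | src {N E : Type} {X : LSort → Type} (e : E) (x : N) :
      Definable (X := X) (fun G ν ε _ => G.src (ε e) = ν x)
  | tgt {N E : Type} {X : LSort → Type} (e : E) (x : N) :
      Definable (X := X) (fun G ν ε _ => G.tgt (ε e) = ν x)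
  | nodeList {N E : Type} {X : LSort → Type} (x : N) (l : X .list) :
      Definable (E := E) (fun G ν _ α => G.vList (ν x) = α .list l)
  | edgeList {N E : Type} {X : LSort → Type} (e : E) (l : X .list) :
      Definable (N := N) (fun G _ ε α => G.eList (ε e) = α .list l)
  | indeg {N E : Type} {X : LSort → Type} (x : N) (z : X .int) :
      Definable (E := E) (fun G ν _ α => (G.indeg (ν x) : ℤ) = α .int z)
  | outdeg {N E : Type} {X : LSort → Type} (x : N) (z : X .int) :
      Definable (E := E) (fun G ν _ α => (G.outdeg (ν x) : ℤ) = α .int z)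
  | root {N E : Type} {X : LSort → Type} (x : N) :
      Definable (E := E) (X := X) (fun G ν _ _ => G.root (ν x) = true)
  | nodeMark {N E : Type} {X : LSort → Type} (x : N) (m : VPat) :
      Definable (E := E) (X := X) (fun G ν _ _ => m.Matches (G.vMark (ν x)))
  | edgeMark {N E : Type} {X : LSort → Type} (e : E) (m : EPat) :
      Definable (N := N) (X := X) (fun G _ ε _ => m.Matches (G.eMark (ε e)))
  | nodeEq {N E : Type} {X : LSort → Type} (x y : N) :
      Definable (E := E) (X := X) (fun _ ν _ _ => ν x = ν y)
  | edgeEq {N E : Type} {X : LSort → Type} (e f : E) :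
      Definable (N := N) (X := X) (fun _ _ ε _ => ε e = ε f)
  | and {N E : Type} {X : LSort → Type} {P Q : Pred N E X} : Definable P → Definable Q →
      Definable (fun G ν ε α => P G ν ε α ∧ Q G ν ε α)
  | not {N E : Type} {X : LSort → Type} {P : Pred N E X} : Definable P →
      Definable (fun G ν ε α => ¬ P G ν ε α)
  | existsV {N E : Type} {X : LSort → Type} {P : Pred (Option N) E X} : Definable P →
      Definable (fun G ν ε α => ∃ v : G.V, P G (fun x => x.elim v ν) ε α)
  | existsE {N E : Type} {X : LSort → Type} {P : Pred N (Option E) X} : Definable P →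
      Definable (fun G ν ε α => ∃ e : G.E, P G ν (fun x => x.elim e ε) α)
  | existsL {N E : Type} {X : LSort → Type} (s : LSort) {P : Pred N E (Ext X s)} : Definable P →
      Definable (fun G ν ε α => ∃ d : s.Dom, P G ν ε (Ext.assign α d))
  | rename {N E N' E' : Type} {X X' : LSort → Type} (f : N → N') (g : E → E')
      (h : ∀ s, X s → X' s) {P : Pred N E X} : Definable P →
      Definable (fun G ν ε α => P G (fun x => ν (f x)) (fun e => ε (g e)) (fun s x => α s (h s x)))

variable {N E : Type} {X : LSort → Type}

theorem Definable.congr {P Q : Pred N E X} (hP : Definable P)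
    (h : ∀ G ν ε α, Q G ν ε α ↔ P G ν ε α) : Definable Q := by
  have : Q = P := by
    funext G ν ε α
    exact propext (h G ν ε α)
  exact this ▸ hP

/-- A map of label variables, extended to one more variable. -/
def Ext.map {X Y : LSort → Type} (ρ : ∀ s, X s → Y s) (s : LSort) : ∀ t, Ext X s t → Ext Y s t
  | _, .old x => .old (ρ _ x)
  | _, .new => .new

theorem Ext.assign_map {X Y : LSort → Type} (ρ : ∀ s, X s → Y s) {s : LSort} (α : LAssign Y)
    (d : s.Dom) :
    (fun t x => Ext.assign α d t (Ext.map ρ s t x)) =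
      Ext.assign (fun t x => α t (ρ t x)) d := by
  funext t x
  cases x <;> rfl

theorem optionElim_map {N N' W : Type} (f : N → N') (v : W) (ν : N' → W) :
    (fun x : Option N => (x.map f).elim v ν) = fun x => x.elim v (fun y => ν (f y)) := by
  funext x
  cases x <;> rfl

/-- Label terms can be equated in formulas only as lists, so equations between integers, strings,
characters or atoms are written between one-element lists. -/
theorem singleton_int_eq {a b : ℤ} : ([Atom.int a] : HList) = [Atom.int b] ↔ a = b := by simp

theorem singleton_str_eq {a b : List Character} :
    ([Atom.str a] : HList) = [Atom.str b] ↔ a = b := by simp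

theorem singleton_char_eq {a b : Character} :
    ([Atom.str [a]] : HList) = [Atom.str [b]] ↔ a = b := by simp

theorem singleton_atom_eq {a b : Atom} : ([a] : HList) = [b] ↔ a = b := by simp

/-- Definable predicates are expressed by formulas. -/
theorem Definable.exists_formula {P : Pred N E X} (hP : Definable P) :
    ∀ {N' E' : Type} {X' : LSort → Type} (f : N → N') (g : E → E') (h : ∀ s, X s → X' s),
      ∃ φ : Formula N' E' X', ∀ G ν ε α, φ.Sat G ν ε α ↔
        P G (fun x => ν (f x)) (fun e => ε (g e)) (fun s x => α s (h s x)) := by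
  induction hP with
  | pure p h => exact fun _ _ ρ => h _ _ _ ρ
  | src e x => exact fun f g _ => ⟨.nodeEq (.src (g e)) (.var (f x)), fun G ν ε α => Iff.rfl⟩
  | tgt e x => exact fun f g _ => ⟨.nodeEq (.tgt (g e)) (.var (f x)), fun G ν ε α => Iff.rfl⟩
  | nodeList x l =>
    exact fun f g h => ⟨.lstEq (.nodeLabel (.var (f x))) (.var (h _ l)), fun G ν ε α => Iff.rfl⟩
  | edgeList e l =>
    exact fun f g h => ⟨.lstEq (.edgeLabel (g e)) (.var (h _ l)), fun G ν ε α => Iff.rfl⟩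
  | indeg x z =>
    exact fun f g h => ⟨.lstEq (.atom (.int (.indeg (.var (f x))))) (.atom (.int (.var (h _ z)))),
      fun G ν ε α => singleton_int_eq⟩
  | outdeg x z =>
    exact fun f g h => ⟨.lstEq (.atom (.int (.outdeg (.var (f x))))) (.atom (.int (.var (h _ z)))),
      fun G ν ε α => singleton_int_eq⟩
  | root x => exact fun f g h => ⟨.root (.var (f x)), fun G ν ε α => Iff.rfl⟩
  | nodeMark x m => exact fun f g h => ⟨.nodeMarkEq (.var (f x)) m, fun G ν ε α => Iff.rfl⟩
  | edgeMark e m => exact fun f g h => ⟨.edgeMarkEq (g e) m, fun G ν ε α => Iff.rfl⟩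
  | nodeEq x y => exact fun f g h => ⟨.nodeEq (.var (f x)) (.var (f y)), fun G ν ε α => Iff.rfl⟩
  | edgeEq x y => exact fun f g h => ⟨.edgeEq (g x) (g y), fun G ν ε α => Iff.rfl⟩
  | and _ _ ih₁ ih₂ =>
    intro _ _ _ f g h
    obtain ⟨φ, hφ⟩ := ih₁ f g h
    obtain ⟨ψ, hψ⟩ := ih₂ f g h
    exact ⟨.and φ ψ, fun G ν ε α => and_congr (hφ G ν ε α) (hψ G ν ε α)⟩
  | not _ ih =>
    intro _ _ _ f g h
    obtain ⟨φ, hφ⟩ := ih f g h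
    exact ⟨.not φ, fun G ν ε α => not_congr (hφ G ν ε α)⟩
  | existsV _ ih =>
    intro _ _ _ f g h
    obtain ⟨φ, hφ⟩ := ih (Option.map f) g h
    refine ⟨.existsV φ, fun G ν ε α => exists_congr fun v => ?_⟩
    rw [hφ, optionElim_map]
  | existsE _ ih =>
    intro _ _ _ f g h
    obtain ⟨φ, hφ⟩ := ih f (Option.map g) h
    refine ⟨.existsE φ, fun G ν ε α => exists_congr fun v => ?_⟩
    rw [hφ, optionElim_map]
  | existsL s _ ih =>
    intro _ _ _ f g h
    obtain ⟨φ, hφ⟩ := ih f g (Ext.map h s)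
    refine ⟨.existsL s φ, fun G ν ε α => exists_congr fun v => ?_⟩
    rw [hφ, Ext.assign_map]
  -- Renamings compose; this case and the binders are why the statement quantifies over all
  -- renamings.
  | rename f' g' h' _ ih =>
    intro _ _ _ f g h
    obtain ⟨φ, hφ⟩ := ih (fun x => f (f' x)) (fun x => g (g' x)) (fun s x => h s (h' s x))
    exact ⟨φ, hφ⟩

/-! ### Closure properties -/

/-- The truth value is fixed outside the logic, so one of the formulas `tt` and `ff` always serves.
This covers all facts that depend only on the finite rule graphs. -/
theorem Definable.const (p : Prop) : Definable (N := N) (E := E) (X := X) (fun _ _ _ _ => p) := by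
  refine .pure (fun _ => p) fun N E Y ρ => ?_
  by_cases h : p
  · exact ⟨.tt, fun _ _ _ _ => by simp [Formula.Sat, h]⟩
  · exact ⟨.ff, fun _ _ _ _ => by simp [Formula.Sat, h]⟩

theorem Definable.or {P Q : Pred N E X} (hP : Definable P) (hQ : Definable Q) :
    Definable (fun G ν ε α => P G ν ε α ∨ Q G ν ε α) :=
  (hP.not.and hQ.not).not.congr fun _ _ _ _ => by tauto

/-- A finite index type turns the quantifier into a disjunction, built up by induction on finite
subsets of the index type. -/
theorem Definable.exists_finite {ι : Type} [Finite ι] {P : ι → Pred N E X}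
    (hP : ∀ i, Definable (P i)) : Definable (fun G ν ε α => ∃ i, P i G ν ε α) := by
  classical
  have := Fintype.ofFinite ι
  have key : ∀ s : Finset ι, Definable (fun G ν ε α => ∃ i ∈ s, P i G ν ε α) := by
    intro s
    induction s using Finset.induction_on with
    | empty => exact (Definable.const False).congr fun _ _ _ _ => by simp
    | insert i s _ ih => exact ((hP i).or ih).congr fun _ _ _ _ => by simp
  exact (key Finset.univ).congr fun _ _ _ _ => by simp

theorem Definable.forall_finite {ι : Type} [Finite ι] {P : ι → Pred N E X}
    (hP : ∀ i, Definable (P i)) : Definable (fun G ν ε α => ∀ i, P i G ν ε α) :=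
  (Definable.exists_finite fun i => (hP i).not).not.congr fun _ _ _ _ => by simp

theorem Definable.forallE {P : Pred N (Option E) X} (hP : Definable P) :
    Definable (fun G ν ε α => ∀ e : G.E, P G ν (fun x => x.elim e ε) α) :=
  hP.not.existsE.not.congr fun _ _ _ _ => by simp

theorem Definable.imp {P Q : Pred N E X} (hP : Definable P) (hQ : Definable Q) :
    Definable (fun G ν ε α => P G ν ε α → Q G ν ε α) :=
  (hP.and hQ.not).not.congr fun _ _ _ _ => by tauto

/-- Node-valued functions with definable graph. -/
def DefinableNode (f : ∀ G : HostGraph, (N → G.V) → (E → G.E) → LAssign X → G.V) : Prop :=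
  Definable (N := Option N) (fun G ν ε α => ν none = f G (fun x => ν (some x)) ε α)

/-- Label-valued functions with definable graph. -/
def DefinableFun (s : LSort)
    (f : ∀ G : HostGraph, (N → G.V) → (E → G.E) → LAssign X → s.Dom) : Prop :=
  Definable (X := Ext X s) (fun G ν ε α => α s .new = f G ν ε (fun t x => α t (.old x)))

/-- `P` holds at `f` if and only if some node equals `f` and satisfies `P`. This replaces nested
terms by quantified variables. -/
theorem DefinableNode.subst
    {f : ∀ G : HostGraph, (N → G.V) → (E → G.E) → LAssign X → G.V} (hf : DefinableNode f)
    {P : Pred (Option N) E X} (hP : Definable P) :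
    Definable (fun G ν ε α => P G (fun x => x.elim (f G ν ε α) ν) ε α) :=
  (hf.and hP).existsV.congr fun _ _ _ _ => by simp

theorem DefinableFun.subst {s : LSort}
    {f : ∀ G : HostGraph, (N → G.V) → (E → G.E) → LAssign X → s.Dom} (hf : DefinableFun s f)
    {P : Pred N E (Ext X s)} (hP : Definable P) :
    Definable (fun G ν ε α => P G ν ε (Ext.assign α (f G ν ε α))) :=
  (hf.and hP).existsL.congr fun _ _ _ _ => by simp [Ext.assign]

theorem DefinableNode.rename {N' E' : Type} {X' : LSort → Type} (f : N → N') (g : E → E')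
    (h : ∀ s, X s → X' s) {F : ∀ G : HostGraph, (N → G.V) → (E → G.E) → LAssign X → G.V}
    (hF : DefinableNode F) :
    DefinableNode (fun G ν ε α =>
      F G (fun x => ν (f x)) (fun e => ε (g e)) (fun s x => α s (h s x))) :=
  Definable.rename (Option.map f) g h hF

theorem DefinableFun.rename {N' E' : Type} {X' : LSort → Type} (f : N → N') (g : E → E')
    (h : ∀ s, X s → X' s) {s : LSort}
    {F : ∀ G : HostGraph, (N → G.V) → (E → G.E) → LAssign X → s.Dom}
    (hF : DefinableFun s F) :
    DefinableFun s (fun G ν ε α =>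
      F G (fun x => ν (f x)) (fun e => ε (g e)) (fun s x => α s (h s x))) :=
  Definable.rename f g (Ext.map h s) hF

-- Relations and operations on definable label-valued functions

section Rel

variable {s t u : LSort}
  {f : ∀ G : HostGraph, (N → G.V) → (E → G.E) → LAssign X → s.Dom}
  {g : ∀ G : HostGraph, (N → G.V) → (E → G.E) → LAssign X → t.Dom}
  {k : ∀ G : HostGraph, (N → G.V) → (E → G.E) → LAssign X → u.Dom}

/-- The values of `f` and `g` are named by two new label variables, so that only the relation
between variables has to be expressible. -/
theorem DefinableFun.rel₂ (hf : DefinableFun s f) (hg : DefinableFun t g)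
    {R : s.Dom → t.Dom → Prop}
    (hR : ∀ (Y : LSort → Type) (x : Y s) (y : Y t),
      PureDefinable (X := Y) (fun α => R (α s x) (α t y))) :
    Definable (fun G ν ε α => R (f G ν ε α) (g G ν ε α)) :=
  hf.subst ((hg.rename id id (fun _ x => Ext.old (s := s) x)).subst
    (.pure _ (hR (Ext (Ext X s) t) (.old .new) .new)))

theorem DefinableFun.rel₃ (hf : DefinableFun s f) (hg : DefinableFun t g) (hk : DefinableFun u k)
    {R : s.Dom → t.Dom → u.Dom → Prop}
    (hR : ∀ (Y : LSort → Type) (x : Y s) (y : Y t) (z : Y u),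
      PureDefinable (X := Y) (fun α => R (α s x) (α t y) (α u z))) :
    Definable (fun G ν ε α => R (f G ν ε α) (g G ν ε α) (k G ν ε α)) :=
  hf.subst ((hg.rename id id (fun _ x => Ext.old (s := s) x)).subst
    ((hk.rename id id (fun _ x => Ext.old (s := t) (Ext.old (s := s) x))).subst
    (.pure _ (hR (Ext (Ext (Ext X s) t) u) (.old (.old .new)) (.old .new) .new))))

/-- The equation of two label variables of the same type. -/
theorem pureDefinable_eq (s : LSort) (Y : LSort → Type) (x y : Y s) :
    PureDefinable (X := Y) (fun α => α s x = α s y) := by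
  intro N E Z ρ
  cases s with
  | list => exact ⟨.lstEq (.var (ρ _ x)) (.var (ρ _ y)), fun _ _ _ _ => Iff.rfl⟩
  | atom =>
    exact ⟨.lstEq (.atom (.var (ρ _ x))) (.atom (.var (ρ _ y))), fun _ _ _ _ => singleton_atom_eq⟩
  | int =>
    exact ⟨.lstEq (.atom (.int (.var (ρ _ x)))) (.atom (.int (.var (ρ _ y)))), fun _ _ _ _ => singleton_int_eq⟩
  | string =>
    exact ⟨.lstEq (.atom (.str (.var (ρ _ x)))) (.atom (.str (.var (ρ _ y)))), fun _ _ _ _ => singleton_str_eq⟩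
  | char =>
    exact ⟨.lstEq (.atom (.str (.charVar (ρ _ x)))) (.atom (.str (.charVar (ρ _ y)))),
      fun _ _ _ _ => singleton_char_eq⟩

theorem DefinableFun.var (x : X s) :
    DefinableFun (N := N) (E := E) (X := X) s (fun _ _ _ α => α s x) :=
  Definable.pure _ (pureDefinable_eq s (Ext X s) .new (.old x))

theorem DefinableFun.const (d : s.Dom)
    (hd : ∀ (Y : LSort → Type) (x : Y s), PureDefinable (X := Y) (fun α => α s x = d)) :
    DefinableFun (N := N) (E := E) (X := X) s (fun _ _ _ _ => d) :=
  Definable.pure _ (hd (Ext X s) .new)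

theorem DefinableFun.map₁ (hf : DefinableFun s f) (o : s.Dom → u.Dom)
    (ho : ∀ (Y : LSort → Type) (z : Y u) (x : Y s),
      PureDefinable (X := Y) (fun α => α u z = o (α s x))) :
    DefinableFun u (fun G ν ε α => o (f G ν ε α)) :=
  (DefinableFun.var (X := Ext X u) .new).rel₂ (hf.rename id id (fun _ x => Ext.old (s := u) x))
    (R := fun a b => a = o b) ho

theorem DefinableFun.map₂ (hf : DefinableFun s f) (hg : DefinableFun t g)
    (o : s.Dom → t.Dom → u.Dom)
    (ho : ∀ (Y : LSort → Type) (z : Y u) (x : Y s) (y : Y t),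
      PureDefinable (X := Y) (fun α => α u z = o (α s x) (α t y))) :
    DefinableFun u (fun G ν ε α => o (f G ν ε α) (g G ν ε α)) :=
  (DefinableFun.var (X := Ext X u) .new).rel₃ (hf.rename id id (fun _ x => Ext.old (s := u) x))
    (hg.rename id id (fun _ x => Ext.old (s := u) x)) (R := fun a b c => a = o b c) ho

theorem DefinableFun.eq {f' : ∀ G : HostGraph, (N → G.V) → (E → G.E) → LAssign X → s.Dom}
    (hf : DefinableFun s f) (hf' : DefinableFun s f') :
    Definable (fun G ν ε α => f G ν ε α = f' G ν ε α) :=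
  hf.rel₂ hf' (pureDefinable_eq s)

end Rel

/-- Definability of `g` is definability of the equation between `g` and a variable; the value of `f`
is substituted for that variable. -/
theorem DefinableNode.eq {f g : ∀ G : HostGraph, (N → G.V) → (E → G.E) → LAssign X → G.V}
    (hf : DefinableNode f) (hg : DefinableNode g) :
    Definable (fun G ν ε α => f G ν ε α = g G ν ε α) :=
  hf.subst hg

theorem NodeTerm.definableNode (t : NodeTerm N E) :
    DefinableNode (X := X) (fun G ν ε _ => t.eval G ν ε) := by
  cases t with
  | var x => exact .nodeEq none (some x)
  | src e => exact (Definable.src e none).congr fun _ _ _ _ => eq_comm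
  | tgt e => exact (Definable.tgt e none).congr fun _ _ _ _ => eq_comm

section Node

variable {f : ∀ G : HostGraph, (N → G.V) → (E → G.E) → LAssign X → G.V}

theorem DefinableNode.indeg (hf : DefinableNode f) :
    DefinableFun .int (fun G ν ε α => (G.indeg (f G ν ε α) : ℤ)) :=
  ((hf.rename id id (fun _ x => Ext.old (s := .int) x)).subst
    (Definable.indeg none .new)).congr fun _ _ _ _ => eq_comm

theorem DefinableNode.outdeg (hf : DefinableNode f) :
    DefinableFun .int (fun G ν ε α => (G.outdeg (f G ν ε α) : ℤ)) :=
  ((hf.rename id id (fun _ x => Ext.old (s := .int) x)).subst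
    (Definable.outdeg none .new)).congr fun _ _ _ _ => eq_comm

theorem DefinableNode.vList (hf : DefinableNode f) :
    DefinableFun .list (fun G ν ε α => G.vList (f G ν ε α)) :=
  ((hf.rename id id (fun _ x => Ext.old (s := .list) x)).subst
    (Definable.nodeList none .new)).congr fun _ _ _ _ => eq_comm

end Node

theorem DefinableFun.eList (e : E) :
    DefinableFun (N := N) (X := X) .list (fun G _ ε _ => G.eList (ε e)) :=
  (Definable.edgeList e .new).congr fun _ _ _ _ => eq_comm

-- Values of expressions are definable

section Expr

variable {M : Type} {τ : ∀ G : HostGraph, M → (N → G.V) → (E → G.E) → G.V}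

/-- The interpretation `τ` of the node identifiers is kept abstract so that one proof serves both
formulas, whose identifiers are node terms, and rule schemata, whose identifiers are nodes of the
left-hand graph. -/
theorem IntExp.definableFun (hτ : ∀ m, DefinableNode (X := X) (fun G ν ε _ => τ G m ν ε))
    (e : IntExp X M) :
    DefinableFun .int (fun G ν ε α => (e.eval G (fun m => τ G m ν ε) α : ℤ)) := by
  induction e with
  | const z =>
    exact .const (s := .int) z fun Y x N E Z ρ =>
      ⟨.lstEq (.atom (.int (.var (ρ _ x)))) (.atom (.int (.const z))), fun _ _ _ _ => singleton_int_eq⟩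
  | var x => exact .var x
  | op o a b iha ihb =>
    exact iha.map₂ ihb (u := .int) o.eval fun Y z x y N E Z ρ =>
      ⟨.lstEq (.atom (.int (.var (ρ _ z)))) (.atom (.int (.op o (.var (ρ _ x)) (.var (ρ _ y))))),
        fun _ _ _ _ => singleton_int_eq⟩
  | indeg n => exact (hτ n).indeg
  | outdeg n => exact (hτ n).outdeg
  | lengthAtom x =>
    exact (DefinableFun.var x).map₁ (u := .int) (fun a => (Atom.length a : ℤ)) fun Y z x N E Z ρ =>
      ⟨.lstEq (.atom (.int (.var (ρ _ z)))) (.atom (.int (.lengthAtom (ρ _ x)))),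
        fun _ _ _ _ => singleton_int_eq⟩
  | lengthString x =>
    exact (DefinableFun.var x).map₁ (u := .int) (fun a => (List.length (α := Character) a : ℤ))
      fun Y z x N E Z ρ =>
      ⟨.lstEq (.atom (.int (.var (ρ _ z)))) (.atom (.int (.lengthString (ρ _ x)))),
        fun _ _ _ _ => singleton_int_eq⟩
  | lengthList x =>
    exact (DefinableFun.var x).map₁ (u := .int) (fun a => (List.length (α := Atom) a : ℤ))
      fun Y z x N E Z ρ =>
      ⟨.lstEq (.atom (.int (.var (ρ _ z)))) (.atom (.int (.lengthList (ρ _ x)))),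
        fun _ _ _ _ => singleton_int_eq⟩

theorem StrExp.definableFun (e : StrExp X) :
    DefinableFun (N := N) (E := E) .string (fun _ _ _ α => e.eval α) := by
  induction e with
  | lit w =>
    exact .const (s := .string) w fun Y x N E Z ρ =>
      ⟨.lstEq (.atom (.str (.var (ρ _ x)))) (.atom (.str (.lit w))), fun _ _ _ _ => singleton_str_eq⟩
  | charVar x =>
    exact (DefinableFun.var x).map₁ (u := .string) (fun a => [a]) fun Y z x N E Z ρ =>
      ⟨.lstEq (.atom (.str (.var (ρ _ z)))) (.atom (.str (.charVar (ρ _ x)))),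
        fun _ _ _ _ => singleton_str_eq⟩
  | var x => exact .var x
  | concat a b iha ihb =>
    exact iha.map₂ ihb (u := .string) (fun v w => List.append v w) fun Y z x y N E Z ρ =>
      ⟨.lstEq (.atom (.str (.var (ρ _ z)))) (.atom (.str (.concat (.var (ρ _ x)) (.var (ρ _ y))))),
        fun _ _ _ _ => singleton_str_eq⟩

theorem AtomExp.definableFun (hτ : ∀ m, DefinableNode (X := X) (fun G ν ε _ => τ G m ν ε))
    (e : AtomExp X M) :
    DefinableFun .atom (fun G ν ε α => e.eval G (fun m => τ G m ν ε) α) := by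
  cases e with
  | int e =>
    exact (e.definableFun hτ).map₁ (u := .atom) Atom.int fun Y z x N E Z ρ =>
      ⟨.lstEq (.atom (.var (ρ _ z))) (.atom (.int (.var (ρ _ x)))),
        fun _ _ _ _ => singleton_atom_eq⟩
  | str e =>
    exact e.definableFun.map₁ (u := .atom) Atom.str fun Y z x N E Z ρ =>
      ⟨.lstEq (.atom (.var (ρ _ z))) (.atom (.str (.var (ρ _ x)))),
        fun _ _ _ _ => singleton_atom_eq⟩
  | var x => exact .var x

theorem pureDefinable_nil (Y : LSort → Type) (x : Y .list) :
    PureDefinable (X := Y) (fun α => α .list x = ([] : HList)) := fun _ _ _ ρ =>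
  ⟨.lstEq (.var (ρ _ x)) .empty, fun _ _ _ _ => Iff.rfl⟩

theorem pureDefinable_singleton (Y : LSort → Type) (z : Y .list) (x : Y .atom) :
    PureDefinable (X := Y) (fun α => α .list z = ([α .atom x] : HList)) := fun _ _ _ ρ =>
  ⟨.lstEq (.var (ρ _ z)) (.atom (.var (ρ _ x))), fun _ _ _ _ => Iff.rfl⟩

theorem pureDefinable_append (Y : LSort → Type) (z x y : Y .list) :
    PureDefinable (X := Y) (fun α => α .list z = List.append (α .list x) (α .list y)) :=
  fun _ _ _ ρ =>
  ⟨.lstEq (.var (ρ _ z)) (.append (.var (ρ _ x)) (.var (ρ _ y))), fun _ _ _ _ => Iff.rfl⟩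

theorem ListExp.definableFun (hτ : ∀ m, DefinableNode (X := X) (fun G ν ε _ => τ G m ν ε))
    (e : ListExp X M) :
    DefinableFun .list (fun G ν ε α => e.eval G (fun m => τ G m ν ε) α) := by
  induction e with
  | empty => exact .const (s := .list) [] pureDefinable_nil
  | atom e => exact (e.definableFun hτ).map₁ (u := .list) (fun a => [a]) pureDefinable_singleton
  | append a b iha ihb => exact iha.map₂ ihb (u := .list) (fun v w => List.append v w) pureDefinable_append
  | var x => exact .var x

end Expr

theorem Lst.definableFun (e : Lst N E X) : DefinableFun .list (fun G ν ε α => e.eval G ν ε α) := by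
  induction e with
  | empty => exact .const (s := .list) [] pureDefinable_nil
  | atom e =>
    exact (e.definableFun fun m => m.definableNode).map₁ (u := .list) (fun a => [a])
      pureDefinable_singleton
  | append a b iha ihb => exact iha.map₂ ihb (u := .list) (fun v w => List.append v w) pureDefinable_append
  | var x => exact .var x
  | nodeLabel t => exact t.definableNode.vList
  | edgeLabel e => exact .eList e

theorem pureDefinable_typed (p : TypePred) (s : LSort) (Y : LSort → Type) (x : Y s) :
    PureDefinable (X := Y) (fun α => p.Holds (s.toHList (α s x))) := fun _ _ _ ρ =>
  ⟨.typed p s (ρ _ x), fun _ _ _ _ => Iff.rfl⟩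

theorem pureDefinable_cmp (o : Cmp) (Y : LSort → Type) (x y : Y .int) :
    PureDefinable (X := Y) (fun α => o.Holds (α .int x) (α .int y)) := fun _ _ _ ρ =>
  ⟨.cmp o (.var (ρ _ x)) (.var (ρ _ y)), fun _ _ _ _ => Iff.rfl⟩

/-- The edge predicate unfolds to an edge quantifier over equations for source, target and list and
a mark atom, so it needs no atom of its own in `Definable`. -/
theorem Definable.hasEdge {f g : ∀ G : HostGraph, (N → G.V) → (E → G.E) → LAssign X → G.V}
    (hf : DefinableNode f) (hg : DefinableNode g)
    {l : Option (∀ G : HostGraph, (N → G.V) → (E → G.E) → LAssign X → HList)}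
    (hl : ∀ k ∈ l, DefinableFun .list k) (m : Option EPat) :
    Definable (fun G ν ε α =>
      G.HasEdge (f G ν ε α) (g G ν ε α) (l.map fun k => k G ν ε α) m) := by
  have h₁ : Definable (N := N) (E := Option E) (X := X) (fun G ν ε α =>
      G.src (ε none) = f G ν (fun e => ε (some e)) α) :=
    (NodeTerm.definableNode (.src none)).eq (hf.rename id some (fun _ x => x))
  have h₂ : Definable (N := N) (E := Option E) (X := X) (fun G ν ε α =>
      G.tgt (ε none) = g G ν (fun e => ε (some e)) α) :=
    (NodeTerm.definableNode (.tgt none)).eq (hg.rename id some (fun _ x => x))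
  have h₃ : Definable (N := N) (E := Option E) (X := X) (fun G ν ε α =>
      ∀ l' ∈ l.map fun k => k G ν (fun e => ε (some e)) α, G.eList (ε none) = l') := by
    cases l with
    | none => exact (Definable.const True).congr fun _ _ _ _ => by simp
    | some k =>
      have := (DefinableFun.eList (N := N) (X := X) (none : Option E)).eq
        ((hl k rfl).rename id some (fun _ x => x))
      exact this.congr fun _ _ _ _ => by simp; rfl
  have h₄ : Definable (N := N) (E := Option E) (X := X) (fun G ν ε α =>
      ∀ p ∈ m, p.Matches (G.eMark (ε none))) := by
    cases m with
    | none => exact (Definable.const True).congr fun _ _ _ _ => by simp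
    | some p => exact (Definable.edgeMark none p).congr fun _ _ _ _ => by simp
  exact (h₁.and (h₂.and (h₃.and h₄))).existsE

/-- Satisfaction of a formula is a definable predicate. -/
theorem Formula.definable (φ : Formula N E X) : Definable (fun G => φ.Sat G) := by
  induction φ with
  | tt => exact .const True
  | ff => exact .const False
  | typed p s x => exact .pure _ (pureDefinable_typed p s _ x)
  | cmp o a b =>
    exact (a.definableFun fun m => m.definableNode).rel₂ (b.definableFun fun m => m.definableNode)
      (pureDefinable_cmp o)
  | edge t u l m =>
    refine (Definable.hasEdge t.definableNode u.definableNode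
      (l := l.map fun a G ν ε α => a.eval G ν ε α) ?_ m).congr fun _ _ _ _ => ?_
    · intro k hk
      obtain ⟨a, -, rfl⟩ := Option.mem_map.1 hk
      exact a.definableFun
    · simp [Formula.Sat, Function.comp_def]
  | root t => exact t.definableNode.subst (.root none)
  | nodeEq t u => exact t.definableNode.eq u.definableNode
  | edgeEq e f => exact .edgeEq e f
  | lstEq a b => exact a.definableFun.eq b.definableFun
  | nodeMarkEq t m => exact t.definableNode.subst (.nodeMark none m)
  | edgeMarkEq e m => exact .edgeMark e m
  | and _ _ ih₁ ih₂ => exact ih₁.and ih₂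
  | or _ _ ih₁ ih₂ => exact ih₁.or ih₂
  | not _ ih => exact ih.not
  | existsV _ ih => exact ih.existsV
  | existsE _ ih => exact ih.existsE
  | existsL s _ ih => exact ih.existsL

end GP2

namespace GP2

variable {N E : Type} {X : LSort → Type}

/-! ### Quantification over finite families of variables -/

/-- By induction on the finite index type, the variables are quantified one at a time; the step
splits a map on `Option A` into its value at `none` and its restriction to `A`. -/
theorem Definable.exists_nodes {A : Type} [Finite A] {P : Pred A E X} (hP : Definable P) :
    Definable (N := Empty) (fun G _ ε α => ∃ ν : A → G.V, P G ν ε α) := by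
  revert P
  refine Finite.induction_empty_option (P := fun A => ∀ {P : Pred A E X}, Definable P →
      Definable (N := Empty) (fun G _ ε α => ∃ ν : A → G.V, P G ν ε α)) ?_ ?_ ?_ A
  · intro A B e ih P hP
    refine (ih (hP.rename e.symm (fun e => e) (fun _ x => x))).congr fun G ν ε α => ?_
    constructor
    · rintro ⟨ν, h⟩
      exact ⟨fun a => ν (e a), by simpa using h⟩
    · rintro ⟨ν, h⟩
      exact ⟨_, h⟩
  · intro P hP
    refine (hP.rename PEmpty.elim (fun e => e) (fun _ x => x)).congr fun G ν ε α => ?_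
    constructor
    · rintro ⟨ν', h⟩
      convert h with x
      exact x.elim
    · intro h
      exact ⟨_, h⟩
  · intro A _ ih P hP
    refine (ih hP.existsV).congr fun G ν ε α => ?_
    constructor
    · rintro ⟨ν', h⟩
      refine ⟨fun a => ν' (some a), ν' none, ?_⟩
      convert h using 1
      funext x
      cases x <;> rfl
    · rintro ⟨ν', v, h⟩
      exact ⟨_, h⟩

theorem Definable.exists_edges {B : Type} [Finite B] {P : Pred N B X} (hP : Definable P) :
    Definable (E := Empty) (fun G ν _ α => ∃ ε : B → G.E, P G ν ε α) := by
  revert P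
  refine Finite.induction_empty_option (P := fun B => ∀ {P : Pred N B X}, Definable P →
      Definable (E := Empty) (fun G ν _ α => ∃ ε : B → G.E, P G ν ε α)) ?_ ?_ ?_ B
  · intro A B e ih P hP
    refine (ih (hP.rename (fun x => x) e.symm (fun _ x => x))).congr fun G ν ε α => ?_
    constructor
    · rintro ⟨ε, h⟩
      exact ⟨fun a => ε (e a), by simpa using h⟩
    · rintro ⟨ε, h⟩
      exact ⟨_, h⟩
  · intro P hP
    refine (hP.rename (fun x => x) PEmpty.elim (fun _ x => x)).congr fun G ν ε α => ?_
    constructor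
    · rintro ⟨ε', h⟩
      convert h with x
      exact x.elim
    · intro h
      exact ⟨_, h⟩
  · intro B _ ih P hP
    refine (ih hP.existsE).congr fun G ν ε α => ?_
    constructor
    · rintro ⟨ε', h⟩
      refine ⟨fun a => ε' (some a), ε' none, ?_⟩
      convert h using 1
      funext x
      cases x <;> rfl
    · rintro ⟨ε', v, h⟩
      exact ⟨_, h⟩

/-- Vacuous label quantifiers may be added only because no domain is empty. -/
instance (s : LSort) : Nonempty s.Dom := by
  cases s with
  | list => exact ⟨([] : List Atom)⟩
  | atom => exact ⟨Atom.int 0⟩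
  | int => exact ⟨(0 : ℤ)⟩
  | string => exact ⟨([] : List Character)⟩
  | char => exact ⟨(⟨Char.ofNat 65, by decide⟩ : Character)⟩

/-- One label variable of each type. -/
abbrev OneVar : LSort → Type :=
  Ext (Ext (Ext (Ext (Ext (fun _ => Empty) .list) .atom) .int) .string) .char

def OneVar.var : ∀ s : LSort, OneVar s
  | .list => .old (.old (.old (.old .new)))
  | .atom => .old (.old (.old .new))
  | .int => .old (.old .new)
  | .string => .old .new
  | .char => .new

open Classical in
/-- Turn the variable `p` into the bound variable. -/
noncomputable def Ext.bind (p : Σ s, X s) : ∀ t, X t → Ext X p.1 t := fun t y =>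
  if h : t = p.1 then (if h ▸ y = p.2 then h ▸ Ext.new else .old y) else .old y

theorem Ext.assign_bind_self (p : Σ s, X s) (α : LAssign X) (d : p.1.Dom) :
    Ext.assign α d p.1 (Ext.bind p p.1 p.2) = d := by
  simp [Ext.bind, Ext.assign]

theorem Ext.assign_bind_of_ne (p q : Σ s, X s) (hq : q ≠ p) (α : LAssign X) (d : p.1.Dom) :
    Ext.assign α d q.1 (Ext.bind p q.1 q.2) = α q.1 q.2 := by
  obtain ⟨s, x⟩ := p
  obtain ⟨t, y⟩ := q
  by_cases h : t = s
  · subst h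
    have : y ≠ x := fun h => hq (by rw [h])
    simp [Ext.bind, Ext.assign, this]
  · simp [Ext.bind, Ext.assign, h]

/-- Rule schemata have infinitely many label variables at their disposal, but formulas quantify over
one at a time. Dependence on the finite set `S` alone makes finitely many quantifiers sufficient. -/
theorem Definable.exists_labels (S : Finset (Σ s, X s)) {P : Pred N E X} (hP : Definable P)
    (hS : ∀ G ν ε (α α' : LAssign X), (∀ p ∈ S, α p.1 p.2 = α' p.1 p.2) →
      P G ν ε α → P G ν ε α') :
    Definable (X := fun _ => Empty) (fun G ν ε _ => ∃ α, P G ν ε α) := by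
  classical
  induction S using Finset.induction_on generalizing P with
  | empty =>
    -- No variable matters any more, so all variables of a type may be merged into a single one;
    -- five quantifiers then close the predicate.
    have := hP.rename (X' := OneVar) (fun x => x) (fun x => x) (fun s _ => OneVar.var s)
    refine this.existsL.existsL.existsL.existsL.existsL.congr fun G ν ε α => ?_
    constructor
    · rintro ⟨α, h⟩
      exact ⟨Classical.arbitrary _, Classical.arbitrary _, Classical.arbitrary _,
        Classical.arbitrary _, Classical.arbitrary _, hS _ _ _ _ _ (by simp) h⟩
    · rintro ⟨_, _, _, _, _, h⟩
      exact ⟨_, h⟩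
  | insert p S hp ih =>
    -- After `p` is bound, the predicate still formally has all variables of `X` but no longer
    -- depends on `p`, hence only on `S`.
    have := (hP.rename (fun x => x) (fun x => x) (Ext.bind p)).existsL
    refine (ih this ?_).congr fun G ν ε _ => ?_
    · rintro G ν ε α α' h ⟨d, hd⟩
      refine ⟨d, hS _ _ _ _ _ (fun q hq => ?_) hd⟩
      by_cases hqp : q = p
      · subst hqp
        simp only [Ext.assign_bind_self]
      · simp only [Ext.assign_bind_of_ne p q hqp]
        exact h q ((Finset.mem_insert.1 hq).resolve_left hqp)
    · constructor
      · rintro ⟨α, h⟩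
        refine ⟨α, α p.1 p.2, hS _ _ _ _ _ (fun q _ => ?_) h⟩
        by_cases hqp : q = p
        · subst hqp
          simp only [Ext.assign_bind_self]
        · simp only [Ext.assign_bind_of_ne p q hqp]
      · rintro ⟨α, d, h⟩
        exact ⟨_, h⟩

/-! ### Isomorphisms of host graphs -/

structure HostGraph.Iso (G H : HostGraph) : Type where
  onV : G.V ≃ H.V
  onE : G.E ≃ H.E
  src_comm : ∀ e, H.src (onE e) = onV (G.src e)
  tgt_comm : ∀ e, H.tgt (onE e) = onV (G.tgt e)
  vList_comm : ∀ v, H.vList (onV v) = G.vList v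
  vMark_comm : ∀ v, H.vMark (onV v) = G.vMark v
  eList_comm : ∀ e, H.eList (onE e) = G.eList e
  eMark_comm : ∀ e, H.eMark (onE e) = G.eMark e
  root_comm : ∀ v, H.root (onV v) = G.root v

namespace HostGraph.Iso

variable {G H : HostGraph}

def refl (G : HostGraph) : G.Iso G where
  onV := .refl _
  onE := .refl _
  src_comm _ := rfl
  tgt_comm _ := rfl
  vList_comm _ := rfl
  vMark_comm _ := rfl
  eList_comm _ := rfl
  eMark_comm _ := rfl
  root_comm _ := rfl

theorem indeg_comm (i : G.Iso H) (v : G.V) : H.indeg (i.onV v) = G.indeg v :=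
  (Nat.card_congr (i.onE.subtypeEquiv fun e => by rw [i.tgt_comm, i.onV.apply_eq_iff_eq])).symm

theorem outdeg_comm (i : G.Iso H) (v : G.V) : H.outdeg (i.onV v) = G.outdeg v :=
  (Nat.card_congr (i.onE.subtypeEquiv fun e => by rw [i.src_comm, i.onV.apply_eq_iff_eq])).symm

end HostGraph.Iso

/-- Atoms refer only to structure that isomorphisms preserve, and quantifiers are transported along
the bijections. This is needed because contexts and results of derivations are determined only up to
isomorphism. -/
theorem Definable.iso {P : Pred N E X} (hP : Definable P) {G H : HostGraph} (i : G.Iso H) :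
    ∀ (ν : N → G.V) (ε : E → G.E) (α : LAssign X),
      P H (fun x => i.onV (ν x)) (fun e => i.onE (ε e)) α ↔ P G ν ε α := by
  induction hP with
  | pure => exact fun _ _ _ => Iff.rfl
  | src => simp [i.src_comm]
  | tgt => simp [i.tgt_comm]
  | nodeList => simp [i.vList_comm]
  | edgeList => simp [i.eList_comm]
  | indeg => simp [i.indeg_comm]
  | outdeg => simp [i.outdeg_comm]
  | root => simp [i.root_comm]
  | nodeMark => simp [i.vMark_comm]
  | edgeMark => simp [i.eMark_comm]
  | nodeEq => simp
  | edgeEq => simp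
  | and _ _ ih₁ ih₂ => exact fun _ _ _ => and_congr (ih₁ _ _ _) (ih₂ _ _ _)
  | not _ ih => exact fun _ _ _ => not_congr (ih _ _ _)
  | existsV _ ih =>
    intro ν ε α
    refine (i.onV.exists_congr fun v => ?_).symm
    rw [← ih]
    refine iff_of_eq ?_
    congr 1
    funext x
    cases x <;> rfl
  | existsE _ ih =>
    intro ν ε α
    refine (i.onE.exists_congr fun v => ?_).symm
    rw [← ih]
    refine iff_of_eq ?_
    congr 1
    funext x
    cases x <;> rfl
  | existsL s _ ih => exact fun _ _ _ => exists_congr fun d => ih _ _ _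
  | rename f g h _ ih => exact fun _ _ _ => ih _ _ _

end GP2

namespace GP2

variable {N E : Type} {X : LSort → Type}

/-! ### Contexts and gluing -/

/-- A host graph with holes: the end points of its edges may belong to an interface `K`. -/
structure Ctx (K : Type) : Type 1 where
  V : Type
  E : Type
  finV : Finite V
  finE : Finite E
  src : E → V ⊕ K
  tgt : E → V ⊕ K
  vList : V → HList
  vMark : V → VMark
  eList : E → HList
  eMark : E → EMark
  root : V → Bool

/-- Fill the holes of a context by a host graph. -/
def Ctx.glue {K : Type} (C : Ctx K) (S : HostGraph) (k : K → S.V) : HostGraph where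
  V := C.V ⊕ S.V
  E := C.E ⊕ S.E
  finV := by
    have := C.finV
    have := S.finV
    infer_instance
  finE := by
    have := C.finE
    have := S.finE
    infer_instance
  src := Sum.elim (fun e => (C.src e).map id k) (fun e => .inr (S.src e))
  tgt := Sum.elim (fun e => (C.tgt e).map id k) (fun e => .inr (S.tgt e))
  vList := Sum.elim C.vList S.vList
  vMark := Sum.elim C.vMark S.vMark
  eList := Sum.elim C.eList S.eList
  eMark := Sum.elim C.eMark S.eMark
  root := Sum.elim C.root S.root

-- Cutting edges at an occurrence, and counting degrees

section Attached

variable {A B V F K : Type}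

/-- The map `t` (source or target) restricts to `u` along `(a, b)`, and satisfies the dangling
condition with respect to the interface `k`. -/
structure Attached (a : A → V) (b : B → F) (k : K → A) (t : F → V) (u : B → A) : Prop where
  comm : ∀ e, t (b e) = a (u e)
  dangling : ∀ e, e ∉ Set.range b → ∀ x, t e = a x → x ∈ Set.range k

variable {a : A → V} {b : B → F} {k : K → A} {t : F → V} {u : B → A}

open Classical in
/-- The end point, in the context, of an edge outside the occurrence. -/
noncomputable def Attached.restrict (h : Attached a b k t u) (e : {e // e ∉ Set.range b}) :
    {v // v ∉ Set.range a} ⊕ K :=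
  if hj : ∃ j, a (k j) = t e.1 then .inr hj.choose else .inl ⟨t e.1, fun ⟨x, hx⟩ => by
    obtain ⟨j, rfl⟩ := h.dangling e.1 e.2 x hx.symm
    exact hj ⟨j, hx⟩⟩

/-- An end point outside the range of `a` cannot be an interface node, so the first branch in the
definition of `restrict` is impossible for it. -/
theorem Attached.restrict_eq_inl (h : Attached a b k t u) (e : {e // e ∉ Set.range b})
    (v : {v // v ∉ Set.range a}) : h.restrict e = .inl v ↔ t e.1 = v.1 := by
  unfold Attached.restrict
  split_ifs with hj
  · simp only [false_iff]
    intro hv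
    obtain ⟨j, hj⟩ := hj
    exact v.2 ⟨k j, hj.trans hv⟩
  · simp [Subtype.ext_iff]

/-- Injectivity of `a` and `k` makes the interface point chosen in `restrict` the only possible one.
-/
theorem Attached.restrict_eq_inr (h : Attached a b k t u) (ha : Function.Injective a)
    (hk : Function.Injective k) (e : {e // e ∉ Set.range b})
    (j : K) : h.restrict e = .inr j ↔ t e.1 = a (k j) := by
  unfold Attached.restrict
  split_ifs with hj
  · simp only [Sum.inr.injEq]
    constructor
    · rintro rfl
      exact hj.choose_spec.symm
    · intro h
      exact hk (ha (hj.choose_spec.trans h))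
  · simp only [false_iff]
    exact fun h => hj ⟨j, h.symm⟩

/-- The edges at `v` split into those outside the occurrence and those inside it; the latter are
counted in the pattern by injectivity of `b`. -/
theorem Attached.card_eq [Finite F] [Finite B] (h : Attached a b k t u)
    (hb : Function.Injective b) (v : V) :
    Nat.card {e : F // t e = v} =
      Nat.card {e : {e // e ∉ Set.range b} // t e.1 = v} + Nat.card {e : B // a (u e) = v} := by
  classical
  rw [← Nat.card_sum]
  refine Nat.card_congr (Equiv.ofBijective (Sum.elim (fun e => ⟨e.1.1, e.2⟩)
    (fun e => ⟨b e.1, (h.comm e.1).trans e.2⟩)) ⟨?_, ?_⟩).symm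
  · rintro (⟨⟨e, he⟩, he'⟩ | ⟨e, he⟩) (⟨⟨f, hf⟩, hf'⟩ | ⟨f, hf⟩) hef
    · simpa using hef
    · exact absurd ⟨f, (congrArg Subtype.val hef).symm⟩ he
    · exact absurd ⟨e, congrArg Subtype.val hef⟩ hf
    · have : e = f := hb (congrArg Subtype.val hef)
      subst this
      rfl
  · rintro ⟨e, he⟩
    by_cases hr : e ∈ Set.range b
    · obtain ⟨f, rfl⟩ := hr
      exact ⟨.inr ⟨f, (h.comm f).symm.trans he⟩, rfl⟩
    · exact ⟨.inl ⟨⟨e, hr⟩, he⟩, rfl⟩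

theorem card_subtype_sum {α β : Type} [Finite α] [Finite β] (p : α ⊕ β → Prop) :
    Nat.card {c // p c} = Nat.card {x // p (.inl x)} + Nat.card {x // p (.inr x)} := by
  rw [← Nat.card_sum]
  exact Nat.card_congr Equiv.subtypeSum

variable {W D : Type} {kS : K → W} {w : D → W}

/-- Edges of the occurrence and inserted edges never end at a node outside the occurrence, so
replacement preserves the degrees there. -/
theorem Attached.card_glue_inl [Finite F] [Finite B] [Finite D] (h : Attached a b k t u)
    (hb : Function.Injective b) (v : {v // v ∉ Set.range a}) :
    Nat.card {e : {e // e ∉ Set.range b} ⊕ D // Sum.elim (fun e => (h.restrict e).map id kS)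
      (fun e => .inr (w e)) e = .inl v} = Nat.card {e : F // t e = v.1} := by
  have h₁ : IsEmpty {e : B // a (u e) = v.1} := ⟨fun e => v.2 ⟨_, e.2⟩⟩
  rw [card_subtype_sum, h.card_eq hb v.1, Nat.card_of_isEmpty (α := {e : B // a (u e) = v.1})]
  have h₂ : IsEmpty {e : D // Sum.elim (fun e => (h.restrict e).map id kS)
      (fun e => .inr (w e)) (.inr e) = Sum.inl v} := ⟨fun e => by simpa using e.2⟩
  rw [Nat.card_of_isEmpty (α := {e : D // _})]
  congr 1
  refine Nat.card_congr (Equiv.subtypeEquivRight fun e => ?_)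
  rw [← h.restrict_eq_inl]
  change (h.restrict e).map id kS = _ ↔ _
  rcases h.restrict e with x | x <;> simp

/-- At an interface node the context edges are the same before and after, so the degree changes by
the difference of the degrees in the two patterns. The additive form avoids subtraction of natural
numbers. -/
theorem Attached.card_glue_inr [Finite F] [Finite B] [Finite D] (h : Attached a b k t u)
    (ha : Function.Injective a) (hb : Function.Injective b) (hk : Function.Injective k)
    (hkS : Function.Injective kS) (j : K) :
    Nat.card {e : {e // e ∉ Set.range b} ⊕ D // Sum.elim (fun e => (h.restrict e).map id kS)
      (fun e => .inr (w e)) e = .inr (kS j)} + Nat.card {e : B // u e = k j} =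
    Nat.card {e : F // t e = a (k j)} + Nat.card {e : D // w e = kS j} := by
  rw [card_subtype_sum, h.card_eq hb]
  simp only [Sum.elim_inl, Sum.elim_inr, Sum.inr.injEq, ha.eq_iff]
  have : Nat.card {e : {e // e ∉ Set.range b} //
      (h.restrict e).map id kS = Sum.inr (kS j)} =
      Nat.card {e : {e // e ∉ Set.range b} // t e.1 = a (k j)} := by
    refine Nat.card_congr (Equiv.subtypeEquivRight fun e => ?_)
    rw [← h.restrict_eq_inr ha hk]
    rcases h.restrict e with x | x <;> simp [hkS.eq_iff]
  omega

/-- Context edges reach the inserted graph only through the interface, so they contribute nothing at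
any other inserted node. -/
theorem Attached.card_glue_new [Finite F] [Finite D] (h : Attached a b k t u)
    (p : W) (hp : p ∉ Set.range kS) :
    Nat.card {e : {e // e ∉ Set.range b} ⊕ D // Sum.elim (fun e => (h.restrict e).map id kS)
      (fun e => .inr (w e)) e = .inr p} = Nat.card {e : D // w e = p} := by
  have h₁ : IsEmpty {e : {e // e ∉ Set.range b} // Sum.elim (fun e => (h.restrict e).map id kS)
      (fun e => .inr (w e)) (.inl e) = Sum.inr p} := ⟨fun ⟨e, he⟩ => by
    rcases h' : h.restrict e with x | x
    · simp [h'] at he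
    · simp only [Sum.elim_inl, h', Sum.map_inr, Sum.inr.injEq] at he
      exact hp ⟨x, he⟩⟩
  rw [card_subtype_sum, Nat.card_of_isEmpty (α := {e : {e // e ∉ Set.range b} // _})]
  simp

end Attached

/-- `a` and `b` embed the graph structure of `M` in `G`, and satisfy the dangling condition with
respect to the interface `k`. -/
structure IsOcc {K : Type} (M : HostGraph) (k : K → M.V) (G : HostGraph) (a : M.V → G.V)
    (b : M.E → G.E) : Prop where
  injV : Function.Injective a
  injE : Function.Injective b
  src : Attached a b k G.src M.src
  tgt : Attached a b k G.tgt M.tgt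

/-- What remains of `G` outside an occurrence. -/
noncomputable def IsOcc.ctx {K : Type} {M : HostGraph} {k : K → M.V} {G : HostGraph}
    {a : M.V → G.V} {b : M.E → G.E} (o : IsOcc M k G a b) : Ctx K where
  V := {v // v ∉ Set.range a}
  E := {e // e ∉ Set.range b}
  finV := by
    have := G.finV
    infer_instance
  finE := by
    have := G.finE
    infer_instance
  src := o.src.restrict
  tgt := o.tgt.restrict
  vList v := G.vList v.1
  vMark v := G.vMark v.1
  eList e := G.eList e.1
  eMark e := G.eMark e.1
  root v := G.root v.1

/-- The values of a family of list variables. -/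
def LAssign.lists {X : LSort → Type} {A : Type} (α : LAssign X) (l : A → X .list) : A → HList :=
  fun p => α .list (l p)

/-- Change the lists of a host graph. -/
def HostGraph.relabel (S : HostGraph) (lV : S.V → HList) (lE : S.E → HList) : HostGraph :=
  { S with vList := lV, eList := lE }

/-! ### Definability is preserved by gluing -/

section Transfer

variable {K : Type} [Finite K] {M S : HostGraph} {k : K → M.V} {kS : K → S.V}

/-- The predicate `P` on the graphs obtained by replacing an occurrence of `M` by `S` is definable
as a predicate on the given graphs. -/
def Transfers (M S : HostGraph) (k : K → M.V) (kS : K → S.V) (P : Pred N E X) : Prop :=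
  ∀ {N' E' : Type} {X' : LSort → Type} (σ : N → N' ⊕ S.V) (τ : E → E' ⊕ S.E)
    (ρ : ∀ s, X s → X' s) (a : M.V → N') (b : M.E → E') (lV : S.V → X' .list)
    (lE : S.E → X' .list), ∃ Q : Pred N' E' X', Definable Q ∧
      ∀ (G : HostGraph) (ν : N' → G.V) (ε : E' → G.E) (α : LAssign X')
        (o : IsOcc M k G (fun x => ν (a x)) (fun e => ε (b e)))
        (ν' : N → o.ctx.V ⊕ S.V) (ε' : E → o.ctx.E ⊕ S.E),
        (∀ x, (ν' x).map Subtype.val id = (σ x).map ν id) →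
        (∀ e, (ε' e).map Subtype.val id = (τ e).map ε id) →
        (Q G ν ε α ↔ P (o.ctx.glue (S.relabel (α.lists lV) (α.lists lE)) kS)
          ν' ε' (fun s x => α s (ρ s x)))

/-- In `Transfers` the value of a variable is compared with its placement only after forgetting that
context items avoid the occurrence. The comparison nevertheless forces a variable placed on the left
to denote an item outside the occurrence. -/
theorem eq_inl_of_map {V A W : Type} {p : V → Prop} {w : {v // p v} ⊕ W} {ν : A → V} {n : A}
    (h : w.map Subtype.val id = (Sum.inl n : A ⊕ W).map ν id) : ∃ hn, w = .inl ⟨ν n, hn⟩ := by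
  rcases w with ⟨v, hv⟩ | w
  · simp only [Sum.map_inl, Sum.inl.injEq] at h
    subst h
    exact ⟨hv, rfl⟩
  · simp at h

theorem eq_inr_of_map {V A W : Type} {p : V → Prop} {w : {v // p v} ⊕ W} {ν : A → V} {q : W}
    (h : w.map Subtype.val id = (Sum.inr q : A ⊕ W).map ν id) : w = .inr q := by
  rcases w with ⟨v, hv⟩ | w
  · simp at h
  · simpa using h

end Transfer

end GP2

namespace GP2

variable {N E : Type} {X : LSort → Type}
variable {K : Type} {M S : HostGraph} {k : K → M.V} {kS : K → S.V}

theorem IsOcc.indeg_glue_inl {G : HostGraph} {a : M.V → G.V} {b : M.E → G.E}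
    (o : IsOcc M k G a b) (v : {v // v ∉ Set.range a}) :
    (o.ctx.glue S kS).indeg (.inl v) = G.indeg v.1 := by
  have := G.finE
  have := M.finE
  have := S.finE
  exact o.tgt.card_glue_inl o.injE v

theorem IsOcc.outdeg_glue_inl {G : HostGraph} {a : M.V → G.V} {b : M.E → G.E}
    (o : IsOcc M k G a b) (v : {v // v ∉ Set.range a}) :
    (o.ctx.glue S kS).outdeg (.inl v) = G.outdeg v.1 := by
  have := G.finE
  have := M.finE
  have := S.finE
  exact o.src.card_glue_inl o.injE v

theorem IsOcc.indeg_glue_inr {G : HostGraph} {a : M.V → G.V} {b : M.E → G.E}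
    (o : IsOcc M k G a b) (hk : Function.Injective k) (hkS : Function.Injective kS) (j : K) :
    (o.ctx.glue S kS).indeg (.inr (kS j)) + M.indeg (k j) = G.indeg (a (k j)) + S.indeg (kS j) := by
  have := G.finE
  have := M.finE
  have := S.finE
  exact o.tgt.card_glue_inr o.injV o.injE hk hkS j

theorem IsOcc.outdeg_glue_inr {G : HostGraph} {a : M.V → G.V} {b : M.E → G.E}
    (o : IsOcc M k G a b) (hk : Function.Injective k) (hkS : Function.Injective kS) (j : K) :
    (o.ctx.glue S kS).outdeg (.inr (kS j)) + M.outdeg (k j) =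
      G.outdeg (a (k j)) + S.outdeg (kS j) := by
  have := G.finE
  have := M.finE
  have := S.finE
  exact o.src.card_glue_inr o.injV o.injE hk hkS j

theorem IsOcc.indeg_glue_new {G : HostGraph} {a : M.V → G.V} {b : M.E → G.E}
    (o : IsOcc M k G a b) (p : S.V) (hp : p ∉ Set.range kS) :
    (o.ctx.glue S kS).indeg (.inr p) = S.indeg p := by
  have := G.finE
  have := S.finE
  exact o.tgt.card_glue_new p hp

theorem IsOcc.outdeg_glue_new {G : HostGraph} {a : M.V → G.V} {b : M.E → G.E}
    (o : IsOcc M k G a b) (p : S.V) (hp : p ∉ Set.range kS) :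
    (o.ctx.glue S kS).outdeg (.inr p) = S.outdeg p := by
  have := G.finE
  have := S.finE
  exact o.src.card_glue_new p hp

theorem pureDefinable_int_eq (c : ℤ) (Y : LSort → Type) (x : Y .int) :
    PureDefinable (X := Y) (fun α => c = α .int x) := fun _ _ _ ρ =>
  ⟨.lstEq (.atom (.int (.const c))) (.atom (.int (.var (ρ _ x)))), fun _ _ _ _ => singleton_int_eq⟩

/-- This expresses that two integers differ by a known constant, as degrees at interface nodes do
before and after a replacement. -/
theorem pureDefinable_add_eq (c d : ℤ) (Y : LSort → Type) (x y : Y .int) :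
    PureDefinable (X := Y)
      (fun α => (fun m n : ℤ => m + c = n + d) (α .int x) (α .int y)) := fun _ _ _ ρ =>
  ⟨.lstEq (.atom (.int (.op .add (.var (ρ _ x)) (.const c))))
    (.atom (.int (.op .add (.var (ρ _ y)) (.const d)))), fun _ _ _ _ => singleton_int_eq⟩

/-- There are four cases, according to whether the edge and the node belong to the context or to
`S`. The only one that needs a translation is a context edge whose source is a node of `S`: that
node is then an interface node, and in the original graph the source is the corresponding node of
the match. -/
theorem Transfers.src [Finite K] (hk : Function.Injective k) (e : E) (x : N) :
    Transfers M S k kS (X := X) (fun G ν ε _ => G.src (ε e) = ν x) := by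
  intro N' E' X' σ τ ρ a b lV lE
  rcases hτ : τ e with e₀ | f <;> rcases hσ : σ x with n | p
  · refine ⟨_, .src e₀ n, fun G ν ε α o ν' ε' hν hε => ?_⟩
    beta_reduce
    obtain ⟨h₁, hx⟩ := eq_inl_of_map ((hν x).trans (by rw [hσ]))
    obtain ⟨h₂, he⟩ := eq_inl_of_map ((hε e).trans (by rw [hτ]))
    rw [hx, he, ← o.src.restrict_eq_inl ⟨_, h₂⟩ ⟨_, h₁⟩]
    change _ ↔ (o.src.restrict ⟨_, h₂⟩).map id kS = _
    rcases o.src.restrict ⟨ε e₀, h₂⟩ with y | y <;> simp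
  -- The disjunction runs over the interface points that `kS` sends to `p`; it is empty, hence
  -- false, if `p` is a newly created node.
  · refine ⟨_, .exists_finite fun j : K => (Definable.const (kS j = p)).and
      ((NodeTerm.definableNode (.src e₀)).eq (NodeTerm.definableNode (.var (a (k j))))),
      fun G ν ε α o ν' ε' hν hε => ?_⟩
    beta_reduce
    have hx := eq_inr_of_map ((hν x).trans (by rw [hσ]))
    obtain ⟨h₂, he⟩ := eq_inl_of_map ((hε e).trans (by rw [hτ]))
    rw [hx, he]
    change (∃ j, kS j = p ∧ G.src (ε e₀) = ν (a (k j))) ↔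
      (o.src.restrict ⟨_, h₂⟩).map id kS = .inr p
    simp only [← o.src.restrict_eq_inr o.injV hk ⟨_, h₂⟩]
    rcases o.src.restrict ⟨ε e₀, h₂⟩ with y | y <;> simp
  · refine ⟨_, .const False, fun G ν ε α o ν' ε' hν hε => ?_⟩
    beta_reduce
    obtain ⟨h₁, hx⟩ := eq_inl_of_map ((hν x).trans (by rw [hσ]))
    have he := eq_inr_of_map ((hε e).trans (by rw [hτ]))
    rw [hx, he]
    change _ ↔ Sum.inr _ = Sum.inl _
    simp
  · refine ⟨_, .const (S.src f = p), fun G ν ε α o ν' ε' hν hε => ?_⟩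
    beta_reduce
    have hx := eq_inr_of_map ((hν x).trans (by rw [hσ]))
    have he := eq_inr_of_map ((hε e).trans (by rw [hτ]))
    rw [hx, he]
    change _ ↔ Sum.inr (S.src f) = Sum.inr p
    simp

theorem Transfers.tgt [Finite K] (hk : Function.Injective k) (e : E) (x : N) :
    Transfers M S k kS (X := X) (fun G ν ε _ => G.tgt (ε e) = ν x) := by
  intro N' E' X' σ τ ρ a b lV lE
  rcases hτ : τ e with e₀ | f <;> rcases hσ : σ x with n | p
  · refine ⟨_, .tgt e₀ n, fun G ν ε α o ν' ε' hν hε => ?_⟩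
    beta_reduce
    obtain ⟨h₁, hx⟩ := eq_inl_of_map ((hν x).trans (by rw [hσ]))
    obtain ⟨h₂, he⟩ := eq_inl_of_map ((hε e).trans (by rw [hτ]))
    rw [hx, he, ← o.tgt.restrict_eq_inl ⟨_, h₂⟩ ⟨_, h₁⟩]
    change _ ↔ (o.tgt.restrict ⟨_, h₂⟩).map id kS = _
    rcases o.tgt.restrict ⟨ε e₀, h₂⟩ with y | y <;> simp
  · refine ⟨_, .exists_finite fun j : K => (Definable.const (kS j = p)).and
      ((NodeTerm.definableNode (.tgt e₀)).eq (NodeTerm.definableNode (.var (a (k j))))),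
      fun G ν ε α o ν' ε' hν hε => ?_⟩
    beta_reduce
    have hx := eq_inr_of_map ((hν x).trans (by rw [hσ]))
    obtain ⟨h₂, he⟩ := eq_inl_of_map ((hε e).trans (by rw [hτ]))
    rw [hx, he]
    change (∃ j, kS j = p ∧ G.tgt (ε e₀) = ν (a (k j))) ↔
      (o.tgt.restrict ⟨_, h₂⟩).map id kS = .inr p
    simp only [← o.tgt.restrict_eq_inr o.injV hk ⟨_, h₂⟩]
    rcases o.tgt.restrict ⟨ε e₀, h₂⟩ with y | y <;> simp
  · refine ⟨_, .const False, fun G ν ε α o ν' ε' hν hε => ?_⟩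
    beta_reduce
    obtain ⟨h₁, hx⟩ := eq_inl_of_map ((hν x).trans (by rw [hσ]))
    have he := eq_inr_of_map ((hε e).trans (by rw [hτ]))
    rw [hx, he]
    change _ ↔ Sum.inr _ = Sum.inl _
    simp
  · refine ⟨_, .const (S.tgt f = p), fun G ν ε α o ν' ε' hν hε => ?_⟩
    beta_reduce
    have hx := eq_inr_of_map ((hν x).trans (by rw [hσ]))
    have he := eq_inr_of_map ((hε e).trans (by rw [hτ]))
    rw [hx, he]
    change _ ↔ Sum.inr (S.tgt f) = Sum.inr p
    simp

theorem Transfers.indeg (hk : Function.Injective k) (hkS : Function.Injective kS)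
    (x : N) (z : X .int) :
    Transfers M S k kS (E := E) (fun G ν _ α => (G.indeg (ν x) : ℤ) = α .int z) := by
  intro N' E' X' σ τ ρ a b lV lE
  rcases hσ : σ x with n | p
  · refine ⟨_, .indeg n (ρ _ z), fun G ν ε α o ν' ε' hν hε => ?_⟩
    beta_reduce
    obtain ⟨h₁, hx⟩ := eq_inl_of_map ((hν x).trans (by rw [hσ]))
    rw [hx]
    exact iff_of_eq (congrArg (fun d : ℕ => (d : ℤ) = α .int (ρ .int z))
      (o.indeg_glue_inl (S := S.relabel (α.lists lV) (α.lists lE)) (kS := kS) ⟨ν n, h₁⟩).symm)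
  · by_cases hp : p ∈ Set.range kS
    · obtain ⟨j, rfl⟩ := hp
      -- The required value is compared with the indegree in `G` after adding to each side the
      -- constant that `indeg_glue_inr` puts there.
      refine ⟨_, (NodeTerm.definableNode (.var (a (k j)))).indeg.rel₂ (.var (ρ _ z))
        (R := fun m n : ℤ => m + S.indeg (kS j) = n + M.indeg (k j))
        (pureDefinable_add_eq (S.indeg (kS j)) (M.indeg (k j))), fun G ν ε α o ν' ε' hν hε => ?_⟩
      beta_reduce
      rw [eq_inr_of_map ((hν x).trans (by rw [hσ]))]
      have : (o.ctx.glue (S.relabel (α.lists lV) (α.lists lE)) kS).indeg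
          (.inr (kS j)) + M.indeg (k j) = G.indeg (ν (a (k j))) + S.indeg (kS j) :=
        o.indeg_glue_inr hk hkS j
      have key : ∀ y : ℤ, (G.indeg (ν (a (k j))) : ℤ) + S.indeg (kS j) = y + M.indeg (k j) ↔
          ((o.ctx.glue (S.relabel (α.lists lV) (α.lists lE)) kS).indeg (.inr (kS j)) : ℤ) = y := by
        intro y
        omega
      exact key (α .int (ρ .int z))
    · refine ⟨_, .pure _ (pureDefinable_int_eq (S.indeg p) _ (ρ _ z)),
        fun G ν ε α o ν' ε' hν hε => ?_⟩
      beta_reduce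
      rw [eq_inr_of_map ((hν x).trans (by rw [hσ]))]
      exact iff_of_eq (congrArg (fun d : ℕ => (d : ℤ) = α .int (ρ .int z))
        (o.indeg_glue_new (S := S.relabel (α.lists lV) (α.lists lE)) p hp).symm)

theorem Transfers.outdeg (hk : Function.Injective k) (hkS : Function.Injective kS)
    (x : N) (z : X .int) :
    Transfers M S k kS (E := E) (fun G ν _ α => (G.outdeg (ν x) : ℤ) = α .int z) := by
  intro N' E' X' σ τ ρ a b lV lE
  rcases hσ : σ x with n | p
  · refine ⟨_, .outdeg n (ρ _ z), fun G ν ε α o ν' ε' hν hε => ?_⟩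
    beta_reduce
    obtain ⟨h₁, hx⟩ := eq_inl_of_map ((hν x).trans (by rw [hσ]))
    rw [hx]
    exact iff_of_eq (congrArg (fun d : ℕ => (d : ℤ) = α .int (ρ .int z))
      (o.outdeg_glue_inl (S := S.relabel (α.lists lV) (α.lists lE)) (kS := kS) ⟨ν n, h₁⟩).symm)
  · by_cases hp : p ∈ Set.range kS
    · obtain ⟨j, rfl⟩ := hp
      refine ⟨_, (NodeTerm.definableNode (.var (a (k j)))).outdeg.rel₂ (.var (ρ _ z))
        (R := fun m n : ℤ => m + S.outdeg (kS j) = n + M.outdeg (k j))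
        (pureDefinable_add_eq (S.outdeg (kS j)) (M.outdeg (k j))),
        fun G ν ε α o ν' ε' hν hε => ?_⟩
      beta_reduce
      rw [eq_inr_of_map ((hν x).trans (by rw [hσ]))]
      have : (o.ctx.glue (S.relabel (α.lists lV) (α.lists lE)) kS).outdeg
          (.inr (kS j)) + M.outdeg (k j) = G.outdeg (ν (a (k j))) + S.outdeg (kS j) :=
        o.outdeg_glue_inr hk hkS j
      have key : ∀ y : ℤ, (G.outdeg (ν (a (k j))) : ℤ) + S.outdeg (kS j) = y + M.outdeg (k j) ↔
          ((o.ctx.glue (S.relabel (α.lists lV) (α.lists lE)) kS).outdeg (.inr (kS j)) : ℤ) = y := by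
        intro y
        omega
      exact key (α .int (ρ .int z))
    · refine ⟨_, .pure _ (pureDefinable_int_eq (S.outdeg p) _ (ρ _ z)),
        fun G ν ε α o ν' ε' hν hε => ?_⟩
      beta_reduce
      rw [eq_inr_of_map ((hν x).trans (by rw [hσ]))]
      exact iff_of_eq (congrArg (fun d : ℕ => (d : ℤ) = α .int (ρ .int z))
        (o.outdeg_glue_new (S := S.relabel (α.lists lV) (α.lists lE)) p hp).symm)

/-- Definable properties of the result of a replacement are definable. -/
theorem Definable.transfers [Finite K] (hk : Function.Injective k) (hkS : Function.Injective kS)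
    {P : Pred N E X} (hP : Definable P) : Transfers M S k kS P := by
  have hM := M.finV
  have hM' := M.finE
  have hS := S.finV
  have hS' := S.finE
  induction hP with
  | pure p h =>
    exact fun σ τ ρ a b lV lE => ⟨_, (Definable.pure p h).rename Empty.elim Empty.elim ρ,
      fun G ν ε α o ν' ε' hν hε => Iff.rfl⟩
  | src e x => exact Transfers.src hk e x
  | tgt e x => exact Transfers.tgt hk e x
  | nodeList x l =>
    intro N' E' X' σ τ ρ a b lV lE
    rcases hσ : σ x with n | p
    · refine ⟨_, .nodeList n (ρ _ l), fun G ν ε α o ν' ε' hν hε => ?_⟩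
      beta_reduce
      obtain ⟨h₁, hx⟩ := eq_inl_of_map ((hν x).trans (by rw [hσ]))
      rw [hx]
      rfl
    · refine ⟨_, .pure _ (pureDefinable_eq .list _ (lV p) (ρ _ l)), fun G ν ε α o ν' ε' hν hε => ?_⟩
      beta_reduce
      rw [eq_inr_of_map ((hν x).trans (by rw [hσ]))]
      rfl
  | edgeList e l =>
    intro N' E' X' σ τ ρ a b lV lE
    rcases hτ : τ e with n | p
    · refine ⟨_, .edgeList n (ρ _ l), fun G ν ε α o ν' ε' hν hε => ?_⟩
      beta_reduce
      obtain ⟨h₁, hx⟩ := eq_inl_of_map ((hε e).trans (by rw [hτ]))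
      rw [hx]
      rfl
    · refine ⟨_, .pure _ (pureDefinable_eq .list _ (lE p) (ρ _ l)), fun G ν ε α o ν' ε' hν hε => ?_⟩
      beta_reduce
      rw [eq_inr_of_map ((hε e).trans (by rw [hτ]))]
      rfl
  | indeg x z => exact Transfers.indeg hk hkS x z
  | outdeg x z => exact Transfers.outdeg hk hkS x z
  | root x =>
    intro N' E' X' σ τ ρ a b lV lE
    rcases hσ : σ x with n | p
    · refine ⟨_, .root n, fun G ν ε α o ν' ε' hν hε => ?_⟩
      beta_reduce
      obtain ⟨h₁, hx⟩ := eq_inl_of_map ((hν x).trans (by rw [hσ]))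
      rw [hx]
      rfl
    · refine ⟨_, .const (S.root p = true), fun G ν ε α o ν' ε' hν hε => ?_⟩
      beta_reduce
      rw [eq_inr_of_map ((hν x).trans (by rw [hσ]))]
      rfl
  | nodeMark x m =>
    intro N' E' X' σ τ ρ a b lV lE
    rcases hσ : σ x with n | p
    · refine ⟨_, .nodeMark n m, fun G ν ε α o ν' ε' hν hε => ?_⟩
      beta_reduce
      obtain ⟨h₁, hx⟩ := eq_inl_of_map ((hν x).trans (by rw [hσ]))
      rw [hx]
      rfl
    · refine ⟨_, .const (m.Matches (S.vMark p)), fun G ν ε α o ν' ε' hν hε => ?_⟩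
      beta_reduce
      rw [eq_inr_of_map ((hν x).trans (by rw [hσ]))]
      rfl
  | edgeMark e m =>
    intro N' E' X' σ τ ρ a b lV lE
    rcases hτ : τ e with n | p
    · refine ⟨_, .edgeMark n m, fun G ν ε α o ν' ε' hν hε => ?_⟩
      beta_reduce
      obtain ⟨h₁, hx⟩ := eq_inl_of_map ((hε e).trans (by rw [hτ]))
      rw [hx]
      rfl
    · refine ⟨_, .const (m.Matches (S.eMark p)), fun G ν ε α o ν' ε' hν hε => ?_⟩
      beta_reduce
      rw [eq_inr_of_map ((hε e).trans (by rw [hτ]))]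
      rfl
  | nodeEq x y =>
    intro N' E' X' σ τ ρ a b lV lE
    have key : ∀ {G : HostGraph} {p : G.V → Prop} {ν : N' → G.V} (w w' : {v // p v} ⊕ S.V),
        w.map Subtype.val id = (σ x).map ν id → w'.map Subtype.val id = (σ y).map ν id →
        (w = w' ↔ (σ x).map ν id = (σ y).map ν id) := by
      intro G p ν w w' h h'
      rw [← h, ← h', (Sum.map_injective.2 ⟨Subtype.val_injective, Function.injective_id⟩).eq_iff]
    rcases hσ : σ x with n | p <;> rcases hσ' : σ y with n' | p'
    · refine ⟨_, .nodeEq n n', fun G ν ε α o ν' ε' hν hε => ?_⟩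
      refine ((key _ _ (hν x) (hν y)).trans ?_).symm
      simp [hσ, hσ']
    · refine ⟨_, .const False, fun G ν ε α o ν' ε' hν hε => ?_⟩
      refine ((key _ _ (hν x) (hν y)).trans ?_).symm
      simp [hσ, hσ']
    · refine ⟨_, .const False, fun G ν ε α o ν' ε' hν hε => ?_⟩
      refine ((key _ _ (hν x) (hν y)).trans ?_).symm
      simp [hσ, hσ']
    · refine ⟨_, .const (p = p'), fun G ν ε α o ν' ε' hν hε => ?_⟩
      refine ((key _ _ (hν x) (hν y)).trans ?_).symm
      simp [hσ, hσ']
  | edgeEq x y =>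
    intro N' E' X' σ τ ρ a b lV lE
    have key : ∀ {G : HostGraph} {p : G.E → Prop} {ν : E' → G.E} (w w' : {v // p v} ⊕ S.E),
        w.map Subtype.val id = (τ x).map ν id → w'.map Subtype.val id = (τ y).map ν id →
        (w = w' ↔ (τ x).map ν id = (τ y).map ν id) := by
      intro G p ν w w' h h'
      rw [← h, ← h', (Sum.map_injective.2 ⟨Subtype.val_injective, Function.injective_id⟩).eq_iff]
    rcases hτ : τ x with n | p <;> rcases hτ' : τ y with n' | p'
    · refine ⟨_, .edgeEq n n', fun G ν ε α o ν' ε' hν hε => ?_⟩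
      refine ((key _ _ (hε x) (hε y)).trans ?_).symm
      simp [hτ, hτ']
    · refine ⟨_, .const False, fun G ν ε α o ν' ε' hν hε => ?_⟩
      refine ((key _ _ (hε x) (hε y)).trans ?_).symm
      simp [hτ, hτ']
    · refine ⟨_, .const False, fun G ν ε α o ν' ε' hν hε => ?_⟩
      refine ((key _ _ (hε x) (hε y)).trans ?_).symm
      simp [hτ, hτ']
    · refine ⟨_, .const (p = p'), fun G ν ε α o ν' ε' hν hε => ?_⟩
      refine ((key _ _ (hε x) (hε y)).trans ?_).symm
      simp [hτ, hτ']
  | and _ _ ih₁ ih₂ =>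
    intro N' E' X' σ τ ρ a b lV lE
    obtain ⟨Q₁, h₁, h₁'⟩ := ih₁ σ τ ρ a b lV lE
    obtain ⟨Q₂, h₂, h₂'⟩ := ih₂ σ τ ρ a b lV lE
    exact ⟨_, h₁.and h₂, fun G ν ε α o ν' ε' hν hε =>
      and_congr (h₁' G ν ε α o ν' ε' hν hε) (h₂' G ν ε α o ν' ε' hν hε)⟩
  | not _ ih =>
    intro N' E' X' σ τ ρ a b lV lE
    obtain ⟨Q₁, h₁, h₁'⟩ := ih σ τ ρ a b lV lE
    exact ⟨_, h₁.not, fun G ν ε α o ν' ε' hν hε => not_congr (h₁' G ν ε α o ν' ε' hν hε)⟩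
  | existsV _ ih =>
    intro N' E' X' σ τ ρ a b lV lE
    -- `Q₁` treats a witness outside the match, named by the new variable `none`; the `Q₂ p` treat
    -- the finitely many possible witnesses `p` in the inserted graph. The condition `hne` keeps the
    -- first witness off the match.
    obtain ⟨Q₁, h₁, h₁'⟩ := ih (fun x : Option _ => x.elim (.inl none) fun y => (σ y).map some id) τ ρ
      (fun m => some (a m)) b lV lE
    choose Q₂ h₂ h₂' using fun p : S.V => ih (fun x : Option _ => x.elim (.inr p) σ) τ ρ a b lV lE
    have hne : Definable (N := Option N') (E := E') (X := X')
        (fun G ν ε α => ¬ ∃ m, ν (some (a m)) = ν none) :=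
      (Definable.exists_finite fun m => .nodeEq (some (a m)) none).not
    refine ⟨_, (hne.and h₁).existsV.or (.exists_finite h₂), fun G ν ε α o ν' ε' hν hε => ?_⟩
    have e₁ : ∀ (v : G.V) (hv : ¬ ∃ m, ν (a m) = v) (x : Option _),
        (x.elim (.inl ⟨v, hv⟩) ν' : o.ctx.V ⊕ S.V).map Subtype.val id =
        (x.elim (.inl none) fun y => (σ y).map some id : Option N' ⊕ S.V).map
          (fun x => x.elim v ν) id := by
      rintro v hv (_ | x)
      · rfl
      · refine (hν x).trans ?_
        simp only [Option.elim]
        rcases σ x with y | y <;> rfl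
    have e₂ : ∀ (p : S.V) (x : Option _), (x.elim (.inr p) ν' : o.ctx.V ⊕ S.V).map Subtype.val id =
        (x.elim (.inr p) σ : N' ⊕ S.V).map ν id := by
      rintro p (_ | x)
      · rfl
      · exact hν x
    constructor
    · rintro (⟨v, hv, h⟩ | ⟨p, h⟩)
      · exact ⟨.inl ⟨v, hv⟩, (h₁' G _ ε α o _ ε' (e₁ v hv) hε).1 h⟩
      · exact ⟨.inr p, (h₂' p G ν ε α o _ ε' (e₂ p) hε).1 h⟩
    · rintro ⟨⟨v, hv⟩ | p, h⟩
      · exact .inl ⟨v, hv, (h₁' G _ ε α o _ ε' (e₁ v hv) hε).2 h⟩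
      · exact .inr ⟨p, (h₂' p G ν ε α o _ ε' (e₂ p) hε).2 h⟩
  | existsE _ ih =>
    intro N' E' X' σ τ ρ a b lV lE
    obtain ⟨Q₁, h₁, h₁'⟩ := ih σ (fun x : Option _ => x.elim (.inl none) fun y => (τ y).map some id) ρ
      a (fun m => some (b m)) lV lE
    choose Q₂ h₂ h₂' using fun p : S.E => ih σ (fun x : Option _ => x.elim (.inr p) τ) ρ a b lV lE
    have hne : Definable (N := N') (E := Option E') (X := X')
        (fun G ν ε α => ¬ ∃ m, ε (some (b m)) = ε none) :=
      (Definable.exists_finite fun m => .edgeEq (some (b m)) none).not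
    refine ⟨_, (hne.and h₁).existsE.or (.exists_finite h₂), fun G ν ε α o ν' ε' hν hε => ?_⟩
    have e₁ : ∀ (v : G.E) (hv : ¬ ∃ m, ε (b m) = v) (x : Option _),
        (x.elim (.inl ⟨v, hv⟩) ε' : o.ctx.E ⊕ S.E).map Subtype.val id =
        (x.elim (.inl none) fun y => (τ y).map some id : Option E' ⊕ S.E).map
          (fun x => x.elim v ε) id := by
      rintro v hv (_ | x)
      · rfl
      · refine (hε x).trans ?_
        simp only [Option.elim]
        rcases τ x with y | y <;> rfl
    have e₂ : ∀ (p : S.E) (x : Option _), (x.elim (.inr p) ε' : o.ctx.E ⊕ S.E).map Subtype.val id =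
        (x.elim (.inr p) τ : E' ⊕ S.E).map ε id := by
      rintro p (_ | x)
      · rfl
      · exact hε x
    constructor
    · rintro (⟨v, hv, h⟩ | ⟨p, h⟩)
      · exact ⟨.inl ⟨v, hv⟩, (h₁' G ν _ α o ν' _ hν (e₁ v hv)).1 h⟩
      · exact ⟨.inr p, (h₂' p G ν ε α o ν' _ hν (e₂ p)).1 h⟩
    · rintro ⟨⟨v, hv⟩ | p, h⟩
      · exact .inl ⟨v, hv, (h₁' G ν _ α o ν' _ hν (e₁ v hv)).2 h⟩
      · exact .inr ⟨p, (h₂' p G ν ε α o ν' _ hν (e₂ p)).2 h⟩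
  | existsL s _ ih =>
    intro N' E' X' σ τ ρ a b lV lE
    -- Label domains do not depend on the graph, so a label quantifier is kept as it is; the
    -- variables that hold the inserted lists are merely weakened.
    obtain ⟨Q₁, h₁, h₁'⟩ := ih σ τ (Ext.map ρ s) a b (fun p => .old (lV p)) (fun p => .old (lE p))
    refine ⟨_, h₁.existsL, fun G ν ε α o ν' ε' hν hε => exists_congr fun d => ?_⟩
    rw [h₁' G ν ε (Ext.assign α d) o ν' ε' hν hε, Ext.assign_map]
    rfl
  | rename f g h _ ih =>
    intro N' E' X' σ τ ρ a b lV lE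
    obtain ⟨Q₁, h₁, h₁'⟩ := ih (fun x => σ (f x)) (fun x => τ (g x)) (fun s x => ρ s (h s x))
      a b lV lE
    exact ⟨_, h₁, fun G ν ε α o ν' ε' hν hε => h₁' G ν ε α o _ _ (fun _ => hν _) (fun _ => hε _)⟩

end GP2

namespace GP2

variable {K : Type} {M S : HostGraph} {k : K → M.V} {kS : K → S.V}

/-! ### Matches, and presentations of graphs by gluing -/

/-- An occurrence that preserves labels and roots. -/
structure IsMatch (M : HostGraph) (k : K → M.V) (G : HostGraph) (a : M.V → G.V)
    (b : M.E → G.E) : Prop where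
  occ : IsOcc M k G a b
  vList : ∀ x, G.vList (a x) = M.vList x
  vMark : ∀ x, G.vMark (a x) = M.vMark x
  root : ∀ x, G.root (a x) = M.root x
  eList : ∀ e, G.eList (b e) = M.eList e
  eMark : ∀ e, G.eMark (b e) = M.eMark e

theorem sumElim_subtypeVal_bijective {A V : Type} {a : A → V} (ha : Function.Injective a) :
    Function.Bijective (Sum.elim Subtype.val a : {v // v ∉ Set.range a} ⊕ A → V) := by
  constructor
  · rintro (⟨v, hv⟩ | x) (⟨w, hw⟩ | y) h
    · exact congrArg Sum.inl (Subtype.ext h)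
    · exact absurd ⟨y, h.symm⟩ hv
    · exact absurd ⟨x, h⟩ hw
    · exact congrArg Sum.inr (ha h)
  · intro v
    by_cases hv : v ∈ Set.range a
    · obtain ⟨x, rfl⟩ := hv
      exact ⟨.inr x, rfl⟩
    · exact ⟨.inl ⟨v, hv⟩, rfl⟩

theorem Attached.sumElim_restrict {A B V F : Type} {a : A → V} {b : B → F} {k : K → A}
    {t : F → V} {u : B → A} (h : Attached a b k t u) (e : {e // e ∉ Set.range b}) :
    Sum.elim Subtype.val a ((h.restrict e).map id k) = t e.1 := by
  unfold Attached.restrict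
  split_ifs with hj
  · exact hj.choose_spec
  · rfl

/-- The graph is recovered by gluing the match into the context. -/
noncomputable def IsMatch.iso {G : HostGraph} {a : M.V → G.V} {b : M.E → G.E}
    (h : IsMatch M k G a b) : (h.occ.ctx.glue M k).Iso G where
  onV := Equiv.ofBijective (Sum.elim Subtype.val a) (sumElim_subtypeVal_bijective h.occ.injV)
  onE := Equiv.ofBijective (Sum.elim Subtype.val b) (sumElim_subtypeVal_bijective h.occ.injE)
  src_comm := by
    rintro (e | e)
    · exact (h.occ.src.sumElim_restrict e).symm
    · exact h.occ.src.comm e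
  tgt_comm := by
    rintro (e | e)
    · exact (h.occ.tgt.sumElim_restrict e).symm
    · exact h.occ.tgt.comm e
  vList_comm := by
    rintro (v | v)
    · rfl
    · exact h.vList v
  vMark_comm := by
    rintro (v | v)
    · rfl
    · exact h.vMark v
  eList_comm := by
    rintro (v | v)
    · rfl
    · exact h.eList v
  eMark_comm := by
    rintro (v | v)
    · rfl
    · exact h.eMark v
  root_comm := by
    rintro (v | v)
    · rfl
    · exact h.root v

/-- In a glued graph an edge of the context meets the glued part only through the interface, which
is the dangling condition. -/
theorem Attached.of_equiv {A B V F V' F' : Type} {k : K → A} {t : F → V} {u : B → A}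
    (i : V' ⊕ A ≃ V) (j : F' ⊕ B ≃ F) (s : F' → V' ⊕ K)
    (h : ∀ e, t (j e) = i (Sum.elim (fun e => (s e).map id k) (fun e => .inr (u e)) e)) :
    Attached (fun x => i (.inr x)) (fun e => j (.inr e)) k t u where
  comm e := h (.inr e)
  dangling e he x hx := by
    obtain ⟨e | e, rfl⟩ := j.surjective e
    · rw [h, i.apply_eq_iff_eq] at hx
      rcases hs : s e with v | l
      · simp [hs] at hx
      · simp only [Sum.elim_inl, hs, Sum.map_inr, Sum.inr.injEq] at hx
        exact ⟨l, hx⟩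
    · exact absurd ⟨e, rfl⟩ he

/-- A presentation of a graph by gluing yields a match. -/
theorem HostGraph.Iso.isMatch {C : Ctx K} {G : HostGraph} (i : (C.glue M k).Iso G) :
    IsMatch M k G (fun x => i.onV (.inr x)) (fun e => i.onE (.inr e)) where
  occ :=
    { injV := i.onV.injective.comp Sum.inr_injective
      injE := i.onE.injective.comp Sum.inr_injective
      src := .of_equiv i.onV i.onE C.src i.src_comm
      tgt := .of_equiv i.onV i.onE C.tgt i.tgt_comm }
  vList x := i.vList_comm (.inr x)
  vMark x := i.vMark_comm (.inr x)
  root x := i.root_comm (.inr x)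
  eList x := i.eList_comm (.inr x)
  eMark x := i.eMark_comm (.inr x)

/-- The part of a sum outside the second summand. -/
noncomputable def equivCompl {A V V' : Type} (i : V' ⊕ A ≃ V) :
    V' ≃ {v // v ∉ Set.range fun x => i (.inr x)} :=
  Equiv.ofBijective (fun c => ⟨i (.inl c), by rintro ⟨x, hx⟩; simpa using i.injective hx⟩) <| by
    constructor
    · intro c d h
      simpa using congrArg Subtype.val h
    · rintro ⟨v, hv⟩
      obtain ⟨c | x, rfl⟩ := i.surjective v
      · exact ⟨c, rfl⟩
      · exact absurd ⟨x, rfl⟩ hv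

/-- Both sides record where the edge ends in the glued graph, and the characterizations of
`restrict` show that this determines the end point in the context. -/
theorem Attached.restrict_of_equiv {A B V F V' F' : Type} {k : K → A} {t : F → V} {u : B → A}
    (i : V' ⊕ A ≃ V) (j : F' ⊕ B ≃ F) (s : F' → V' ⊕ K)
    (h : ∀ e, t (j e) = i (Sum.elim (fun e => (s e).map id k) (fun e => .inr (u e)) e))
    (hk : Function.Injective k)
    (h' : Attached (fun x => i (.inr x)) (fun e => j (.inr e)) k t u) (e : F') :
    h'.restrict (equivCompl j e) = (s e).map (equivCompl i) id := by
  have he := h (.inl e)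
  rcases hs : s e with v | l
  · rw [Sum.map_inl, h'.restrict_eq_inl]
    have : t (j (.inl e)) = i (.inl v) := by simpa [hs] using he
    exact this
  · rw [Sum.map_inr, id, h'.restrict_eq_inr (i.injective.comp Sum.inr_injective) hk]
    have : t (j (.inl e)) = i (.inr (k l)) := by simpa [hs] using he
    exact this

/-- The context in a presentation is unique. -/
noncomputable def HostGraph.Iso.glueCongr {C : Ctx K} {G : HostGraph} (i : (C.glue M k).Iso G)
    (hk : Function.Injective k)
    (o : IsOcc M k G (fun x => i.onV (.inr x)) (fun e => i.onE (.inr e))) :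
    (C.glue S kS).Iso (o.ctx.glue S kS) where
  onV := (equivCompl i.onV).sumCongr (.refl _)
  onE := (equivCompl i.onE).sumCongr (.refl _)
  src_comm := by
    rintro (e | e)
    · refine (congrArg (Sum.map id kS)
        (o.src.restrict_of_equiv i.onV i.onE C.src i.src_comm hk e)).trans ?_
      change _ = Sum.map (equivCompl i.onV) id (Sum.map id kS (C.src e))
      rcases C.src e with v | l <;> rfl
    · rfl
  tgt_comm := by
    rintro (e | e)
    · refine (congrArg (Sum.map id kS)
        (o.tgt.restrict_of_equiv i.onV i.onE C.tgt i.tgt_comm hk e)).trans ?_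
      change _ = Sum.map (equivCompl i.onV) id (Sum.map id kS (C.tgt e))
      rcases C.tgt e with v | l <;> rfl
    · rfl
  vList_comm := by
    rintro (v | v)
    · exact i.vList_comm (.inl v)
    · rfl
  vMark_comm := by
    rintro (v | v)
    · exact i.vMark_comm (.inl v)
    · rfl
  eList_comm := by
    rintro (v | v)
    · exact i.eList_comm (.inl v)
    · rfl
  eMark_comm := by
    rintro (v | v)
    · exact i.eMark_comm (.inl v)
    · rfl
  root_comm := by
    rintro (v | v)
    · exact i.root_comm (.inl v)
    · rfl

end GP2

namespace GP2

/-! ### Natural pushouts -/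

namespace PGraph

variable {A B D T U : PGraph}

theorem hom_congrV {f g : T ⟶ U} (h : f = g) (v : T.V) : Hom.onV f v = Hom.onV g v := by rw [h]

theorem hom_congrE {f g : T ⟶ U} (h : f = g) (e : T.E) : Hom.onE f e = Hom.onE g e := by rw [h]

/-- Concrete description of the natural pushouts along discrete unlabelled interfaces. -/
structure IsGluing (f : A ⟶ B) (k : A ⟶ D) (m : B ⟶ T) (d : D ⟶ T) : Prop where
  comm : ∀ a, Hom.onV m (Hom.onV f a) = Hom.onV d (Hom.onV k a)
  injV_left : Function.Injective (Hom.onV m)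
  injE_left : Function.Injective (Hom.onE m)
  injV_right : Function.Injective (Hom.onV d)
  injE_right : Function.Injective (Hom.onE d)
  surjV : ∀ v, (∃ b, Hom.onV m b = v) ∨ ∃ x, Hom.onV d x = v
  surjE : ∀ e, (∃ b, Hom.onE m b = e) ∨ ∃ x, Hom.onE d x = e
  interV : ∀ b x, Hom.onV m b = Hom.onV d x → ∃ a, Hom.onV f a = b ∧ Hom.onV k a = x
  interE : ∀ e e', Hom.onE m e ≠ Hom.onE d e'
  label_none : ∀ a, D.vLabel (Hom.onV k a) = none
  label_some : ∀ x, x ∉ Set.range (Hom.onV k) → D.vLabel x ≠ none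
  root_none : ∀ a, D.root (Hom.onV k a) = none
  root_some : ∀ x, x ∉ Set.range (Hom.onV k) → D.root x ≠ none

-- Natural pushouts are gluings

section Necessity

variable {f : A ⟶ B} {k : A ⟶ D} {m : B ⟶ T} {d : D ⟶ T}

open Classical in
/-- The node map into the set-theoretic pushout. -/
noncomputable def sumMap (f : A ⟶ B) (k : A ⟶ D) (x : D.V) :
    B.V ⊕ {x : D.V // x ∉ Set.range (Hom.onV k)} :=
  if h : x ∈ Set.range (Hom.onV k) then .inl (Hom.onV f h.choose) else .inr ⟨x, h⟩

theorem sumMap_of_mem (hk : Function.Injective (Hom.onV k)) (a : A.V) :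
    sumMap f k (Hom.onV k a) = .inl (Hom.onV f a) := by
  have h : Hom.onV k a ∈ Set.range (Hom.onV k) := ⟨a, rfl⟩
  unfold sumMap
  rw [dif_pos h, hk h.choose_spec]

theorem sumMap_of_notMem {x : D.V} (h : x ∉ Set.range (Hom.onV k)) :
    sumMap f k x = .inr ⟨x, h⟩ := dif_neg h

theorem sumElim_sumMap (hc : ∀ a, Hom.onV m (Hom.onV f a) = Hom.onV d (Hom.onV k a))
    (hk : Function.Injective (Hom.onV k)) (x : D.V) :
    Sum.elim (Hom.onV m) (fun y => Hom.onV d y.1) (sumMap f k x) = Hom.onV d x := by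
  by_cases h : x ∈ Set.range (Hom.onV k)
  · obtain ⟨a, rfl⟩ := h
    rw [sumMap_of_mem hk]
    exact hc a
  · rw [sumMap_of_notMem h]
    rfl

/-- The set-theoretic pushout, with the labels of `T`. -/
noncomputable def sumGraph (f : A ⟶ B) (k : A ⟶ D) (m : B ⟶ T) (d : D ⟶ T) : PGraph where
  V := B.V ⊕ {x : D.V // x ∉ Set.range (Hom.onV k)}
  E := B.E ⊕ D.E
  finV := by
    have := B.finV
    have := D.finV
    infer_instance
  finE := by
    have := B.finE
    have := D.finE
    infer_instance
  src := Sum.elim (fun e => .inl (B.src e)) (fun e => sumMap f k (D.src e))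
  tgt := Sum.elim (fun e => .inl (B.tgt e)) (fun e => sumMap f k (D.tgt e))
  vLabel v := T.vLabel (Sum.elim (Hom.onV m) (fun y => Hom.onV d y.1) v)
  eLabel := Sum.elim B.eLabel D.eLabel
  root v := T.root (Sum.elim (Hom.onV m) (fun y => Hom.onV d y.1) v)

/-- The universal property is tested against the set-theoretic pushout. Labels and roots there are
pulled back from `T`, so both components map into it. The mediating morphism separates in `T`
whatever is separated in the disjoint sum. -/
theorem exists_sum_desc (hA : IsEmpty A.E) (h : IsPushout f k m d)
    (hk : Function.Injective (Hom.onV k)) :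
    ∃ u : T ⟶ sumGraph f k m d,
      (∀ b, Hom.onV u (Hom.onV m b) = .inl b) ∧
      (∀ x, Hom.onV u (Hom.onV d x) = sumMap f k x) ∧
      (∀ b, Hom.onE u (Hom.onE m b) = .inl b) ∧ (∀ x, Hom.onE u (Hom.onE d x) = .inr x) := by
  have hc : ∀ a, Hom.onV m (Hom.onV f a) = Hom.onV d (Hom.onV k a) := hom_congrV h.w
  let i : B ⟶ sumGraph f k m d := Hom.mk (G := B) (H := sumGraph f k m d) Sum.inl Sum.inl
    (fun _ => rfl) (fun _ => rfl) (fun v l hl => Hom.vLabel_comm m v l hl) (fun _ => rfl)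
    (fun v l hl => Hom.root_comm m v l hl)
  let j : D ⟶ sumGraph f k m d := Hom.mk (G := D) (H := sumGraph f k m d) (sumMap f k) Sum.inr
    (fun _ => rfl) (fun _ => rfl)
    (fun v l hl => by
      change T.vLabel _ = _
      rw [sumElim_sumMap hc hk]
      exact Hom.vLabel_comm d v l hl) (fun _ => rfl)
    (fun v l hl => by
      change T.root _ = _
      rw [sumElim_sumMap hc hk]
      exact Hom.root_comm d v l hl)
  have w : f ≫ i = k ≫ j := by
    refine Hom.ext (funext fun a => ?_) (funext fun e => hA.elim e)
    exact (sumMap_of_mem hk a).symm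
  exact ⟨h.desc i j w, hom_congrV (h.inl_desc i j w), hom_congrV (h.inr_desc i j w),
    hom_congrE (h.inl_desc i j w), hom_congrE (h.inr_desc i j w)⟩

/-- The subgraph of `T` covered by `m` and `d`. -/
def imageGraph (m : B ⟶ T) (d : D ⟶ T) : PGraph where
  V := {v : T.V // (∃ b, Hom.onV m b = v) ∨ ∃ x, Hom.onV d x = v}
  E := {e : T.E // (∃ b, Hom.onE m b = e) ∨ ∃ x, Hom.onE d x = e}
  finV := by
    have := T.finV
    infer_instance
  finE := by
    have := T.finE
    infer_instance
  src e := ⟨T.src e.1, by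
    obtain ⟨_, ⟨b, rfl⟩ | ⟨x, rfl⟩⟩ := e
    · exact .inl ⟨_, (Hom.src_comm m b).symm⟩
    · exact .inr ⟨_, (Hom.src_comm d x).symm⟩⟩
  tgt e := ⟨T.tgt e.1, by
    obtain ⟨_, ⟨b, rfl⟩ | ⟨x, rfl⟩⟩ := e
    · exact .inl ⟨_, (Hom.tgt_comm m b).symm⟩
    · exact .inr ⟨_, (Hom.tgt_comm d x).symm⟩⟩
  vLabel v := T.vLabel v.1
  eLabel e := T.eLabel e.1
  root v := T.root v.1

/-- Both components factor through the subgraph that they cover. By uniqueness the mediating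
morphism followed by the inclusion is the identity of `T`, so that subgraph is everything. -/
theorem isPushout_surj (h : IsPushout f k m d) :
    (∀ v, (∃ b, Hom.onV m b = v) ∨ ∃ x, Hom.onV d x = v) ∧
    (∀ e, (∃ b, Hom.onE m b = e) ∨ ∃ x, Hom.onE d x = e) := by
  let i : B ⟶ imageGraph m d := Hom.mk (G := B) (H := imageGraph m d)
    (fun b => ⟨Hom.onV m b, .inl ⟨b, rfl⟩⟩) (fun b => ⟨Hom.onE m b, .inl ⟨b, rfl⟩⟩)
    (fun e => Subtype.ext (Hom.src_comm m e)) (fun e => Subtype.ext (Hom.tgt_comm m e))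
    (Hom.vLabel_comm m) (Hom.eLabel_comm m) (Hom.root_comm m)
  let j : D ⟶ imageGraph m d := Hom.mk (G := D) (H := imageGraph m d)
    (fun b => ⟨Hom.onV d b, .inr ⟨b, rfl⟩⟩) (fun b => ⟨Hom.onE d b, .inr ⟨b, rfl⟩⟩)
    (fun e => Subtype.ext (Hom.src_comm d e)) (fun e => Subtype.ext (Hom.tgt_comm d e))
    (Hom.vLabel_comm d) (Hom.eLabel_comm d) (Hom.root_comm d)
  let s : imageGraph m d ⟶ T := Hom.mk (G := imageGraph m d) (H := T) Subtype.val Subtype.val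
    (fun _ => rfl) (fun _ => rfl) (fun _ _ h => h) (fun _ => rfl) (fun _ _ h => h)
  have w : f ≫ i = k ≫ j :=
    Hom.ext (funext fun a => Subtype.ext (hom_congrV h.w a))
      (funext fun a => Subtype.ext (hom_congrE h.w a))
  have hs : h.desc i j w ≫ s = 𝟙 T := by
    apply h.hom_ext
    · rw [← Category.assoc, h.inl_desc, Category.comp_id]
      rfl
    · rw [← Category.assoc, h.inr_desc, Category.comp_id]
      rfl
  constructor
  · intro v
    have : (Hom.onV (h.desc i j w) v).1 = v := hom_congrV hs v
    exact this ▸ (Hom.onV (h.desc i j w) v).2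
  · intro v
    have : (Hom.onE (h.desc i j w) v).1 = v := hom_congrE hs v
    exact this ▸ (Hom.onE (h.desc i j w) v).2

/-- In a pushout, no labels or roots are defined that do not come from the components. -/
theorem isPushout_label (h : IsPushout f k m d) (lab : T.V → Option (HList × VMark))
    (rt : T.V → Option Bool) (hlab : ∀ v, ∀ l ∈ lab v, T.vLabel v = some l)
    (hrt : ∀ v, ∀ l ∈ rt v, T.root v = some l)
    (hBl : ∀ b, ∀ l ∈ B.vLabel b, lab (Hom.onV m b) = some l)
    (hDl : ∀ b, ∀ l ∈ D.vLabel b, lab (Hom.onV d b) = some l)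
    (hBr : ∀ b, ∀ l ∈ B.root b, rt (Hom.onV m b) = some l)
    (hDr : ∀ b, ∀ l ∈ D.root b, rt (Hom.onV d b) = some l) (v : T.V) :
    (∀ l ∈ T.vLabel v, lab v = some l) ∧ (∀ l ∈ T.root v, rt v = some l) := by
  let T' : PGraph := { T with vLabel := lab, root := rt }
  let i : B ⟶ T' := Hom.mk (G := B) (H := T') (Hom.onV (H := T) m)
    (Hom.onE (H := T) m) (Hom.src_comm m)
    (Hom.tgt_comm m) hBl (Hom.eLabel_comm m) hBr
  let j : D ⟶ T' := Hom.mk (G := D) (H := T') (Hom.onV (H := T) d)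
    (Hom.onE (H := T) d) (Hom.src_comm d)
    (Hom.tgt_comm d) hDl (Hom.eLabel_comm d) hDr
  let s : T' ⟶ T := Hom.mk (G := T') (H := T) id id (fun _ => rfl) (fun _ => rfl) hlab
    (fun _ => rfl) hrt
  have w : f ≫ i = k ≫ j :=
    Hom.ext (funext fun a => (hom_congrV h.w a :)) (funext fun e => (hom_congrE h.w e :))
  -- The mediating morphism into the less labelled graph `T'` is therefore the identity on nodes;
  -- since it preserves labels, `T'` has all the labels of `T`.
  have hs : h.desc i j w ≫ s = 𝟙 T := by
    apply h.hom_ext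
    · rw [← Category.assoc, h.inl_desc, Category.comp_id]
      rfl
    · rw [← Category.assoc, h.inr_desc, Category.comp_id]
      rfl
  have hv : Hom.onV (h.desc i j w) v = v := hom_congrV hs v
  constructor
  · intro l hl
    have := Hom.vLabel_comm (h.desc i j w) v l hl
    rwa [hv] at this
  · intro l hl
    have := Hom.root_comm (h.desc i j w) v l hl
    rwa [hv] at this

/-- A graph with a single node. -/
def point (l : Option (HList × VMark)) (b : Option Bool) : PGraph where
  V := Unit
  E := Empty
  finV := inferInstance
  finE := inferInstance
  src := Empty.elim
  tgt := Empty.elim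
  vLabel _ := l
  eLabel := Empty.elim
  root _ := b

def pointHom (l : Option (HList × VMark)) (b : Option Bool) (v : T.V)
    (hl : ∀ l' ∈ l, T.vLabel v = some l') (hb : ∀ b' ∈ b, T.root v = some b') : point l b ⟶ T :=
  Hom.mk (G := point l b) (H := T) (fun _ => v) Empty.elim (fun e => e.elim) (fun e => e.elim)
    (fun _ => hl) (fun e => e.elim) (fun _ => hb)

/-- If `D` had a label at an interface node, it would agree with the label in `B`, since both are
preserved into `T`. A one-node graph with this label would then map compatibly to `B` and `D`, and
hence lift to `A`, where no node is labelled. Roots are treated in the same way. -/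
theorem isPullback_none (hAl : ∀ a, A.vLabel a = none) (hAr : ∀ a, A.root a = none)
    (hBl : ∀ b, B.vLabel b ≠ none) (hBr : ∀ b, B.root b ≠ none) (h : IsPullback f k m d) (a : A.V) :
    D.vLabel (Hom.onV k a) = none ∧ D.root (Hom.onV k a) = none := by
  have hc : ∀ a, Hom.onV m (Hom.onV f a) = Hom.onV d (Hom.onV k a) := hom_congrV h.w
  constructor
  · by_contra hne
    obtain ⟨l, hl⟩ := Option.ne_none_iff_exists'.1 hne
    obtain ⟨l', hl'⟩ := Option.ne_none_iff_exists'.1 (hBl (Hom.onV f a))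
    have h₁ := Hom.vLabel_comm m _ _ hl'
    have h₂ := Hom.vLabel_comm d _ _ hl
    rw [hc, h₂] at h₁
    cases h₁
    let i : point (some l) none ⟶ B := pointHom _ _ (Hom.onV f a) (by simpa using hl') (by simp)
    let j : point (some l) none ⟶ D := pointHom _ _ (Hom.onV k a) (by simpa using hl) (by simp)
    have w : i ≫ m = j ≫ d := Hom.ext (funext fun _ => hc a) (funext fun e => e.elim)
    have := Hom.vLabel_comm (h.lift i j w) () l rfl
    rw [hAl] at this
    cases this
  · by_contra hne
    obtain ⟨l, hl⟩ := Option.ne_none_iff_exists'.1 hne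
    obtain ⟨l', hl'⟩ := Option.ne_none_iff_exists'.1 (hBr (Hom.onV f a))
    have h₁ := Hom.root_comm m _ _ hl'
    have h₂ := Hom.root_comm d _ _ hl
    rw [hc, h₂] at h₁
    cases h₁
    let i : point none (some l) ⟶ B := pointHom _ _ (Hom.onV f a) (by simp) (by simpa using hl')
    let j : point none (some l) ⟶ D := pointHom _ _ (Hom.onV k a) (by simp) (by simpa using hl)
    have w : i ≫ m = j ≫ d := Hom.ext (funext fun _ => hc a) (funext fun e => e.elim)
    have := Hom.root_comm (h.lift i j w) () l rfl
    rw [hAr] at this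
    cases this

/-- The pushout property yields the underlying gluing and makes labels and roots defined outside the
interface; the pullback property makes them undefined on the interface. -/
theorem isGluing_of_isNaturalPushout (hA : IsEmpty A.E) (hAl : ∀ a, A.vLabel a = none)
    (hAr : ∀ a, A.root a = none) (hBl : ∀ b, B.vLabel b ≠ none) (hBr : ∀ b, B.root b ≠ none)
    (hTl : ∀ b, T.vLabel b ≠ none) (hTr : ∀ b, T.root b ≠ none)
    (hf : Function.Injective (Hom.onV f)) (hk : Function.Injective (Hom.onV k))
    (h : IsNaturalPushout f k m d) : IsGluing f k m d := by
  classical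
  obtain ⟨h, h'⟩ := h
  obtain ⟨u, hu₁, hu₂, hu₃, hu₄⟩ := exists_sum_desc hA h hk
  have interV : ∀ b x, Hom.onV m b = Hom.onV d x → ∃ a, Hom.onV f a = b ∧ Hom.onV k a = x := by
    intro b x hbx
    have := (hu₁ b).symm.trans ((congrArg (Hom.onV u) hbx).trans (hu₂ x))
    by_cases hx : x ∈ Set.range (Hom.onV k)
    · obtain ⟨a, rfl⟩ := hx
      rw [sumMap_of_mem hk] at this
      exact ⟨a, (Sum.inl_injective this).symm, rfl⟩
    · rw [sumMap_of_notMem hx] at this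
      cases this
  have injV : Function.Injective (Hom.onV d) := by
    intro x y hxy
    have := (hu₂ x).symm.trans ((congrArg (Hom.onV u) hxy).trans (hu₂ y))
    by_cases hx : x ∈ Set.range (Hom.onV k) <;> by_cases hy : y ∈ Set.range (Hom.onV k)
    · obtain ⟨a, rfl⟩ := hx
      obtain ⟨b, rfl⟩ := hy
      rw [sumMap_of_mem hk, sumMap_of_mem hk] at this
      rw [hf (Sum.inl_injective this)]
    · obtain ⟨a, rfl⟩ := hx
      rw [sumMap_of_mem hk, sumMap_of_notMem hy] at this
      cases this
    · obtain ⟨a, rfl⟩ := hy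
      rw [sumMap_of_mem hk, sumMap_of_notMem hx] at this
      cases this
    · rw [sumMap_of_notMem hy, sumMap_of_notMem hx] at this
      exact congrArg Subtype.val (Sum.inr_injective this)
  refine
    { comm := hom_congrV h.w
      injV_left := fun x y hxy => Sum.inl_injective
        ((hu₁ x).symm.trans ((congrArg (Hom.onV u) hxy).trans (hu₁ y)))
      injE_left := fun x y hxy => Sum.inl_injective
        ((hu₃ x).symm.trans ((congrArg (Hom.onE u) hxy).trans (hu₃ y)))
      injV_right := injV
      injE_right := fun x y hxy => Sum.inr_injective
        ((hu₄ x).symm.trans ((congrArg (Hom.onE u) hxy).trans (hu₄ y)))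
      surjV := (isPushout_surj h).1
      surjE := (isPushout_surj h).2
      interV := interV
      interE := fun x y hxy => by
        cases (hu₃ x).symm.trans ((congrArg (Hom.onE u) hxy).trans (hu₄ y))
      label_none := fun a => (isPullback_none hAl hAr hBl hBr h' a).1
      root_none := fun a => (isPullback_none hAl hAr hBl hBr h' a).2
      label_some := fun x hx hxl => ?_
      root_some := fun x hx hxl => ?_ }
  · obtain ⟨l, hl⟩ := Option.ne_none_iff_exists'.1 (hTl (Hom.onV d x))
    -- If `D` had no label at `x`, then the label of `T` at the image of `x` would come from neither
    -- component, and erasing it would still give a cocone.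
    have := (isPushout_label h (fun v => if v = Hom.onV d x then none else T.vLabel v) T.root
      (fun v l hl => by
        split_ifs at hl
        · cases hl
        · exact hl) (fun v l hl => hl)
      (fun b l hl => by
        rw [if_neg]
        · exact Hom.vLabel_comm m b l hl
        · intro hb
          obtain ⟨a, -, ha⟩ := interV b x hb
          exact hx ⟨a, ha⟩)
      (fun y l hl => by
        rw [if_neg]
        · exact Hom.vLabel_comm d y l hl
        · intro hy
          rw [injV hy, hxl] at hl
          cases hl)
      (Hom.root_comm m) (Hom.root_comm d) (Hom.onV d x)).1 l hl
    simp at this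
  · obtain ⟨l, hl⟩ := Option.ne_none_iff_exists'.1 (hTr (Hom.onV d x))
    have := (isPushout_label h T.vLabel (fun v => if v = Hom.onV d x then none else T.root v)
      (fun v l hl => hl)
      (fun v l hl => by
        split_ifs at hl
        · cases hl
        · exact hl)
      (Hom.vLabel_comm m) (Hom.vLabel_comm d)
      (fun b l hl => by
        rw [if_neg]
        · exact Hom.root_comm m b l hl
        · intro hb
          obtain ⟨a, -, ha⟩ := interV b x hb
          exact hx ⟨a, ha⟩)
      (fun y l hl => by
        rw [if_neg]
        · exact Hom.root_comm d y l hl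
        · intro hy
          rw [injV hy, hxl] at hl
          cases hl) (Hom.onV d x)).2 l hl
    simp at this

end Necessity

-- Gluings are natural pushouts

section Sufficiency

variable {f : A ⟶ B} {k : A ⟶ D} {m : B ⟶ T} {d : D ⟶ T}

/-- Joint factorization through a jointly surjective pair of maps. -/
theorem exists_joint_lift {α β γ δ : Type} {m : α → γ} {d : β → γ} (s : α → δ) (t : β → δ)
    (hm : Function.Injective m) (hd : Function.Injective d)
    (hsurj : ∀ c, (∃ a, m a = c) ∨ ∃ b, d b = c) (hst : ∀ a b, m a = d b → s a = t b) :
    ∃ u : γ → δ, (∀ a, u (m a) = s a) ∧ ∀ b, u (d b) = t b := by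
  have : ∀ c, ∃ e, (∀ a, m a = c → s a = e) ∧ ∀ b, d b = c → t b = e := by
    intro c
    rcases hsurj c with ⟨a, rfl⟩ | ⟨b, rfl⟩
    · exact ⟨s a, fun a' h => by rw [hm h], fun b h => (hst a b h.symm).symm⟩
    · exact ⟨t b, fun a h => hst a b h, fun b' h => by rw [hd h]⟩
  choose u hu using this
  exact ⟨u, fun a => ((hu _).1 a rfl).symm, fun b => ((hu _).2 b rfl).symm⟩

/-- On nodes and edges the components prescribe the map, consistently by `interV` and `interE`.
Labels and roots are preserved because at each node of `T` they come from `B`, or from `D` off the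
interface, where they are defined. -/
theorem IsGluing.exists_desc (h : IsGluing f k m d) (hBl : ∀ b, B.vLabel b ≠ none)
    (hBr : ∀ b, B.root b ≠ none) (s : B ⟶ U) (t : D ⟶ U) (w : f ≫ s = k ≫ t) :
    ∃ u : T ⟶ U, m ≫ u = s ∧ d ≫ u = t := by
  obtain ⟨u, hu₁, hu₂⟩ := exists_joint_lift (Hom.onV s) (Hom.onV t) h.injV_left h.injV_right
    h.surjV (fun b x hbx => by
      obtain ⟨a, rfl, rfl⟩ := h.interV b x hbx
      exact hom_congrV w a)
  obtain ⟨v, hv₁, hv₂⟩ := exists_joint_lift (Hom.onE s) (Hom.onE t) h.injE_left h.injE_right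
    h.surjE (fun b x hbx => (h.interE b x hbx).elim)
  refine ⟨Hom.mk (G := T) (H := U) u v ?_ ?_ ?_ ?_ ?_,
    Hom.ext (funext hu₁) (funext hv₁), Hom.ext (funext hu₂) (funext hv₂)⟩
  · intro e
    rcases h.surjE e with ⟨e, rfl⟩ | ⟨e, rfl⟩
    · rw [hv₁, Hom.src_comm, Hom.src_comm, hu₁]
    · rw [hv₂, Hom.src_comm, Hom.src_comm, hu₂]
  · intro e
    rcases h.surjE e with ⟨e, rfl⟩ | ⟨e, rfl⟩
    · rw [hv₁, Hom.tgt_comm, Hom.tgt_comm, hu₁]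
    · rw [hv₂, Hom.tgt_comm, Hom.tgt_comm, hu₂]
  · intro c l hl
    by_cases hc : ∃ b, Hom.onV m b = c
    · obtain ⟨b, rfl⟩ := hc
      obtain ⟨l', hl'⟩ := Option.ne_none_iff_exists'.1 (hBl b)
      have := Hom.vLabel_comm m b l' hl'
      obtain rfl : l' = l := Option.some_injective _ (this.symm.trans hl)
      rw [hu₁]
      exact Hom.vLabel_comm s b l' hl'
    · obtain ⟨x, rfl⟩ := (h.surjV c).resolve_left hc
      have hx : x ∉ Set.range (Hom.onV k) := by
        rintro ⟨a, rfl⟩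
        exact hc ⟨_, h.comm a⟩
      obtain ⟨l', hl'⟩ := Option.ne_none_iff_exists'.1 (h.label_some x hx)
      have := Hom.vLabel_comm d x l' hl'
      obtain rfl : l' = l := Option.some_injective _ (this.symm.trans hl)
      rw [hu₂]
      exact Hom.vLabel_comm t x l' hl'
  · intro e
    rcases h.surjE e with ⟨e, rfl⟩ | ⟨e, rfl⟩
    · rw [hv₁, Hom.eLabel_comm, Hom.eLabel_comm]
    · rw [hv₂, Hom.eLabel_comm, Hom.eLabel_comm]
  · intro c l hl
    by_cases hc : ∃ b, Hom.onV m b = c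
    · obtain ⟨b, rfl⟩ := hc
      obtain ⟨l', hl'⟩ := Option.ne_none_iff_exists'.1 (hBr b)
      have := Hom.root_comm m b l' hl'
      obtain rfl : l' = l := Option.some_injective _ (this.symm.trans hl)
      rw [hu₁]
      exact Hom.root_comm s b l' hl'
    · obtain ⟨x, rfl⟩ := (h.surjV c).resolve_left hc
      have hx : x ∉ Set.range (Hom.onV k) := by
        rintro ⟨a, rfl⟩
        exact hc ⟨_, h.comm a⟩
      obtain ⟨l', hl'⟩ := Option.ne_none_iff_exists'.1 (h.root_some x hx)
      have := Hom.root_comm d x l' hl'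
      obtain rfl : l' = l := Option.some_injective _ (this.symm.trans hl)
      rw [hu₂]
      exact Hom.root_comm t x l' hl'

/-- A graph that maps compatibly to `B` and `D` has no edges, because the edge images are disjoint,
and no labels or roots, because its nodes go to the interface, where `D` has none. So the node map
alone is a morphism to `A`. -/
theorem IsGluing.exists_lift (h : IsGluing f k m d) (s : U ⟶ B) (t : U ⟶ D) (w : s ≫ m = t ≫ d) :
    ∃ u : U ⟶ A, u ≫ f = s ∧ u ≫ k = t := by
  have hE : IsEmpty U.E := ⟨fun e => h.interE _ _ (hom_congrE w e)⟩
  choose u hu₁ hu₂ using fun x => h.interV _ _ (hom_congrV w x)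
  have hl : ∀ x, U.vLabel x = none := by
    intro x
    by_contra hne
    obtain ⟨l, hl⟩ := Option.ne_none_iff_exists'.1 hne
    have := Hom.vLabel_comm t x l hl
    have h' : D.vLabel (Hom.onV t x) = none := hu₂ x ▸ h.label_none (u x)
    rw [h'] at this
    cases this
  have hr : ∀ x, U.root x = none := by
    intro x
    by_contra hne
    obtain ⟨l, hl⟩ := Option.ne_none_iff_exists'.1 hne
    have := Hom.root_comm t x l hl
    have h' : D.root (Hom.onV t x) = none := hu₂ x ▸ h.root_none (u x)
    rw [h'] at this
    cases this
  refine ⟨Hom.mk (G := U) (H := A) u hE.elim hE.elim hE.elim ?_ hE.elim ?_,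
    Hom.ext (funext hu₁) (funext hE.elim), Hom.ext (funext hu₂) (funext hE.elim)⟩
  · intro x l hx
    rw [hl] at hx
    cases hx
  · intro x l hx
    rw [hr] at hx
    cases hx

theorem IsGluing.hom_ext (h : IsGluing f k m d) {u u' : T ⟶ U} (h₁ : m ≫ u = m ≫ u')
    (h₂ : d ≫ u = d ≫ u') : u = u' := by
  refine Hom.ext (funext fun c => ?_) (funext fun c => ?_)
  · rcases h.surjV c with ⟨e, rfl⟩ | ⟨e, rfl⟩
    · exact hom_congrV h₁ e
    · exact hom_congrV h₂ e
  · rcases h.surjE c with ⟨e, rfl⟩ | ⟨e, rfl⟩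
    · exact hom_congrE h₁ e
    · exact hom_congrE h₂ e

theorem IsGluing.isNaturalPushout (hA : IsEmpty A.E) (h : IsGluing f k m d)
    (hBl : ∀ b, B.vLabel b ≠ none) (hBr : ∀ b, B.root b ≠ none)
    (hf : Function.Injective (Hom.onV f)) : IsNaturalPushout f k m d := by
  have w : f ≫ m = k ≫ d := Hom.ext (funext h.comm) (funext hA.elim)
  constructor
  · refine ⟨⟨w⟩, ⟨Limits.PushoutCocone.IsColimit.mk w
      (fun c => (h.exists_desc hBl hBr c.inl c.inr c.condition).choose)
      (fun c => (h.exists_desc hBl hBr c.inl c.inr c.condition).choose_spec.1)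
      (fun c => (h.exists_desc hBl hBr c.inl c.inr c.condition).choose_spec.2) ?_⟩⟩
    intro c u h₁ h₂
    have := (h.exists_desc hBl hBr c.inl c.inr c.condition).choose_spec
    exact h.hom_ext (h₁.trans this.1.symm) (h₂.trans this.2.symm)
  · refine ⟨⟨w⟩, ⟨Limits.PullbackCone.IsLimit.mk w
      (fun c => (h.exists_lift c.fst c.snd c.condition).choose)
      (fun c => (h.exists_lift c.fst c.snd c.condition).choose_spec.1)
      (fun c => (h.exists_lift c.fst c.snd c.condition).choose_spec.2) ?_⟩⟩
    intro c u h₁ h₂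
    have := (h.exists_lift c.fst c.snd c.condition).choose_spec
    -- Uniqueness of the lift follows on nodes from injectivity of `f`; there are no edges to
    -- compare.
    refine Hom.ext (funext fun x => hf ?_) (funext fun e => hA.elim (Hom.onE u e))
    exact hom_congrV (h₁.trans this.1.symm) x

end Sufficiency

end PGraph

end GP2

-- Passing between gluings and fillings of contexts

namespace GP2

namespace PGraph

/-- The position of a node in the decomposition along an interface `κ`. -/
noncomputable def endpoint {V K : Type} (κ : K → V) (v : V) : {x // x ∉ Set.range κ} ⊕ K :=
  open Classical in if h : v ∈ Set.range κ then .inr h.choose else .inl ⟨v, h⟩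

theorem sumElim_endpoint {V K W : Type} (κ : K → V) (s : V → W) (v : V) :
    Sum.elim (fun x => s x.1) (fun j => s (κ j)) (endpoint κ v) = s v := by
  unfold endpoint
  split_ifs with h
  · exact congrArg s h.choose_spec
  · rfl

/-- The context given by a graph whose labels are undefined on the interface. -/
noncomputable def toCtx (D : PGraph) {K : Type} (κ : K → D.V) : Ctx K where
  V := {x // x ∉ Set.range κ}
  E := D.E
  finV := by
    have := D.finV
    infer_instance
  finE := D.finE
  src e := endpoint κ (D.src e)
  tgt e := endpoint κ (D.tgt e)
  vList x := ((D.vLabel x.1).getD ([], .none)).1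
  vMark x := ((D.vLabel x.1).getD ([], .none)).2
  eList e := (D.eLabel e).1
  eMark e := (D.eLabel e).2
  root x := (D.root x.1).getD false

variable {A D : PGraph} {B G : HostGraph}

theorem IsGluing.bijV {f : A ⟶ B.toPGraph} {k : A ⟶ D} {m : B.toPGraph ⟶ G.toPGraph}
    {d : D ⟶ G.toPGraph} (h : IsGluing f k m d) :
    Function.Bijective (Sum.elim (fun x => Hom.onV d x.1) (Hom.onV m) :
      {x // x ∉ Set.range (Hom.onV k)} ⊕ B.V → G.V) := by
  constructor
  · rintro (⟨x, hx⟩ | b) (⟨y, hy⟩ | c) hxy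
    · exact congrArg Sum.inl (Subtype.ext (h.injV_right hxy))
    · obtain ⟨a, -, ha⟩ := h.interV c x hxy.symm
      exact absurd ⟨a, ha⟩ hx
    · obtain ⟨a, -, ha⟩ := h.interV b y hxy
      exact absurd ⟨a, ha⟩ hy
    · exact congrArg Sum.inr (h.injV_left hxy)
  · intro v
    by_cases hv : ∃ b, Hom.onV m b = v
    · obtain ⟨b, hb⟩ := hv
      exact ⟨.inr b, hb⟩
    · obtain ⟨x, rfl⟩ := (h.surjV v).resolve_left hv
      refine ⟨.inl ⟨x, ?_⟩, rfl⟩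
      rintro ⟨a, rfl⟩
      exact hv ⟨_, h.comm a⟩

theorem IsGluing.bijE {f : A ⟶ B.toPGraph} {k : A ⟶ D} {m : B.toPGraph ⟶ G.toPGraph}
    {d : D ⟶ G.toPGraph} (h : IsGluing f k m d) :
    Function.Bijective (Sum.elim (Hom.onE d) (Hom.onE m) : D.E ⊕ B.E → G.E) := by
  constructor
  · rintro (x | b) (y | c) hxy
    · exact congrArg Sum.inl (h.injE_right hxy)
    · exact absurd hxy.symm (h.interE c x)
    · exact absurd hxy (h.interE b y)
    · exact congrArg Sum.inr (h.injE_left hxy)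
  · intro v
    rcases h.surjE v with ⟨b, hb⟩ | ⟨x, hx⟩
    · exact ⟨.inr b, hb⟩
    · exact ⟨.inl x, hx⟩

theorem IsGluing.endpoint_comm {f : A ⟶ B.toPGraph} {k : A ⟶ D} {m : B.toPGraph ⟶ G.toPGraph}
    {d : D ⟶ G.toPGraph} (h : IsGluing f k m d) (x : D.V) :
    (Sum.elim (fun x => Hom.onV d x.1) (Hom.onV m) :
      {x // x ∉ Set.range (Hom.onV k)} ⊕ B.V → G.V)
      ((endpoint (Hom.onV k) x).map id (Hom.onV f)) = Hom.onV d x := by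
  refine Eq.trans ?_ (sumElim_endpoint (Hom.onV k) (Hom.onV d) x)
  rcases endpoint (Hom.onV k) x with y | a
  · rfl
  · exact h.comm a

/-- The nodes of `T` are those of `B` and the non-interface nodes of `D`. At the latter, labels and
roots are defined, so the default values in `toCtx` never occur. -/
noncomputable def IsGluing.iso {f : A ⟶ B.toPGraph} {k : A ⟶ D} {m : B.toPGraph ⟶ G.toPGraph}
    {d : D ⟶ G.toPGraph} (h : IsGluing f k m d) :
    ((D.toCtx (Hom.onV k)).glue B (Hom.onV f)).Iso G where
  onV := Equiv.ofBijective _ h.bijV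
  onE := Equiv.ofBijective _ h.bijE
  src_comm := by
    rintro (e | e)
    · exact (Hom.src_comm d e).trans (h.endpoint_comm _).symm
    · exact Hom.src_comm m e
  tgt_comm := by
    rintro (e | e)
    · exact (Hom.tgt_comm d e).trans (h.endpoint_comm _).symm
    · exact Hom.tgt_comm m e
  vList_comm := by
    rintro (⟨x, hx⟩ | b)
    · obtain ⟨l, hl⟩ := Option.ne_none_iff_exists'.1 (h.label_some x hx)
      have := congrArg Prod.fst (Option.some_injective _ (Hom.vLabel_comm d x l hl))
      refine this.trans ?_
      change l.1 = ((D.vLabel x).getD ([], .none)).1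
      rw [hl]
      rfl
    · exact congrArg Prod.fst (Option.some_injective _ (Hom.vLabel_comm m b _ rfl))
  vMark_comm := by
    rintro (⟨x, hx⟩ | b)
    · obtain ⟨l, hl⟩ := Option.ne_none_iff_exists'.1 (h.label_some x hx)
      have := congrArg Prod.snd (Option.some_injective _ (Hom.vLabel_comm d x l hl))
      refine this.trans ?_
      change l.2 = ((D.vLabel x).getD ([], .none)).2
      rw [hl]
      rfl
    · exact congrArg Prod.snd (Option.some_injective _ (Hom.vLabel_comm m b _ rfl))
  eList_comm := by
    rintro (e | e)
    · exact congrArg Prod.fst (Hom.eLabel_comm d e)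
    · exact congrArg Prod.fst (Hom.eLabel_comm m e)
  eMark_comm := by
    rintro (e | e)
    · exact congrArg Prod.snd (Hom.eLabel_comm d e)
    · exact congrArg Prod.snd (Hom.eLabel_comm m e)
  root_comm := by
    rintro (⟨x, hx⟩ | b)
    · obtain ⟨l, hl⟩ := Option.ne_none_iff_exists'.1 (h.root_some x hx)
      refine (Option.some_injective _ (Hom.root_comm d x l hl)).trans ?_
      change l = (D.root x).getD false
      rw [hl]
      rfl
    · exact Option.some_injective _ (Hom.root_comm m b _ rfl)

end PGraph

open PGraph

variable {A : PGraph} {B G : HostGraph}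

/-- The graph given by a context, with undefined labels on the interface. -/
def Ctx.toPGraph {K : Type} [Finite K] (C : Ctx K) : PGraph where
  V := C.V ⊕ K
  E := C.E
  finV := by
    have := C.finV
    infer_instance
  finE := C.finE
  src := C.src
  tgt := C.tgt
  vLabel := Sum.elim (fun v => some (C.vList v, C.vMark v)) (fun _ => none)
  eLabel e := (C.eList e, C.eMark e)
  root := Sum.elim (fun v => some (C.root v)) (fun _ => none)

def Ctx.interfaceHom [Finite A.V] (C : Ctx A.V) (hA : IsEmpty A.E)
    (hAl : ∀ a, A.vLabel a = none) (hAr : ∀ a, A.root a = none) : A ⟶ C.toPGraph :=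
  Hom.mk (G := A) (H := C.toPGraph) Sum.inr hA.elim hA.elim hA.elim
    (fun a l hl => by rw [hAl] at hl; cases hl) hA.elim (fun a l hl => by rw [hAr] at hl; cases hl)

def HostGraph.Iso.homRight {K : Type} {C : Ctx K} {κ : K → B.V} (i : (C.glue B κ).Iso G) :
    B.toPGraph ⟶ G.toPGraph :=
  Hom.mk (G := B.toPGraph) (H := G.toPGraph) (fun b => i.onV (.inr b)) (fun e => i.onE (.inr e))
    (fun e => i.src_comm (.inr e)) (fun e => i.tgt_comm (.inr e))
    (fun v l hl => by
      obtain rfl := Option.some_injective _ hl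
      exact congrArg some (Prod.ext (i.vList_comm (.inr v)) (i.vMark_comm (.inr v))))
    (fun e => Prod.ext (i.eList_comm (.inr e)) (i.eMark_comm (.inr e)))
    (fun v l hl => by
      obtain rfl := Option.some_injective _ hl
      exact congrArg some (i.root_comm (.inr v)))

def HostGraph.Iso.homCtx {K : Type} [Finite K] {C : Ctx K} {κ : K → B.V}
    (i : (C.glue B κ).Iso G) : C.toPGraph ⟶ G.toPGraph :=
  Hom.mk (G := C.toPGraph) (H := G.toPGraph) (fun x => i.onV (x.map id κ))
    (fun e => i.onE (.inl e))
    (fun e => i.src_comm (.inl e)) (fun e => i.tgt_comm (.inl e))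
    (fun v l hl => by
      rcases v with v | a
      · obtain rfl := Option.some_injective _ hl
        exact congrArg some (Prod.ext (i.vList_comm (.inl v)) (i.vMark_comm (.inl v)))
      · cases hl)
    (fun e => Prod.ext (i.eList_comm (.inl e)) (i.eMark_comm (.inl e)))
    (fun v l hl => by
      rcases v with v | a
      · obtain rfl := Option.some_injective _ hl
        exact congrArg some (i.root_comm (.inl v))
      · cases hl)

/-- Conversely, any presentation of a graph as a filled context is a gluing. The intermediate graph
consists of the context and the bare interface nodes, so labels and roots are undefined exactly on
the interface. -/
theorem HostGraph.Iso.isGluing [Finite A.V] {C : Ctx A.V} (hA : IsEmpty A.E)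
    (hAl : ∀ a, A.vLabel a = none) (hAr : ∀ a, A.root a = none) (f : A ⟶ B.toPGraph)
    (hf : Function.Injective (Hom.onV f)) (i : (C.glue B (Hom.onV f)).Iso G) :
    IsGluing f (C.interfaceHom hA hAl hAr) i.homRight i.homCtx where
  comm a := rfl
  injV_left := i.onV.injective.comp Sum.inr_injective
  injE_left := i.onE.injective.comp Sum.inr_injective
  injV_right := i.onV.injective.comp (Sum.map_injective.2 ⟨Function.injective_id, hf⟩)
  injE_right := i.onE.injective.comp Sum.inl_injective
  surjV v := by
    obtain ⟨x | b, rfl⟩ := i.onV.surjective v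
    · exact .inr ⟨.inl x, rfl⟩
    · exact .inl ⟨b, rfl⟩
  surjE v := by
    obtain ⟨x | b, rfl⟩ := i.onE.surjective v
    · exact .inr ⟨x, rfl⟩
    · exact .inl ⟨b, rfl⟩
  interV b x hbx := by
    have := i.onV.injective hbx
    rcases x with x | a
    · cases this
    · exact ⟨a, (Sum.inr_injective this).symm, rfl⟩
  interE e e' h := by cases i.onE.injective h
  label_none _ := rfl
  label_some x hx := by
    rcases x with x | a
    · exact Option.some_ne_none _
    · exact absurd ⟨a, rfl⟩ hx
  root_none _ := rfl
  root_some x hx := by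
    rcases x with x | a
    · exact Option.some_ne_none _
    · exact absurd ⟨a, rfl⟩ hx

def HostGraph.Iso.relabel {K : Type} {C : Ctx K} {κ : K → B.V} {lV lV' : B.V → HList}
    {lE lE' : B.E → HList} (i : (C.glue (B.relabel lV lE) κ).Iso G) (hV : ∀ v, lV' v = lV v)
    (hE : ∀ e, lE' e = lE e) : (C.glue (B.relabel lV' lE') κ).Iso G :=
  { i with
    vList_comm := by
      rintro (v | v)
      · exact i.vList_comm (.inl v)
      · exact (i.vList_comm (.inr v)).trans (hV v).symm
    eList_comm := by
      rintro (v | v)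
      · exact i.eList_comm (.inl v)
      · exact (i.eList_comm (.inr v)).trans (hE v).symm
    src_comm := i.src_comm
    tgt_comm := i.tgt_comm
    vMark_comm := i.vMark_comm
    eMark_comm := i.eMark_comm
    root_comm := i.root_comm }

/-! ### Direct derivations -/

namespace RuleSchema

variable (r : RuleSchema)

/-- The label variables of a rule schema, and a list variable for each of its items. -/
inductive LVar : LSort → Type
  | var {s : LSort} (n : RVar s) : LVar s
  | vL (v : r.VL) : LVar .list
  | eL (e : r.EL) : LVar .list
  | vR (v : r.VR) : LVar .list
  | eR (e : r.ER) : LVar .list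

/-- The values of the wildcards. -/
abbrev Marks : Type := (r.VL → {m : VMark // m ≠ .none}) × (r.EL → {m : EMark // m ≠ .none})

variable {r}

/-- The left-hand graph without lists. -/
def graphL (μ : r.Marks) : HostGraph where
  V := r.VL
  E := r.EL
  finV := inferInstance
  finE := inferInstance
  src := r.L.src
  tgt := r.L.tgt
  vList _ := []
  vMark v := (r.L.vMark v).resolve (μ.1 v).1
  eList _ := []
  eMark e := (r.L.eMark e).resolve (μ.2 e).1
  root := r.L.root

/-- The right-hand graph without lists. -/
def graphR (μ : r.Marks) : HostGraph where
  V := r.VR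
  E := r.ER
  finV := inferInstance
  finE := inferInstance
  src := r.R.src
  tgt := r.R.tgt
  vList _ := []
  vMark v := (r.R.vMark v).resolve (if h : v.1 ∈ r.VL then (μ.1 ⟨v.1, h⟩).1 else .none)
  eList _ := []
  eMark e := (r.R.eMark e).resolve (if h : e.1 ∈ r.EL then (μ.2 ⟨e.1, h⟩).1 else .none)
  root := r.R.root

variable (r)

def inL (k : r.K) : r.VL := ⟨k.1, r.K_sub_L k.2⟩

def inR (k : r.K) : r.VR := ⟨k.1, r.K_sub_R k.2⟩

theorem inL_injective : Function.Injective r.inL :=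
  fun _ _ h => Subtype.ext (congrArg (fun v : r.VL => v.1) h)

theorem inR_injective : Function.Injective r.inR :=
  fun _ _ h => Subtype.ext (congrArg (fun v : r.VR => v.1) h)

/-- The application condition holds, and the list variables of the items have the values of their
expressions. -/
structure Valid (G : HostGraph) (ν : r.VL → G.V) (α : LAssign r.LVar) : Prop where
  cond : r.cond.Holds G ν (fun s n => α s (.var n))
  vL : ∀ v, α .list (.vL v) = (r.L.vList v).eval G ν (fun s n => α s (.var n))
  eL : ∀ v, α .list (.eL v) = (r.L.eList v).eval G ν (fun s n => α s (.var n))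
  vR : ∀ v, α .list (.vR v) = (r.R.vList v).eval G ν (fun s n => α s (.var n))
  eR : ∀ v, α .list (.eR v) = (r.R.eList v).eval G ν (fun s n => α s (.var n))

variable {r}

/-- The left-hand instance. -/
abbrev instanceL (μ : r.Marks) (α : LAssign r.LVar) : HostGraph :=
  (graphL μ).relabel (α.lists .vL) (α.lists .eL)

/-- The right-hand instance. -/
abbrev instanceR (μ : r.Marks) (α : LAssign r.LVar) : HostGraph :=
  (graphR μ).relabel (α.lists .vR) (α.lists .eR)

/-- Extend an assignment to the list variables of the items. -/
noncomputable def extend (G : HostGraph) (ν : r.VL → G.V) (α : LAssign RVar) : LAssign r.LVar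
  | _, .var n => α _ n
  | _, .vL v => (r.L.vList v).eval G ν α
  | _, .eL v => (r.L.eList v).eval G ν α
  | _, .vR v => (r.R.vList v).eval G ν α
  | _, .eR v => (r.R.eList v).eval G ν α

/-- A direct derivation replaces the left-hand instance by the right-hand instance in some
context. -/
theorem exists_derives_iff {G H : HostGraph} :
    (∃ g : r.Premorphism G, g.Injective ∧ r.Derives G H g) ↔
      ∃ (μ : r.Marks) (α : LAssign r.LVar) (C : Ctx r.K)
        (i : (C.glue (instanceL μ α) r.inL).Iso G) (_ : (C.glue (instanceR μ α) r.inR).Iso H),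
        r.Valid G (fun v => i.onV (.inr v)) α := by
  have hA : IsEmpty r.interface.E := inferInstanceAs (IsEmpty Empty)
  have hK : Finite r.interface.V := inferInstanceAs (Finite r.K)
  have hT : ∀ (J : HostGraph) (v : J.V), J.toPGraph.vLabel v ≠ none := fun _ _ =>
    Option.some_ne_none _
  have hT' : ∀ (J : HostGraph) (v : J.V), J.toPGraph.root v ≠ none := fun _ _ =>
    Option.some_ne_none _
  constructor
  · rintro ⟨g, hg, α, m, hmV, hmE, hc, D, k, d, h, m', h₁, h₂⟩
    have hL : Function.Injective (Hom.onV (r.inclL g α)) := r.inL_injective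
    have hR : Function.Injective (Hom.onV (r.inclR g α)) := r.inR_injective
    -- The definition of derivations does not demand this: it follows from commutativity of the left
    -- square and injectivity of the match and of the inclusion.
    have hk : Function.Injective (Hom.onV k) := by
      have hm : Function.Injective (Hom.onV m) := hmV ▸ hg.1
      intro x y hxy
      apply hL
      apply hm
      exact (hom_congrV h₁.1.w x).trans
        ((congrArg (Hom.onV d) hxy).trans (hom_congrV h₁.1.w y).symm)
    have g₁ := isGluing_of_isNaturalPushout hA (fun _ => rfl) (fun _ => rfl) (hT _) (hT' _) (hT _)
      (hT' _) hL hk h₁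
    have g₂ := isGluing_of_isNaturalPushout hA (fun _ => rfl) (fun _ => rfl) (hT _) (hT' _) (hT _)
      (hT' _) hR hk h₂
    refine ⟨(α.muV, α.muE), extend G g.onV α.val, D.toCtx (Hom.onV k), g₁.iso, g₂.iso, ?_⟩
    have : (fun v => g₁.iso.onV (.inr v)) = g.onV := hmV
    have hv : r.Valid G g.onV (extend G g.onV α.val) :=
      ⟨hc, fun _ => rfl, fun _ => rfl, fun _ => rfl, fun _ => rfl⟩
    exact (congrArg (fun ν : r.VL → G.V => r.Valid G ν _) this).mpr hv
  · rintro ⟨μ, α, C, i, j, hv⟩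
    let g : r.Premorphism G :=
      { onV := fun v => i.onV (.inr v)
        onE := fun e => i.onE (.inr e)
        src_comm := fun e => i.src_comm (.inr e)
        tgt_comm := fun e => i.tgt_comm (.inr e)
        root_comm := fun v => i.root_comm (.inr v) }
    -- `Valid` gives the item variables the values of their expressions, so the instances built from
    -- variables and those built from expressions have the same lists.
    let β : r.LabelAssignment := ⟨fun s n => α s (.var n), μ.1, μ.2⟩
    let i' : (C.glue (r.instL g β) (Hom.onV (r.inclL g β))).Iso G :=
      i.relabel (fun v => (hv.vL v).symm) (fun e => (hv.eL e).symm)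
    let j' : (C.glue (r.instR g β) (Hom.onV (r.inclR g β))).Iso H :=
      j.relabel (fun v => (hv.vR v).symm) (fun e => (hv.eR e).symm)
    have g₁ := i'.isGluing (A := r.interface) hA (fun _ => rfl) (fun _ => rfl) _ r.inL_injective
    have g₂ := j'.isGluing (A := r.interface) hA (fun _ => rfl) (fun _ => rfl) _ r.inR_injective
    exact ⟨g, ⟨i.onV.injective.comp Sum.inr_injective, i.onE.injective.comp Sum.inr_injective⟩,
      β, i'.homRight, rfl, rfl, hv.cond, _, _, _, _, _,
      g₁.isNaturalPushout hA (hT _) (hT' _) r.inL_injective,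
      g₂.isNaturalPushout hA (hT _) (hT' _) r.inR_injective⟩

end RuleSchema

end GP2

namespace GP2

variable {N E : Type} {X : LSort → Type}

/-! ### Definability of direct derivations -/

section Rewriting

variable {K : Type} {M S : HostGraph} {k : K → M.V} {kS : K → S.V}

/-- Only the dangling condition involves the unbounded part of the graph, and it takes a single edge
quantifier; everything else ranges over finite types. -/
theorem attached_definable {A B : Type} [Finite A] [Finite B] {k : K → A} {u : B → A}
    {t : ∀ G : HostGraph, G.E → G.V}
    (ht : ∀ {N E : Type} (e : E) (x : N),
      Definable (N := N) (E := E) (X := X) (fun G ν ε _ => t G (ε e) = ν x)) :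
    Definable (X := X) (fun G ν ε _ => Attached ν ε k (t G) u) := by
  refine ((Definable.forall_finite fun e => ht e (u e)).and (Definable.forallE
    ((Definable.exists_finite fun f : B => .edgeEq (some f) none).not.imp
    (.forall_finite fun x : A => (ht none x).imp (.const (x ∈ Set.range k)))))).congr
    fun G ν ε α => ?_
  exact ⟨fun h => ⟨h.comm, h.dangling⟩, fun h => ⟨h.1, h.2⟩⟩

theorem isMatch_definable (M : HostGraph) (k : K → M.V) (lV : M.V → X .list)
    (lE : M.E → X .list) :
    Definable (X := X) (fun G ν ε α =>
      IsMatch (M.relabel (α.lists lV) (α.lists lE)) k G ν ε) := by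
  have := M.finV
  have := M.finE
  have h₁ : Definable (N := M.V) (E := M.E) (X := X) (fun G ν _ _ => ∀ x y, ν x = ν y → x = y) :=
    .forall_finite fun x => .forall_finite fun y => (Definable.nodeEq x y).imp (.const _)
  have h₂ : Definable (N := M.V) (E := M.E) (X := X) (fun G _ ε _ => ∀ x y, ε x = ε y → x = y) :=
    .forall_finite fun x => .forall_finite fun y => (Definable.edgeEq x y).imp (.const _)
  have h₃ : Definable (X := X) (fun G ν ε _ => Attached ν ε k G.src M.src) :=
    attached_definable (t := HostGraph.src) .src
  have h₄ : Definable (X := X) (fun G ν ε _ => Attached ν ε k G.tgt M.tgt) :=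
    attached_definable (t := HostGraph.tgt) .tgt
  have h₅ : Definable (N := M.V) (E := M.E) (fun G ν _ α => ∀ x, G.vList (ν x) = α .list (lV x)) :=
    .forall_finite fun x => .nodeList x (lV x)
  have h₆ : Definable (N := M.V) (E := M.E) (X := X)
      (fun G ν _ _ => ∀ x, G.vMark (ν x) = M.vMark x) :=
    .forall_finite fun x => .nodeMark x (.mark (M.vMark x))
  have h₇ : Definable (N := M.V) (E := M.E) (X := X)
      (fun G ν _ _ => ∀ x, G.root (ν x) = M.root x) := by
    refine .forall_finite fun x => ?_
    cases M.root x
    · exact (Definable.root x).not.congr fun _ _ _ _ => by simp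
    · exact .root x
  have h₈ : Definable (N := M.V) (E := M.E) (fun G _ ε α => ∀ x, G.eList (ε x) = α .list (lE x)) :=
    .forall_finite fun x => .edgeList x (lE x)
  have h₉ : Definable (N := M.V) (E := M.E) (X := X)
      (fun G _ ε _ => ∀ x, G.eMark (ε x) = M.eMark x) :=
    .forall_finite fun x => .edgeMark x (.mark (M.eMark x))
  refine ((h₁.and (h₂.and (h₃.and h₄))).and (h₅.and (h₆.and (h₇.and (h₈.and h₉))))).congr
    fun G ν ε α => ?_
  constructor
  · rintro ⟨⟨a, b, c, d⟩, e, f, g, h, i⟩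
    exact ⟨⟨a, b, c, d⟩, e, f, g, h, i⟩
  · rintro ⟨⟨a, b, c, d⟩, e, f, g, h, i⟩
    exact ⟨⟨a, b, c, d⟩, e, f, g, h, i⟩

/-- The predicate `P` depends only on the label variables in `s`. -/
def SupportedBy (s : Finset (Σ t, X t)) (P : Pred N E X) : Prop :=
  ∀ G ν ε (α α' : LAssign X), (∀ p ∈ s, α p.1 p.2 = α' p.1 p.2) → P G ν ε α → P G ν ε α'

/-- Some match of `M` in `G` satisfies `P`, and replacing it by `S` yields a graph that
satisfies `Q`. -/
def CanReplace (M S : HostGraph) (k : K → M.V) (kS : K → S.V) (lV : M.V → X .list)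
    (lE : M.E → X .list) (lV' : S.V → X .list) (lE' : S.E → X .list) (P : Pred M.V Empty X)
    (Q : Pred S.V Empty X) (G : HostGraph) : Prop :=
  ∃ (ν : M.V → G.V) (ε : M.E → G.E) (α : LAssign X)
    (h : IsMatch (M.relabel (α.lists lV) (α.lists lE)) k G ν ε), P G ν Empty.elim α ∧
      Q (h.occ.ctx.glue (S.relabel (α.lists lV') (α.lists lE')) kS) Sum.inr Empty.elim α

/-- `Definable.transfers` pulls `Q` back to the graph that contains the match, and being a match is
definable. What remains is to quantify over a finite family of nodes, a finite family of edges, and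
the label variables in the finite support `s`. -/
theorem canReplace_definable [Finite K] (hk : Function.Injective k) (hkS : Function.Injective kS)
    (lV : M.V → X .list) (lE : M.E → X .list) (lV' : S.V → X .list) (lE' : S.E → X .list)
    {P : Pred M.V Empty X} {Q : Pred S.V Empty X} (hP : Definable P) (hQ : Definable Q)
    (s : Finset (Σ t, X t)) (hPs : SupportedBy s P) (hQs : SupportedBy s Q)
    (hlV : ∀ x, ⟨_, lV x⟩ ∈ s) (hlE : ∀ x, ⟨_, lE x⟩ ∈ s) (hlV' : ∀ x, ⟨_, lV' x⟩ ∈ s)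
    (hlE' : ∀ x, ⟨_, lE' x⟩ ∈ s) :
    Definable (N := Empty) (E := Empty) (X := fun _ => Empty)
      (fun G _ _ _ => CanReplace M S k kS lV lE lV' lE' P Q G) := by
  have := M.finV
  have := M.finE
  -- All node variables of `Q` denote inserted nodes, while the variables of the translation are the
  -- nodes and edges of the match itself.
  obtain ⟨T, hT, hT'⟩ := hQ.transfers (M := M) (k := k) hk hkS (N' := M.V) (E' := M.E) (X' := X)
    Sum.inr Empty.elim (fun _ x => x) id id lV' lE'
  have main : Definable (N := M.V) (E := M.E) (X := X) (fun G ν ε α =>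
      ∃ h : IsMatch (M.relabel (α.lists lV) (α.lists lE)) k G ν ε, P G ν Empty.elim α ∧
      Q (h.occ.ctx.glue (S.relabel (α.lists lV') (α.lists lE')) kS) Sum.inr Empty.elim α) := by
    refine ((isMatch_definable M k lV lE).and
      ((hP.rename id Empty.elim (fun _ x => x)).and hT)).congr fun G ν ε α => ?_
    have hε : (fun e : Empty => ε e.elim) = Empty.elim := funext fun e => e.elim
    have key : ∀ h : IsMatch (M.relabel (α.lists lV) (α.lists lE)) k G ν ε, T G ν ε α ↔
        Q (h.occ.ctx.glue (S.relabel (α.lists lV') (α.lists lE')) kS) Sum.inr Empty.elim α :=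
      -- Occurrences do not see lists, so a match of the relabelled graph is an occurrence of `M`
      -- with the same context.
      fun h => hT' G ν ε α ⟨h.occ.injV, h.occ.injE, h.occ.src, h.occ.tgt⟩ Sum.inr Empty.elim
        (fun _ => rfl) (fun e => e.elim)
    simp only [hε, id]
    constructor
    · rintro ⟨h, h', h''⟩
      exact ⟨h, h', (key h).2 h''⟩
    · rintro ⟨h, h', h''⟩
      exact ⟨h, h', (key h).1 h''⟩
  refine (main.exists_labels s ?_).exists_edges.exists_nodes
  rintro G ν ε α α' h ⟨hm, hp, hq⟩
  have e₁ : α.lists lV = α'.lists lV := funext fun x => h _ (hlV x)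
  have e₂ : α.lists lE = α'.lists lE := funext fun x => h _ (hlE x)
  have e₃ : α.lists lV' = α'.lists lV' := funext fun x => h _ (hlV' x)
  have e₄ : α.lists lE' = α'.lists lE' := funext fun x => h _ (hlE' x)
  rw [← e₁, ← e₂, ← e₃, ← e₄]
  exact ⟨hm, hPs _ _ _ _ _ h hp, hQs _ _ _ _ _ h hq⟩

end Rewriting

/-! ### Dependence on finitely many variables -/

section Vars

variable {X : LSort → Type} {N : Type} {G : HostGraph} {ν : N → G.V} {α α' : LAssign X}

theorem IntExp.vars_finite (e : IntExp X N) : e.vars.Finite := by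
  induction e <;> simp_all [IntExp.vars]

theorem StrExp.vars_finite (e : StrExp X) : e.vars.Finite := by
  induction e <;> simp_all [StrExp.vars]

theorem AtomExp.vars_finite (e : AtomExp X N) : e.vars.Finite := by
  cases e <;> simp [AtomExp.vars, IntExp.vars_finite, StrExp.vars_finite]

theorem ListExp.vars_finite (e : ListExp X N) : e.vars.Finite := by
  induction e <;> simp_all [ListExp.vars, AtomExp.vars_finite]

theorem RuleGraph.vars_finite {I V E : Type} [Finite V] [Finite E] (M : RuleGraph I V E) :
    M.vars.Finite :=
  (Set.finite_iUnion fun _ => ListExp.vars_finite _).union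
    (Set.finite_iUnion fun _ => ListExp.vars_finite _)

theorem IntExp.eval_congr (e : IntExp X N) (h : ∀ p ∈ e.vars, α p.1 p.2 = α' p.1 p.2) :
    e.eval G ν α = e.eval G ν α' := by
  induction e with
  | op o a b iha ihb =>
    simp only [IntExp.eval]
    rw [iha fun p hp => h p (.inl hp), ihb fun p hp => h p (.inr hp)]
  | const | indeg | outdeg => rfl
  | var x => exact h _ rfl
  | lengthAtom x => exact congrArg (fun a : Atom => (a.length : ℤ)) (h _ rfl)
  | lengthString x => exact congrArg (fun a : List Character => (a.length : ℤ)) (h _ rfl)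
  | lengthList x => exact congrArg (fun a : HList => (a.length : ℤ)) (h _ rfl)

theorem StrExp.eval_congr (e : StrExp X) (h : ∀ p ∈ e.vars, α p.1 p.2 = α' p.1 p.2) :
    e.eval α = e.eval α' := by
  induction e with
  | concat a b iha ihb =>
    simp only [StrExp.eval]
    rw [iha fun p hp => h p (.inl hp), ihb fun p hp => h p (.inr hp)]
  | lit => rfl
  | charVar x => exact congrArg (fun c : Character => [c]) (h _ rfl)
  | var x => exact h _ rfl

theorem AtomExp.eval_congr (e : AtomExp X N) (h : ∀ p ∈ e.vars, α p.1 p.2 = α' p.1 p.2) :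
    e.eval G ν α = e.eval G ν α' := by
  cases e with
  | int e => exact congrArg Atom.int (e.eval_congr h)
  | str e => exact congrArg Atom.str (e.eval_congr h)
  | var x => exact h _ rfl

theorem ListExp.eval_congr (e : ListExp X N) (h : ∀ p ∈ e.vars, α p.1 p.2 = α' p.1 p.2) :
    e.eval G ν α = e.eval G ν α' := by
  induction e with
  | append a b iha ihb =>
    simp only [ListExp.eval]
    rw [iha fun p hp => h p (.inl hp), ihb fun p hp => h p (.inr hp)]
  | empty => rfl
  | atom e => exact congrArg (fun a : Atom => [a]) (e.eval_congr h)
  | var x => exact h _ rfl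

theorem RuleCond.holds_congr {I : Type} {ν : I → G.V} {α α' : LAssign RVar} (c : RuleCond I)
    (h : ∀ p ∈ c.vars, α p.1 p.2 = α' p.1 p.2) : c.Holds G ν α ↔ c.Holds G ν α' := by
  induction c with
  | typed p s x =>
    simp only [RuleCond.Holds]
    rw [h ⟨s, x⟩ rfl]
  | listEq a b =>
    simp only [RuleCond.Holds]
    rw [a.eval_congr fun p hp => h p (.inl hp), b.eval_congr fun p hp => h p (.inr hp)]
  | listNe a b =>
    simp only [RuleCond.Holds]
    rw [a.eval_congr fun p hp => h p (.inl hp), b.eval_congr fun p hp => h p (.inr hp)]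
  | cmp o a b =>
    simp only [RuleCond.Holds]
    rw [a.eval_congr fun p hp => h p (.inl hp), b.eval_congr fun p hp => h p (.inr hp)]
  | edge u v => rfl
  | edgeList u v l =>
    simp only [RuleCond.Holds]
    rw [l.eval_congr h]
  | edgeListMark u v l m =>
    simp only [RuleCond.Holds]
    rw [l.eval_congr h]
  | not c ih => exact not_congr (ih h)
  | and c d ihc ihd =>
    exact and_congr (ihc fun p hp => h p (.inl hp)) (ihd fun p hp => h p (.inr hp))
  | or c d ihc ihd =>
    exact or_congr (ihc fun p hp => h p (.inl hp)) (ihd fun p hp => h p (.inr hp))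

end Vars

/-- Application conditions are definable. -/
theorem RuleCond.definable {I E : Type} (c : RuleCond I) :
    Definable (N := I) (E := E) (X := RVar) (fun G ν _ α => c.Holds G ν α) := by
  have hτ : ∀ x : I, DefinableNode (N := I) (E := E) (X := RVar) (fun _ ν _ _ => ν x) :=
    fun x => (NodeTerm.var x).definableNode
  have hl : ∀ l : ListExp RVar I,
      DefinableFun (N := I) (E := E) (X := RVar) .list (fun G ν _ α => l.eval G ν α) :=
    fun l => l.definableFun (τ := fun _ m ν _ => ν m) hτ
  have hi : ∀ l : IntExp RVar I,
      DefinableFun (N := I) (E := E) (X := RVar) .int (fun G ν _ α => (l.eval G ν α : ℤ)) :=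
    fun l => l.definableFun (τ := fun _ m ν _ => ν m) hτ
  induction c with
  | typed p s x => exact .pure _ (pureDefinable_typed p s _ x)
  | listEq a b => exact (hl a).eq (hl b)
  | listNe a b => exact ((hl a).eq (hl b)).not
  | cmp o a b => exact (hi a).rel₂ (hi b) (pureDefinable_cmp o)
  | edge u v => exact Definable.hasEdge (hτ u) (hτ v) (l := none) (by simp) none
  | edgeList u v l =>
    exact Definable.hasEdge (hτ u) (hτ v) (l := some fun G ν _ α => l.eval G ν α)
      (by rintro _ ⟨⟩; exact hl l) none
  | edgeListMark u v l m =>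
    exact Definable.hasEdge (hτ u) (hτ v) (l := some fun G ν _ α => l.eval G ν α)
      (by rintro _ ⟨⟩; exact hl l) (some m)
  | not c ih => exact ih.not
  | and c d ihc ihd => exact ihc.and ihd
  | or c d ihc ihd => exact ihc.or ihd

namespace RuleSchema

variable (r : RuleSchema)

theorem valid_definable {E : Type} :
    Definable (N := r.VL) (E := E) (X := r.LVar) (fun G ν _ α => r.Valid G ν α) := by
  have hl : ∀ l : ListExp RVar r.VL, DefinableFun (N := r.VL) (E := E) (X := r.LVar) .list
      (fun G ν _ α => l.eval G ν (fun s n => α s (.var n))) := fun l =>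
    (l.definableFun (τ := fun _ m ν _ => ν m) fun x => (NodeTerm.var x).definableNode).rename id id
      (fun _ n => LVar.var n)
  refine ((r.cond.definable.rename id id (fun _ n => LVar.var n)).and
    ((Definable.forall_finite fun v => (DefinableFun.var (.vL v)).eq (hl (r.L.vList v))).and
    ((Definable.forall_finite fun v => (DefinableFun.var (.eL v)).eq (hl (r.L.eList v))).and
    ((Definable.forall_finite fun v => (DefinableFun.var (.vR v)).eq (hl (r.R.vList v))).and
    (Definable.forall_finite fun v => (DefinableFun.var (.eR v)).eq (hl (r.R.eList v))))))).congr
    fun G ν ε α => ?_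
  exact ⟨fun h => ⟨h.cond, h.vL, h.eL, h.vR, h.eR⟩,
    fun h => ⟨h.1, h.2.1, h.2.2.1, h.2.2.2.1, h.2.2.2.2⟩⟩

theorem support_finite : ((fun p : Σ s, RVar s => (⟨p.1, .var p.2⟩ : Σ s, r.LVar s)) '' r.L.vars ∪
    (Set.range (fun v => ⟨.list, .vL v⟩) ∪ Set.range (fun v => ⟨.list, .eL v⟩) ∪
    (Set.range (fun v => ⟨.list, .vR v⟩) ∪ Set.range (fun v => ⟨.list, .eR v⟩)))).Finite :=
  (r.L.vars_finite.image _).union (((Set.finite_range _).union (Set.finite_range _)).union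
    ((Set.finite_range _).union (Set.finite_range _)))

/-- The variables that matter for a direct derivation. -/
noncomputable def support : Finset (Σ s, r.LVar s) := r.support_finite.toFinset

/-- All expressions of the right-hand graph and the condition use only variables of the left-hand
graph, and those are finitely many. -/
theorem valid_supportedBy {E : Type} :
    SupportedBy r.support (N := r.VL) (E := E) (fun G ν _ α => r.Valid G ν α) := by
  intro G ν ε α α' h hv
  simp only [support, Set.Finite.mem_toFinset] at h
  have hL : ∀ p ∈ r.L.vars, α p.1 (.var p.2) = α' p.1 (.var p.2) := fun p hp =>
    h ⟨p.1, .var p.2⟩ (.inl ⟨p, hp, rfl⟩)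
  have hvars : ∀ l : ListExp RVar r.VL, l.vars ⊆ r.L.vars →
      l.eval G ν (fun s n => α s (.var n)) = l.eval G ν (fun s n => α' s (.var n)) :=
    fun l hl => l.eval_congr fun p hp => hL p (hl hp)
  have hLv : ∀ v, (r.L.vList v).vars ⊆ r.L.vars := fun v p hp =>
    .inl (Set.mem_iUnion.2 ⟨v, hp⟩)
  have hLe : ∀ v, (r.L.eList v).vars ⊆ r.L.vars := fun v p hp =>
    .inr (Set.mem_iUnion.2 ⟨v, hp⟩)
  have hRv : ∀ v, (r.R.vList v).vars ⊆ r.L.vars := fun v p hp =>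
    r.vars_R (.inl (Set.mem_iUnion.2 ⟨v, hp⟩))
  have hRe : ∀ v, (r.R.eList v).vars ⊆ r.L.vars := fun v p hp =>
    r.vars_R (.inr (Set.mem_iUnion.2 ⟨v, hp⟩))
  refine ⟨(r.cond.holds_congr fun p hp => hL p (r.vars_cond hp)).1 hv.cond, fun v => ?_,
    fun v => ?_, fun v => ?_, fun v => ?_⟩
  · exact (h ⟨.list, .vL v⟩ (.inr (.inl (.inl ⟨v, rfl⟩)))).symm.trans
      ((hv.vL v).trans (hvars _ (hLv v)))
  · exact (h ⟨.list, .eL v⟩ (.inr (.inl (.inr ⟨v, rfl⟩)))).symm.trans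
      ((hv.eL v).trans (hvars _ (hLe v)))
  · exact (h ⟨.list, .vR v⟩ (.inr (.inr (.inl ⟨v, rfl⟩)))).symm.trans
      ((hv.vR v).trans (hvars _ (hRv v)))
  · exact (h ⟨.list, .eR v⟩ (.inr (.inr (.inr ⟨v, rfl⟩)))).symm.trans
      ((hv.eR v).trans (hvars _ (hRe v)))

end RuleSchema

-- Closed formulas and the definability of preconditions and postconditions of rules

theorem HostGraph.models_iff (G : HostGraph) (φ : ClosedFormula) (ν : Empty → G.V)
    (ε : Empty → G.E) (α : LAssign fun _ => Empty) : G.Models φ ↔ φ.Sat G ν ε α := by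
  constructor
  · rintro ⟨ν', ε', α', h⟩
    obtain rfl : ν' = ν := funext fun x => x.elim
    obtain rfl : ε' = ε := funext fun x => x.elim
    obtain rfl : α' = α := funext fun s => funext fun x => x.elim
    exact h
  · exact fun h => ⟨_, _, _, h⟩

theorem models_definable (φ : ClosedFormula) :
    Definable (N := N) (E := E) (X := X) (fun G _ _ _ => G.Models φ) :=
  (φ.definable.rename Empty.elim Empty.elim (fun _ => Empty.elim)).congr fun G _ _ _ =>
    G.models_iff φ _ _ _

theorem Definable.exists_closedFormula {p : HostGraph → Prop}
    (h : Definable (N := Empty) (E := Empty) (X := fun _ => Empty) (fun G _ _ _ => p G)) :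
    ∃ φ : ClosedFormula, ∀ G : HostGraph, G.Models φ ↔ p G := by
  obtain ⟨φ, hφ⟩ := h.exists_formula id id (fun _ => id)
  exact ⟨φ, fun G =>
    (G.models_iff φ Empty.elim Empty.elim (fun _ => Empty.elim)).trans (hφ G _ _ _)⟩

theorem HostGraph.Iso.models {G H : HostGraph} (i : G.Iso H) (φ : ClosedFormula) :
    H.Models φ ↔ G.Models φ :=
  (models_definable (N := Empty) (E := Empty) (X := fun _ => Empty) φ).iso i Empty.elim Empty.elim
    (fun _ => Empty.elim)

/-- Finiteness of the mark types makes the choice of wildcard values a finite disjunction. -/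
instance : Finite VMark :=
  Finite.of_surjective (fun i : Fin 5 => ![VMark.none, .red, .green, .blue, .grey] i) fun m => by
    cases m
    exacts [⟨0, rfl⟩, ⟨1, rfl⟩, ⟨2, rfl⟩, ⟨3, rfl⟩, ⟨4, rfl⟩]

instance : Finite EMark :=
  Finite.of_surjective (fun i : Fin 5 => ![EMark.none, .red, .green, .blue, .dashed] i) fun m => by
    cases m
    exacts [⟨0, rfl⟩, ⟨1, rfl⟩, ⟨2, rfl⟩, ⟨3, rfl⟩, ⟨4, rfl⟩]

namespace RuleSchema

variable {r : RuleSchema}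

/-- A presentation of `G` as a filled context is the same as a match in `G`, and its context is
unique up to isomorphism. The result is then fixed up to isomorphism, which closed formulas do not
notice. -/
theorem exists_derives_models_iff (G : HostGraph) (φ : ClosedFormula) :
    (∃ H, (∃ g : r.Premorphism G, g.Injective ∧ r.Derives G H g) ∧ H.Models φ) ↔
      ∃ μ : r.Marks, CanReplace (graphL μ) (graphR μ) r.inL r.inR .vL .eL .vR .eR
        (fun G ν _ α => r.Valid G ν α) (fun G _ _ _ => G.Models φ) G := by
  simp only [exists_derives_iff]
  constructor
  · rintro ⟨H, ⟨μ, α, C, i, j, hv⟩, hφ⟩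
    refine ⟨μ, _, _, α, i.isMatch, hv, ?_⟩
    exact ((i.glueCongr r.inL_injective i.isMatch.occ).models φ).2 ((j.models φ).1 hφ)
  · rintro ⟨μ, ν, ε, α, h, hv, hφ⟩
    exact ⟨_, ⟨μ, α, h.occ.ctx, h.iso, .refl _, hv⟩, hφ⟩

/-- The same argument is run backwards, from a match of the right-hand instance in `H`. Validity
refers to the unknown graph `G`, through degrees and the application condition, so it is demanded of
the replaced graph together with `φ`. -/
theorem exists_models_derives_iff (H : HostGraph) (φ : ClosedFormula) :
    (∃ G, G.Models φ ∧ ∃ g : r.Premorphism G, g.Injective ∧ r.Derives G H g) ↔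
      ∃ μ : r.Marks, CanReplace (graphR μ) (graphL μ) r.inR r.inL .vR .eR .vL .eL
        (fun _ _ _ _ => True) (fun G ν _ α => G.Models φ ∧ r.Valid G ν α) H := by
  simp only [exists_derives_iff]
  constructor
  · rintro ⟨G, hφ, μ, α, C, i, j, hv⟩
    -- Validity is moved from `G` to its presentation, and below from there to the graph obtained by
    -- replacement in `H`.
    have hv' := (r.valid_definable.iso i Sum.inr Empty.elim α).1 hv
    refine ⟨μ, _, _, α, j.isMatch, trivial, ?_, ?_⟩
    · exact ((j.glueCongr r.inR_injective j.isMatch.occ).models φ).2 ((i.models φ).1 hφ)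
    · exact (r.valid_definable.iso (j.glueCongr (S := instanceL μ α) (kS := r.inL)
        r.inR_injective j.isMatch.occ) Sum.inr Empty.elim α).2 hv'
  · rintro ⟨μ, ν, ε, α, h, -, hφ, hv⟩
    exact ⟨_, hφ, μ, α, h.occ.ctx, .refl _, h.iso, hv⟩

theorem mem_support_vL (v : r.VL) : ⟨.list, .vL v⟩ ∈ r.support :=
  r.support_finite.mem_toFinset.2 (.inr (.inl (.inl ⟨v, rfl⟩)))

theorem mem_support_eL (v : r.EL) : ⟨.list, .eL v⟩ ∈ r.support :=
  r.support_finite.mem_toFinset.2 (.inr (.inl (.inr ⟨v, rfl⟩)))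

theorem mem_support_vR (v : r.VR) : ⟨.list, .vR v⟩ ∈ r.support :=
  r.support_finite.mem_toFinset.2 (.inr (.inr (.inl ⟨v, rfl⟩)))

theorem mem_support_eR (v : r.ER) : ⟨.list, .eR v⟩ ∈ r.support :=
  r.support_finite.mem_toFinset.2 (.inr (.inr (.inr ⟨v, rfl⟩)))

theorem pre_definable (r : RuleSchema) (φ : ClosedFormula) :
    Definable (N := Empty) (E := Empty) (X := fun _ => Empty) (fun G _ _ _ =>
      ∃ H, (∃ g : r.Premorphism G, g.Injective ∧ r.Derives G H g) ∧ H.Models φ) := by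
  simp only [exists_derives_models_iff]
  exact .exists_finite fun μ => canReplace_definable r.inL_injective r.inR_injective _ _ _ _
    r.valid_definable (models_definable φ) r.support r.valid_supportedBy
    (fun _ _ _ _ _ _ h => h) mem_support_vL mem_support_eL mem_support_vR mem_support_eR

theorem post_definable (r : RuleSchema) (φ : ClosedFormula) :
    Definable (N := Empty) (E := Empty) (X := fun _ => Empty) (fun H _ _ _ =>
      ∃ G, G.Models φ ∧ ∃ g : r.Premorphism G, g.Injective ∧ r.Derives G H g) := by
  simp only [exists_models_derives_iff]
  exact .exists_finite fun μ => canReplace_definable r.inR_injective r.inL_injective _ _ _ _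
    (.const True) ((models_definable φ).and r.valid_definable) r.support (fun _ _ _ _ _ _ h => h)
    (fun _ _ _ _ _ h hv => ⟨hv.1, r.valid_supportedBy _ _ Empty.elim _ _ h hv.2⟩)
    mem_support_vR mem_support_eR mem_support_vL mem_support_eL

/-- An unconditional rule schema with empty left-hand side is applicable to every graph. -/
theorem exists_derives_of_empty (r : RuleSchema) (hV : r.VL = ∅) (hr : r.Unconditional)
    (G : HostGraph) : ∃ H, ∃ g : r.Premorphism G, g.Injective ∧ r.Derives G H g := by
  have hV' : IsEmpty r.VL := by
    rw [hV]
    infer_instance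
  -- Without nodes there are no edges, so the empty maps form a match and its context is all of `G`.
  have hE : IsEmpty r.EL := ⟨fun e => hV'.elim (r.L.src e)⟩
  have α₀ : LAssign RVar := fun s _ => Classical.arbitrary s.Dom
  let μ : r.Marks := (hV'.elim, hE.elim)
  let α : LAssign r.LVar := extend G hV'.elim α₀
  have hm : IsMatch (instanceL μ α) r.inL G hV'.elim hE.elim :=
    { occ :=
        { injV := fun x => hV'.elim x
          injE := fun x => hE.elim x
          src := ⟨fun x => hE.elim x, fun _ _ x => hV'.elim x⟩
          tgt := ⟨fun x => hE.elim x, fun _ _ x => hV'.elim x⟩ }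
      vList := fun x => hV'.elim x
      vMark := fun x => hV'.elim x
      root := fun x => hV'.elim x
      eList := fun x => hE.elim x
      eMark := fun x => hE.elim x }
  let g : r.Premorphism G := ⟨hV'.elim, hE.elim, fun e => hE.elim e, fun e => hE.elim e,
    fun v => hV'.elim v⟩
  refine ⟨_, exists_derives_iff.2 ⟨μ, α, hm.occ.ctx, hm.iso, .refl _, ?_⟩⟩
  exact ⟨hr G g _, fun _ => rfl, fun _ => rfl, fun _ => rfl, fun _ => rfl⟩

end RuleSchema

end GP2

namespace GP2

/-! ### Programs -/

theorem not_step_graph {G : HostGraph} {c : Config} : ¬ Step (.graph G) c := nofun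

theorem not_step_fail {c : Config} : ¬ Step .fail c := nofun

theorem not_step_brk {G : HostGraph} {c : Config} : ¬ Step (.run .brk G) c := nofun

/-- Every run begins with a step. -/
theorem plus_iff_exists_step {a c : Config} :
    Plus a c ↔ ∃ b, Step a b ∧ (b = c ∨ Plus b c) := by
  rw [plus_iff]
  constructor
  · intro h
    induction h using Relation.TransGen.head_induction_on with
    | single h => exact ⟨_, h, .inl rfl⟩
    | head h h' _ => exact ⟨_, h, .inr (plus_iff.2 h')⟩
  · rintro ⟨b, h, rfl | h'⟩
    · exact .single h
    · exact .head h (plus_iff.1 h')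

theorem not_plus_of_not_step {a c : Config} (h : ∀ b, ¬ Step a b) : ¬ Plus a c := fun h' => by
  obtain ⟨b, hb, -⟩ := plus_iff_exists_step.1 h'
  exact h b hb

theorem not_plus_graph {G : HostGraph} {c : Config} : ¬ Plus (.graph G) c :=
  not_plus_of_not_step fun _ => not_step_graph

theorem not_plus_fail {c : Config} : ¬ Plus .fail c := not_plus_of_not_step fun _ => not_step_fail

/-- The results of a run: a graph or failure. -/
def Config.IsResult : Config → Prop
  | .run _ _ => False
  | _ => True

variable {P Q C : Com} {G H : HostGraph}

theorem plus_seq_of_plus {c : Config} (h : Plus (.run P G) c) :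
    (∀ P' H, c = .run P' H → Plus (.run (.seq P Q) G) (.run (.seq P' Q) H)) ∧
    (∀ H, c = .graph H → Plus (.run (.seq P Q) G) (.run Q H)) ∧
    (c = .fail → Plus (.run (.seq P Q) G) .fail) := by
  rw [plus_iff] at h
  induction h with
  | single h =>
    refine ⟨?_, ?_, ?_⟩
    · rintro P' H rfl
      exact .single (.seq₁ h)
    · rintro H rfl
      exact .single (.seq₂ h)
    · rintro rfl
      exact .single (.seq₃ h)
  | @tail b c h h' ih =>
    rcases b with ⟨P', J⟩ | J | _
    · have ih := ih.1 P' J rfl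
      refine ⟨?_, ?_, ?_⟩
      · rintro P' H rfl
        exact .tail ih (.seq₁ h')
      · rintro H rfl
        exact .tail ih (.seq₂ h')
      · rintro rfl
        exact .tail ih (.seq₃ h')
    · exact absurd h' not_step_graph
    · exact absurd h' not_step_fail

/-- A run of `P; Q` imitates a run of `P` until `P` yields a graph or fails. An encountered `break`
discards `Q` and leaves the stuck command `break`, which is not a result; hence it contributes
nothing here. -/
theorem plus_seq_result {c : Config} (hc : c.IsResult) :
    Plus (.run (.seq P Q) G) c ↔
      (c = .fail ∧ Plus (.run P G) .fail) ∨
        ∃ J, Plus (.run P G) (.graph J) ∧ Plus (.run Q J) c := by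
  constructor
  · intro h₀
    rw [plus_iff] at h₀
    -- The first command and the graph vary along the run, so they are generalized before the
    -- induction on its first step.
    suffices key : ∀ a, Relation.TransGen Step a c → ∀ P G, a = .run (.seq P Q) G →
        (c = .fail ∧ Plus (.run P G) .fail) ∨
        ∃ J, Plus (.run P G) (.graph J) ∧ Plus (.run Q J) c from key _ h₀ _ _ rfl
    clear h₀
    intro a ha
    induction ha using Relation.TransGen.head_induction_on with
    | single hs =>
      rintro P G rfl
      cases hs with
      | seq₁ => cases hc
      | seq₂ => cases hc
      | seq₃ h => exact .inl ⟨rfl, .single h⟩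
      | brk => cases hc
    | head hs h' ih =>
      rintro P G rfl
      cases hs with
      | @seq₁ _ P' _ _ H h =>
        rcases ih P' H rfl with ⟨rfl, h''⟩ | ⟨J, h₁, h₂⟩
        · exact .inl ⟨rfl, plus_iff_exists_step.2 ⟨_, h, .inr h''⟩⟩
        · exact .inr ⟨J, plus_iff_exists_step.2 ⟨_, h, .inr h₁⟩, h₂⟩
      | seq₂ h => exact .inr ⟨_, .single h, plus_iff.2 h'⟩
      | seq₃ h => exact absurd (plus_iff.2 h') not_plus_fail
      | brk => exact absurd (plus_iff.2 h') (not_plus_of_not_step fun _ => not_step_brk)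
  · rintro (⟨rfl, h⟩ | ⟨J, h₁, h₂⟩)
    · exact (plus_seq_of_plus h).2.2 rfl
    · have := (plus_seq_of_plus (Q := Q) h₁).2.1 J rfl
      exact plus_iff.2 ((plus_iff.1 this).trans (plus_iff.1 h₂))

theorem plus_seq_graph : Plus (.run (.seq P Q) G) (.graph H) ↔
    ∃ J, Plus (.run P G) (.graph J) ∧ Plus (.run Q J) (.graph H) := by
  rw [plus_seq_result (by trivial)]
  simp

theorem plus_seq_fail : Plus (.run (.seq P Q) G) .fail ↔
    Plus (.run P G) .fail ∨ ∃ J, Plus (.run P G) (.graph J) ∧ Plus (.run Q J) .fail := by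
  rw [plus_seq_result (by trivial)]
  simp

theorem plus_ifte {c : Config} (hc : c.IsResult) : Plus (.run (.ifte C P Q) G) c ↔
    ((∃ J, Plus (.run C G) (.graph J)) ∧ Plus (.run P G) c) ∨
      (Plus (.run C G) .fail ∧ Plus (.run Q G) c) := by
  rw [plus_iff_exists_step]
  constructor
  · rintro ⟨b, h, h'⟩
    cases h with
    | if₁ h => exact .inl ⟨⟨_, h⟩, h'.resolve_left (by rintro rfl; cases hc)⟩
    | if₂ h => exact .inr ⟨h, h'.resolve_left (by rintro rfl; cases hc)⟩
  · rintro (⟨⟨J, h⟩, h'⟩ | ⟨h, h'⟩)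
    · exact ⟨_, .if₁ h, .inr h'⟩
    · exact ⟨_, .if₂ h, .inr h'⟩

theorem plus_tryte {c : Config} (hc : c.IsResult) : Plus (.run (.tryte C P Q) G) c ↔
    (∃ J, Plus (.run C G) (.graph J) ∧ Plus (.run P J) c) ∨
      (Plus (.run C G) .fail ∧ Plus (.run Q G) c) := by
  rw [plus_iff_exists_step]
  constructor
  · rintro ⟨b, h, h'⟩
    cases h with
    | try₁ h => exact .inl ⟨_, h, h'.resolve_left (by rintro rfl; cases hc)⟩
    | try₂ h => exact .inr ⟨h, h'.resolve_left (by rintro rfl; cases hc)⟩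
  · rintro (⟨J, h, h'⟩ | ⟨h, h'⟩)
    · exact ⟨_, .try₁ h, .inr h'⟩
    · exact ⟨_, .try₂ h, .inr h'⟩

theorem plus_choice {c : Config} (hc : c.IsResult) : Plus (.run (.choice P Q) G) c ↔
    Plus (.run P G) c ∨ Plus (.run Q G) c := by
  rw [plus_iff_exists_step]
  constructor
  · rintro ⟨b, h, h'⟩
    cases h with
    | choice₁ => exact .inl (h'.resolve_left (by rintro rfl; cases hc))
    | choice₂ => exact .inr (h'.resolve_left (by rintro rfl; cases hc))
  · rintro (h | h)
    · exact ⟨_, .choice₁, .inr h⟩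
    · exact ⟨_, .choice₂, .inr h⟩

theorem plus_call_graph {rs : List RuleSchema} :
    Plus (.run (.call rs) G) (.graph H) ↔ RuleSetDerives rs G H := by
  rw [plus_iff_exists_step]
  constructor
  · rintro ⟨b, h, h'⟩
    cases h with
    | call₁ h =>
      obtain h' | h' := h'
      · cases h'
        exact h
      · exact absurd h' not_plus_graph
    | call₂ h =>
      obtain h' | h' := h'
      · cases h'
      · exact absurd h' not_plus_fail
  · exact fun h => ⟨_, .call₁ h, .inl rfl⟩

theorem plus_call_fail {rs : List RuleSchema} :
    Plus (.run (.call rs) G) .fail ↔ ¬ ∃ H, RuleSetDerives rs G H := by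
  rw [plus_iff_exists_step]
  constructor
  · rintro ⟨b, h, h'⟩
    cases h with
    | call₁ h =>
      obtain h' | h' := h'
      · cases h'
      · exact absurd h' not_plus_graph
    | call₂ h => exact h
  · exact fun h => ⟨_, .call₂ h, .inl rfl⟩

theorem plus_skip {c : Config} : Plus (.run .skip G) c ↔ .graph G = c := by
  rw [plus_iff_exists_step]
  constructor
  · rintro ⟨b, h, h'⟩
    cases h
    exact h'.resolve_right not_plus_graph
  · exact fun h => ⟨_, .skip, .inl h⟩

theorem plus_failCom {c : Config} : Plus (.run .fail G) c ↔ .fail = c := by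
  rw [plus_iff_exists_step]
  constructor
  · rintro ⟨b, h, h'⟩
    cases h
    exact h'.resolve_right not_plus_fail
  · exact fun h => ⟨_, .fail, .inl h⟩

theorem not_plus_brk {c : Config} : ¬ Plus (.run .brk G) c :=
  not_plus_of_not_step fun _ => not_step_brk

/-- A step of a loop either returns to the same loop or yields a graph, so failure is never reached;
failure of the body only ends the loop. -/
theorem not_plus_loop_fail : ¬ Plus (.run (.loop P) G) .fail := by
  rw [plus_iff]
  intro h
  suffices key : ∀ a, Relation.TransGen Step a .fail → ∀ G, a ≠ .run (.loop P) G from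
    key _ h _ rfl
  intro a h
  induction h using Relation.TransGen.head_induction_on with
  | single h =>
    rintro G rfl
    cases h
  | head h h' ih =>
    rintro G rfl
    cases h with
    | loop₁ => exact ih _ rfl
    | loop₂ => exact not_plus_graph (plus_iff.2 h')
    | loop₃ => exact not_plus_graph (plus_iff.2 h')

/-- An assertion that is expressed by a closed formula. -/
def Expressible (p : HostGraph → Prop) : Prop :=
  ∃ φ : ClosedFormula, ∀ G : HostGraph, G.Models φ ↔ p G

-- Expressible assertions and structural induction on programs

namespace Expressible

variable {p q : HostGraph → Prop}

theorem definable (h : Expressible p) :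
    Definable (N := Empty) (E := Empty) (X := fun _ => Empty) (fun G _ _ _ => p G) := by
  obtain ⟨φ, hφ⟩ := h
  exact (models_definable φ).congr fun G _ _ _ => (hφ G).symm

theorem of_definable
    (h : Definable (N := Empty) (E := Empty) (X := fun _ => Empty) (fun G _ _ _ => p G)) :
    Expressible p := h.exists_closedFormula

theorem congr (h : Expressible p) (hq : ∀ G, q G ↔ p G) : Expressible q :=
  (funext fun G => propext (hq G) : q = p) ▸ h

theorem const (a : Prop) : Expressible fun _ => a := of_definable (.const a)

theorem and (hp : Expressible p) (hq : Expressible q) : Expressible fun G => p G ∧ q G :=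
  of_definable (hp.definable.and hq.definable)

theorem or (hp : Expressible p) (hq : Expressible q) : Expressible fun G => p G ∨ q G :=
  of_definable (hp.definable.or hq.definable)

theorem not (hp : Expressible p) : Expressible fun G => ¬ p G := of_definable hp.definable.not

theorem models (φ : ClosedFormula) : Expressible fun G => G.Models φ := ⟨φ, fun _ => Iff.rfl⟩

/-- Calling a finite set of rule schemata is a finite disjunction over its members. -/
theorem pre_call (rs : List RuleSchema) (hp : Expressible p) :
    Expressible fun G => ∃ H, RuleSetDerives rs G H ∧ p H := by
  obtain ⟨φ, hφ⟩ := hp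
  simp only [← hφ]
  induction rs with
  | nil => exact (const False).congr fun G => by simp [RuleSetDerives]
  | cons r rs ih =>
    refine ((of_definable (r.pre_definable φ)).or ih).congr fun G => ?_
    simp only [RuleSetDerives, List.exists_mem_cons_iff]
    simp only [or_and_right, exists_or]

theorem post_call (rs : List RuleSchema) (hp : Expressible p) :
    Expressible fun H => ∃ G, p G ∧ RuleSetDerives rs G H := by
  obtain ⟨φ, hφ⟩ := hp
  simp only [← hφ]
  induction rs with
  | nil => exact (const False).congr fun G => by simp [RuleSetDerives]
  | cons r rs ih =>
    refine ((of_definable (r.post_definable φ)).or ih).congr fun G => ?_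
    simp only [RuleSetDerives, List.exists_mem_cons_iff]
    simp only [and_or_left, exists_or]

end Expressible

/-- Weakest existential preconditions and failure of loop-free programs are expressible. -/
theorem expressible_pre_fail (hP : P.LoopFree) :
    (∀ p : HostGraph → Prop, Expressible p →
      Expressible fun G => ∃ H, Plus (.run P G) (.graph H) ∧ p H) ∧
    Expressible fun G => Plus (.run P G) .fail := by
  induction P with
  | call rs =>
    simp only [plus_call_graph, plus_call_fail]
    exact ⟨fun p hp => .pre_call rs hp,
      -- A call fails exactly when no rule of the set is applicable, that is, when it has no result
      -- at all.
      ((Expressible.pre_call rs (.const True)).not).congr fun G => by simp⟩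
  | seq P Q ihP ihQ =>
    obtain ⟨hP₁, hP₂⟩ := ihP hP.1
    obtain ⟨hQ₁, hQ₂⟩ := ihQ hP.2
    simp only [plus_seq_graph, plus_seq_fail]
    -- Preconditions of a sequence compose, and its failure uses the precondition of `P` for the
    -- failure of `Q`; this is why both claims are proved together.
    refine ⟨fun p hp => (hP₁ _ (hQ₁ p hp)).congr fun G => ?_, hP₂.or (hP₁ _ hQ₂)⟩
    constructor
    · rintro ⟨H, ⟨J, h₁, h₂⟩, h⟩
      exact ⟨J, h₁, H, h₂, h⟩
    · rintro ⟨J, h₁, H, h₂, h⟩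
      exact ⟨H, ⟨J, h₁, h₂⟩, h⟩
  | ifte C P Q ihC ihP ihQ =>
    obtain ⟨hC₁, hC₂⟩ := ihC hP.1
    obtain ⟨hP₁, hP₂⟩ := ihP hP.2.1
    obtain ⟨hQ₁, hQ₂⟩ := ihQ hP.2.2
    -- The graph produced by the guard of `ifte` is discarded, so only the existence of a result
    -- matters; `tryte` continues on that graph instead.
    have hC := (hC₁ _ (.const True)).congr (q := fun G => ∃ J, Plus (.run C G) (.graph J))
      fun G => by simp
    constructor
    · intro p hp
      refine ((hC.and (hP₁ p hp)).or (hC₂.and (hQ₁ p hp))).congr fun G => ?_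
      simp only [plus_ifte (c := .graph _) trivial, or_and_right, exists_or, and_assoc,
        exists_and_left]
    · exact ((hC.and hP₂).or (hC₂.and hQ₂)).congr fun G => plus_ifte trivial
  | tryte C P Q ihC ihP ihQ =>
    obtain ⟨hC₁, hC₂⟩ := ihC hP.1
    obtain ⟨hP₁, hP₂⟩ := ihP hP.2.1
    obtain ⟨hQ₁, hQ₂⟩ := ihQ hP.2.2
    constructor
    · intro p hp
      refine ((hC₁ _ (hP₁ p hp)).or (hC₂.and (hQ₁ p hp))).congr fun G => ?_
      simp only [plus_tryte (c := .graph _) trivial, or_and_right, exists_or, and_assoc,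
        exists_and_left]
      refine or_congr ?_ Iff.rfl
      constructor
      · rintro ⟨H, ⟨J, h₁, h₂⟩, h⟩
        exact ⟨J, h₁, H, h₂, h⟩
      · rintro ⟨J, h₁, H, h₂, h⟩
        exact ⟨H, ⟨J, h₁, h₂⟩, h⟩
    · exact ((hC₁ _ hP₂).or (hC₂.and hQ₂)).congr fun G => plus_tryte trivial
  | loop P => cases hP
  | choice P Q ihP ihQ =>
    obtain ⟨hP₁, hP₂⟩ := ihP hP.1
    obtain ⟨hQ₁, hQ₂⟩ := ihQ hP.2
    constructor
    · intro p hp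
      refine ((hP₁ p hp).or (hQ₁ p hp)).congr fun G => ?_
      simp only [plus_choice (c := .graph _) trivial, or_and_right, exists_or]
    · exact (hP₂.or hQ₂).congr fun G => plus_choice trivial
  | brk =>
    exact ⟨fun p _ => (Expressible.const False).congr fun G => by simp [not_plus_brk],
      (Expressible.const False).congr fun G => by simp [not_plus_brk]⟩
  | skip =>
    exact ⟨fun p hp => hp.congr fun G => by simp [plus_skip],
      (Expressible.const False).congr fun G => by simp [plus_skip]⟩
  | fail =>
    exact ⟨fun p _ => (Expressible.const False).congr fun G => by simp [plus_failCom],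
      (Expressible.const True).congr fun G => by simp [plus_failCom]⟩

/-- Strongest postconditions of loop-free programs are expressible. -/
theorem expressible_post (hP : P.LoopFree) : ∀ p : HostGraph → Prop, Expressible p →
    Expressible fun H => ∃ G, p G ∧ Plus (.run P G) (.graph H) := by
  induction P with
  | call rs =>
    simp only [plus_call_graph]
    exact fun p hp => .post_call rs hp
  | seq P Q ihP ihQ =>
    intro p hp
    refine (ihQ hP.2 _ (ihP hP.1 p hp)).congr fun G => ?_
    simp only [plus_seq_graph]
    constructor
    · rintro ⟨H, h, J, h₁, h₂⟩
      exact ⟨J, ⟨H, h, h₁⟩, h₂⟩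
    · rintro ⟨J, ⟨H, h, h₁⟩, h₂⟩
      exact ⟨H, h, J, h₁, h₂⟩
  | ifte C P Q ihC ihP ihQ =>
    intro p hp
    obtain ⟨hC₁, hC₂⟩ := expressible_pre_fail hP.1
    have hC := (hC₁ _ (.const True)).congr (q := fun G => ∃ J, Plus (.run C G) (.graph J))
      fun G => by simp
    -- The guard leaves the graph unchanged, so its success or failure is added to the precondition
    -- of the chosen branch. A guard may both succeed and fail, hence the disjunction of the two
    -- branches need not be exclusive.
    refine ((ihP hP.2.1 _ (hp.and hC)).or (ihQ hP.2.2 _ (hp.and hC₂))).congr fun G => ?_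
    simp only [plus_ifte (c := .graph _) trivial, and_or_left, exists_or, and_assoc]
  | tryte C P Q ihC ihP ihQ =>
    intro p hp
    refine ((ihP hP.2.1 _ (ihC hP.1 p hp)).or
      (ihQ hP.2.2 _ (hp.and (expressible_pre_fail hP.1).2))).congr fun G => ?_
    simp only [plus_tryte (c := .graph _) trivial, and_or_left, exists_or, and_assoc]
    refine or_congr ?_ Iff.rfl
    constructor
    · rintro ⟨H, h, J, h₁, h₂⟩
      exact ⟨J, ⟨H, h, h₁⟩, h₂⟩
    · rintro ⟨J, ⟨H, h, h₁⟩, h₂⟩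
      exact ⟨H, h, J, h₁, h₂⟩
  | loop P => cases hP
  | choice P Q ihP ihQ =>
    intro p hp
    refine ((ihP hP.1 p hp).or (ihQ hP.2 p hp)).congr fun G => ?_
    simp only [plus_choice (c := .graph _) trivial, and_or_left, exists_or]
  | brk => exact fun p _ => (Expressible.const False).congr fun G => by simp [not_plus_brk]
  | skip => exact fun p hp => hp.congr fun G => by simp [plus_skip]
  | fail => exact fun p _ => (Expressible.const False).congr fun G => by simp [plus_failCom]

theorem Com.NonFailing.not_plus_fail (hP : P.NonFailing) : ¬ Plus (.run P G) .fail := by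
  induction hP generalizing G with
  | brk => exact not_plus_brk
  | skip => simp [plus_skip]
  | call rs hne h =>
    rw [plus_call_fail, not_not]
    obtain ⟨r, hr⟩ := List.exists_mem_of_ne_nil rs hne
    -- One applicable rule is enough, so nonemptiness of the set is what excludes failure.
    obtain ⟨H, hH⟩ := r.exists_derives_of_empty (h r hr).1 (h r hr).2 G
    exact ⟨H, r, hr, hH⟩
  | loop P => exact not_plus_loop_fail
  | seq P Q _ _ ihP ihQ =>
    rw [plus_seq_fail]
    rintro (h | ⟨J, -, h⟩)
    exacts [ihP h, ihQ h]
  | ifte C P Q _ _ ihP ihQ =>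
    rw [plus_ifte (c := .fail) trivial]
    rintro (⟨-, h⟩ | ⟨-, h⟩)
    exacts [ihP h, ihQ h]
  | tryte C P Q _ _ ihP ihQ =>
    rw [plus_tryte (c := .fail) trivial]
    rintro (⟨J, -, h⟩ | ⟨-, h⟩)
    exacts [ihP h, ihQ h]

/-- Failure of iteration commands is expressible. -/
theorem Com.IsIteration.expressible_fail (hP : P.IsIteration) :
    Expressible fun G => Plus (.run P G) .fail := by
  induction hP with
  | loopFree P h => exact (expressible_pre_fail h).2
  | nonFailing P h => exact (Expressible.const False).congr fun G => by simp [h.not_plus_fail]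
  | seq C P hC _ ih =>
    simp only [plus_seq_fail]
    exact (expressible_pre_fail hC).2.or ((expressible_pre_fail hC).1 _ ih)
  | assoc P Q R _ ih =>
    -- Both bracketings fail in the same three ways: `P` fails, `Q` fails after `P`, or `R` fails
    -- after both.
    refine ih.congr fun G => ?_
    simp only [plus_seq_fail, plus_seq_graph]
    constructor
    · rintro ((h | ⟨J, h₁, h₂⟩) | ⟨J, ⟨H, h₁, h₂⟩, h⟩)
      · exact .inl h
      · exact .inr ⟨J, h₁, .inl h₂⟩
      · exact .inr ⟨H, h₁, .inr ⟨J, h₂, h⟩⟩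
    · rintro (h | ⟨J, h₁, h₂ | ⟨H, h₂, h⟩⟩)
      · exact .inl (.inl h)
      · exact .inl (.inr ⟨J, h₁, h₂⟩)
      · exact .inr ⟨H, ⟨J, h₁, h₂⟩, h⟩

/-- The set of results on graphs satisfying `c` is itself a liberal postcondition, and every liberal
postcondition must contain it. -/
theorem isStrongestLiberalPost_of_forall {c d : Assertion}
    (h : ∀ H, d H ↔ ∃ G, c G ∧ Plus (.run P G) (.graph H)) : IsStrongestLiberalPost c P d :=
  ⟨fun G H hG hH => (h H).2 ⟨G, hG, hH⟩, fun d' hd' H hH => by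
    obtain ⟨G, hG, hGH⟩ := (h H).1 hH
    exact hd' G H hG hGH⟩

end GP2

theorem mainTheorem2 :
    (∀ P : GP2.Com, P.LoopFree →
      (∃ success : GP2.ClosedFormula, ∀ G : GP2.HostGraph, G.Models success ↔ P.Succeeds G) ∧
      (∀ c : GP2.ClosedFormula, ∃ slp : GP2.ClosedFormula,
        GP2.IsStrongestLiberalPost (fun G => G.Models c) P (fun H => H.Models slp))) ∧
    (∀ S : GP2.Com, S.IsIteration →
      ∃ failing : GP2.ClosedFormula, ∀ G : GP2.HostGraph, G.Models failing ↔ S.Fails G) := by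
  refine ⟨fun P hP => ⟨?_, fun c => ?_⟩, fun S hS => hS.expressible_fail⟩
  · exact ((GP2.expressible_pre_fail hP).1 _ (.const True)).congr fun G =>
      ⟨fun ⟨H, h⟩ => ⟨H, h, trivial⟩, fun ⟨H, h, _⟩ => ⟨H, h⟩⟩
  · obtain ⟨slp, h⟩ := GP2.expressible_post hP _ (.models c)
    exact ⟨slp, GP2.isStrongestLiberalPost_of_forall h⟩
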